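/- Fix integers $m,r\ge 1$ and $n\ge m+2$. For every dimension $p>n$ let $X_1,\dots,X_n$ be an i.i.d. sample from an absolutely continuous distribution on $\mathbb R^p$ with mean $\mu$ and covariance matrix $\Sigma=\sum_{i=1}^p\lambda_iu_iu_i^\top$, where $\lambda_1\ge\dots\ge\lambda_p$ and $u_1,\dots,u_p$ are orthonormal (all these objects depend on $p$; the samples for all $p$ live on one probability space). Let $S=\frac1n\sum_{i=1}^n(X_i-\bar X)(X_i-\bar X)^\top$ be the sample covariance matrix, with ordered eigenvalues $\hat\lambda_1\ge\hat\lambda_2\ge\cdots$ and orthonormal eigenvectors $\hat u_1,\hat u_2,\dots$. Assume: 1. (Spiked covariance) $\lambda_i=\sigma_i^2p+\tau_i^2$ for $i\le m$ and $\lambda_i=\tau_i^2$ for $m<i\le p$, where $\sigma_i^2>0$ are constants, $\tau_i^2>0$ (possibly depending on $p$) are bounded uniformly in $i$ and $p$, and $\frac1p\sum_{i=1}^p\tau_i^2\to\tau^2$ as $p\to\infty$ for some constant $\tau^2>0$. 2. ($\rho$-mixing) For each observation $i$, the standardized scores $z_{ji}=\lambda_j^{-1/2}u_j^\top(X_i-\mu)$,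 $j=1,\dots,p$, are for every $p$ the first $p$ terms of one infinite sequence of random variables that does not depend on $p$; the scores have uniformly bounded fourth moments, and after some permutation of its indices the infinite sequence is $\rho$-mixing. 3. (Reference directions) For every $p>n$ with $r\le p-m$, $v_1,\dots,v_r\in\mathbb R^p$ are linearly independent (non-random) unit vectors, whose Gram matrix $(v_i^\top v_j)_{i,j}$ converges entrywise to a non-singular matrix as $p\to\infty$. 4. (Alignment) With $\mathcal U_m=\operatorname{span}(u_1,\dots,u_m)$, as $p\to\infty$ the norms of the orthogonal projections of $v_i$ onto $\mathcal U_m$ converge to constants $a_i\in[0,1]$, and $v_i^\top u_j\to a_{ij}\in[-1,1]$ for $i\le r$, $j\le m$. Let $A$ be the $m\times r$ matrix whose $(j,i)$ entry is $a_{ij}$. Put $\hat{\mathcal U}_m=\operatorname{span}(\hat u_1,\dots,\hat u_m)$, $\mathcal S=\operatorname{span}(\hat u_1,\dots,\hat u_m,v_1,\dots,v_r)$, $\tilde\lambda=\frac1{n-m-1}\sum_{i=m+1}^{n-1}\hat\lambda_i$, $S_m=\sum_{i=1}^m\hat\lambda_i\hat u_i\hat u_i^\top$ and $d_i=-\tilde\lambda(S_m-\tilde\lambda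 I_p)^{-1}v_i$ (the inverse exists almost surely), and let $\hat{\mathcal U}_m^{ARG}$ be the orthogonal complement of $\operatorname{span}(d_1,\dots,d_r)$ within $\mathcal S$. Let $\theta_k(\mathcal T_1,\mathcal T_2)=\arccos\sigma_k(Q_1^\top Q_2)$ be the $k$-th principal angle between two subspaces, where $Q_1,Q_2$ are matrices whose columns form orthonormal bases of $\mathcal T_1,\mathcal T_2$ and $\sigma_k$ is the $k$-th largest singular value. Then, as $p\to\infty$: (i) If $A$ has full rank, i.e. $\operatorname{rank}A=\min(m,r)$, then $\mathbb P\big(\theta_k(\hat{\mathcal U}_m^{ARG},\mathcal U_m)<\theta_k(\hat{\mathcal U}_m,\mathcal U_m)\big)\to1$ for $k=1,\dots,m$. (ii) If $A$ is neither of full rank nor the zero matrix, then $\mathbb P\big(\theta_k(\hat{\mathcal U}_m^{ARG},\mathcal U_m)<\theta_k(\hat{\mathcal U}_m,\mathcal U_m)+\varepsilon\big)\to1$ for every $\varepsilon>0$ and $k=1,\dots,m$. (iii) If $A=0$, then $\theta_k(\hat{\mathcal U}_m^{ARG},\mathcal U_m)-\theta_k(\hat{\mathcal U}_m,\mathcal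 U_m)\to0$ in probability for $k=1,\dots,m$. -/

import Mathlib

open MeasureTheory ProbabilityTheory Filter Topology
open scoped ENNReal

namespace ARG

/-- `ℝᵖ` with its Euclidean inner product. -/
abbrev Vec (p : ℕ) : Type := EuclideanSpace ℝ (Fin p)

/-! ### Eigendecompositions and spans

All lists of eigenvalues and eigenvectors are indexed by `ℕ`, starting at `0`; in dimension `p`
only the entries with index `< p` are meaningful. -/

/-- `M = ∑ i < p, l i • u i (u i)ᵀ` is an eigendecomposition of the `p × p` matrix `M`, with
orthonormal eigenvectors and eigenvalues in non-increasing order. -/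
structure IsEigendecomposition {p : ℕ} (M : Matrix (Fin p) (Fin p) ℝ) (l : ℕ → ℝ)
    (u : ℕ → Vec p) : Prop where
  orthonormal : Orthonormal ℝ (fun i : Fin p => u i)
  eigenvector : ∀ i : ℕ, i < p → Matrix.toEuclideanLin M (u i) = l i • u i
  ordered : ∀ i j : ℕ, i ≤ j → j < p → l j ≤ l i

/-- The span of the `m` leading vectors of a list. -/
def leadingSpan {p : ℕ} (m : ℕ) (u : ℕ → Vec p) : Submodule ℝ (Vec p) :=
  Submodule.span ℝ (Set.range fun i : Fin m => u i)

/-- The `k`-th principal angle (`k = 0, 1, …`, in non-decreasing order) between the subspaces `T₁`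
and `T₂`: the arccosine of the `k`-th largest singular value of the orthogonal projection
`T₂ → T₁`, whose matrix in orthonormal bases with column matrices `Q₁`, `Q₂` is `Q₁ᵀ Q₂`. -/
noncomputable def principalAngle {p : ℕ} (k : ℕ) (T₁ T₂ : Submodule ℝ (Vec p)) : ℝ :=
  Real.arccos
    (((T₁.orthogonalProjectionOnto : Vec p →ₗ[ℝ] T₁) ∘ₗ T₂.subtype).singularValues k)

/-! ### The sample and its population quantities -/

section Sample

variable {Ω : Type*} [MeasurableSpace Ω]

/-- `X 0, …, X (n - 1)` is a sample (independent and identically distributed) from an absolutely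
continuous distribution on `ℝᵖ` with mean `mu` and covariance matrix `Sig`. -/
structure IsSample (P : Measure Ω) {n p : ℕ} (X : Fin n → Ω → Vec p) (mu : Vec p)
    (Sig : Matrix (Fin p) (Fin p) ℝ) : Prop where
  measurable : ∀ i, Measurable (X i)
  indep : iIndepFun X P
  identDistrib : ∀ i j, IdentDistrib (X i) (X j) P P
  absolutelyContinuous : ∀ i, P.map (X i) ≪ volume
  memLp : ∀ i, MemLp (X i) 2 P
  mean : ∀ i, ∫ ω, X i ω ∂P = mu
  cov : ∀ i a b, cov[fun ω => X i ω a, fun ω => X i ω b; P] = Sig a b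

/-- The standardized true PC score `z = λ^{-1/2} uᵀ (x - μ)` of an observation `x`, for a PC with
variance `l` and direction `u`. -/
noncomputable def pcScore {p : ℕ} (mu : Vec p) (l : ℝ) (u x : Vec p) : ℝ :=
  (√l)⁻¹ * inner ℝ u (x - mu)

/-- The maximal correlation coefficient between two σ-algebras: the supremum of `|corr(f, g)|`
over square-integrable `f`, `g` measurable with respect to `𝒜` and `ℬ` respectively. -/
noncomputable def maximalCorrelation (P : Measure Ω) (𝒜 ℬ : MeasurableSpace Ω) : ℝ≥0∞ :=
  ⨆ (f : Ω → ℝ) (g : Ω → ℝ) (_ : Measurable[𝒜] f) (_ : Measurable[ℬ] g)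
    (_ : MemLp f 2 P) (_ : MemLp g 2 P),
    ENNReal.ofReal (|cov[f, g; P]| / (√Var[f; P] * √Var[g; P]))

/-- The `k`-th `ρ`-mixing coefficient of a sequence: the supremum over `l` of the maximal
correlation between `σ(Y_j : j ≤ l)` and `σ(Y_j : j ≥ l + k)`. -/
noncomputable def rhoCoefficient (P : Measure Ω) (Y : ℕ → Ω → ℝ) (k : ℕ) : ℝ≥0∞ :=
  ⨆ l : ℕ, maximalCorrelation P
    (⨆ j ∈ Set.Iic l, MeasurableSpace.comap (Y j) inferInstance)
    (⨆ j ∈ Set.Ici (l + k), MeasurableSpace.comap (Y j) inferInstance)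

/-- The `ρ`-mixing condition: `ρ(k) → 0` as `k → ∞`. -/
def IsRhoMixing (P : Measure Ω) (Y : ℕ → Ω → ℝ) : Prop :=
  Tendsto (rhoCoefficient P Y) atTop (𝓝 0)

end Sample

/-! ### The assumptions, along dimensions `p > n` with `n` fixed -/

/-- Spiked eigenvalues `lam p i`: they equal `σᵢ² p + τ²_{p,i}` for the `m` leading indices and
`τ²_{p,i}` for the others, where the `τ²_{p,i}` are uniformly bounded and their average
converges to some `τ² > 0`. -/
def SpikedCovariance (n m : ℕ) (lam : ℕ → ℕ → ℝ) : Prop :=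
  ∃ (sigSq : Fin m → ℝ) (tauSq : ℕ → ℕ → ℝ) (tauSqLim : ℝ),
    (∀ i, 0 < sigSq i) ∧
    (∀ p, n < p → ∀ i < p, 0 < tauSq p i) ∧
    (∀ p, n < p → ∀ i : Fin m, lam p i = sigSq i * p + tauSq p i) ∧
    (∀ p, n < p → ∀ i < p, m ≤ i → lam p i = tauSq p i) ∧
    (∃ C : ℝ, ∀ p, n < p → ∀ i < p, tauSq p i ≤ C) ∧
    0 < tauSqLim ∧
    Tendsto (fun p : ℕ => (∑ i ∈ Finset.range p, tauSq p i) / (p : ℝ)) atTop (𝓝 tauSqLim)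

/-- For each observation `i`, the true PC scores `(z_{0 i}, …, z_{p-1, i})` are, for every `p`,
the truncation of one infinite sequence `(Z 0 i, Z 1 i, …)`; the scores have uniformly bounded
fourth moments and the infinite sequence is `ρ`-mixing under some permutation. -/
def RhoMixingScores {Ω : Type*} [MeasurableSpace Ω] (P : Measure Ω) {n : ℕ}
    (X : (p : ℕ) → Fin n → Ω → Vec p) (mu : (p : ℕ) → Vec p) (lam : ℕ → ℕ → ℝ)
    (u : (p : ℕ) → ℕ → Vec p) : Prop :=
  ∃ Z : ℕ → Fin n → Ω → ℝ,
    (∀ p, n < p → ∀ j < p, ∀ i ω, pcScore (mu p) (lam p j) (u p j) (X p i ω) = Z j i ω) ∧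
    (∃ C : ℝ, ∀ j i, Integrable (fun ω => Z j i ω ^ 4) P ∧ ∫ ω, Z j i ω ^ 4 ∂P ≤ C) ∧
    (∀ i, ∃ π : Equiv.Perm ℕ, IsRhoMixing P (fun j => Z (π j) i))

/-- The reference directions are linearly independent unit vectors in every dimension `p > n`
with `r ≤ p - m`, and their Gram matrix converges to a non-singular matrix. -/
def ReferencesNonsingular (n m : ℕ) {r : ℕ} (v : (p : ℕ) → Fin r → Vec p) : Prop :=
  (∀ p, n < p → m + r ≤ p → (∀ i, ‖v p i‖ = 1) ∧ LinearIndependent ℝ (v p)) ∧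
  ∃ VG : Matrix (Fin r) (Fin r) ℝ, IsUnit VG.det ∧
    ∀ i j, Tendsto (fun p : ℕ => inner ℝ (v p i) (v p j)) atTop (𝓝 (VG i j))

/-- The norms of the projections of the reference directions onto the true PC subspace converge,
and `v_iᵀ u_j → A j i` for the `m` leading true PC directions `u_j`. -/
def ReferencesAligned {m r : ℕ} (u : (p : ℕ) → ℕ → Vec p) (v : (p : ℕ) → Fin r → Vec p)
    (A : Matrix (Fin m) (Fin r) ℝ) : Prop :=
  (∃ a : Fin r → ℝ, ∀ i, a i ∈ Set.Icc (0 : ℝ) 1 ∧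
    Tendsto (fun p : ℕ => ‖(leadingSpan m (u p)).orthogonalProjectionOnto (v p i)‖)
      atTop (𝓝 (a i))) ∧
  ∀ i (j : Fin m), A j i ∈ Set.Icc (-1 : ℝ) 1 ∧
    Tendsto (fun p : ℕ => inner ℝ (v p i) (u p j)) atTop (𝓝 (A j i))

/-! ### The estimators -/

/-- The sample covariance matrix `∑ i, (x i - x̄)(x i - x̄)ᵀ / n`. -/
noncomputable def sampleCov {n p : ℕ} (x : Fin n → Vec p) : Matrix (Fin p) (Fin p) ℝ :=
  let xbar : Vec p := (n : ℝ)⁻¹ • ∑ i, x i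
  (n : ℝ)⁻¹ • ∑ i, Matrix.vecMulVec ⇑(x i - xbar) ⇑(x i - xbar)

/-- The average `λ̃` of the non-spiked sample eigenvalues, those of (`0`-based) index
`m, …, n - 2`. -/
noncomputable def ridge (n m : ℕ) (l : ℕ → ℝ) : ℝ :=
  (∑ i ∈ Finset.Ico m (n - 1), l i) / ((n : ℝ) - m - 1)

/-- The spiked component `∑ i < m, λ̂ᵢ ûᵢ ûᵢᵀ` of the sample covariance matrix. -/
noncomputable def spikedPart {p : ℕ} (m : ℕ) (l : ℕ → ℝ) (u : ℕ → Vec p) :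
    Matrix (Fin p) (Fin p) ℝ :=
  ∑ i ∈ Finset.range m, l i • Matrix.vecMulVec ⇑(u i) ⇑(u i)

/-- The negatively ridged discriminant vector `d = -λ̃ (S_m - λ̃ I)⁻¹ v`. -/
noncomputable def ridgedVector {p : ℕ} (n m : ℕ) (l : ℕ → ℝ) (u : ℕ → Vec p) (v : Vec p) :
    Vec p :=
  (-ridge n m l) •
    Matrix.toEuclideanLin
      ((spikedPart m l u - ridge n m l • (1 : Matrix (Fin p) (Fin p) ℝ))⁻¹) v

/-- The signal subspace, spanned by the `m` leading sample PC directions and the references. -/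
def signalSubspace {p r : ℕ} (m : ℕ) (u : ℕ → Vec p) (v : Fin r → Vec p) :
    Submodule ℝ (Vec p) :=
  leadingSpan m u ⊔ Submodule.span ℝ (Set.range v)

/-- The Adaptive Reference-Guided subspace: the orthogonal complement, within the signal subspace,
of the span of the negatively ridged discriminant vectors. Here `l`, `u` are the sample
eigenvalues and eigenvectors. -/
noncomputable def argSubspace {p r : ℕ} (n m : ℕ) (l : ℕ → ℝ) (u : ℕ → Vec p)
    (v : Fin r → Vec p) : Submodule ℝ (Vec p) :=
  signalSubspace m u v ⊓ (Submodule.span ℝ (Set.range fun i => ridgedVector n m l u (v i)))ᗮ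

end ARG

open ARG

/-!
The argument is the comparison of two quadratic forms on the true PC subspace `𝒰`, written in the
coordinates given by the true directions `u`.

*Reduction to finitely many limits.* With `n` fixed and `p → ∞`, everything relevant is seen
through the observations divided by `√p`. Their `n × n` Gram matrix converges, by laws of large
numbers for the scores (`tendstoInMeasure_of_orthonormal`, `tendstoInMeasure_of_rhoMixing`), to
`Nᵀ N + t (1 - n⁻¹ 1 1ᵀ)` after centering, where `N` is the `m × n` matrix of centered leading
scores scaled by the spikes and `t = τ²`. The noise parts of their inner products with the
references vanish. An eigenvector of the sample covariance matrix is a combination of the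
observations, so its inner products with `u` and `v` converge as well, and `DualEigen` identifies
the limits: the `j`-th sample direction behaves like `√(c j) e j` with `e` an orthonormal eigenbasis
of `N Nᵀ` in `𝒰` and `c j = 1 - t / ℓ j ∈ (0, 1)`, where `ℓ j` is the limit of the eigenvalue times
`n / p`; the ridge `λ̃`, rescaled likewise, tends to `t`. This is the content of the structure
`AlignedLimits` and of the theorem `exists_alignedLimits`.

*The two forms.* The squared length of the projection of a vector `x` of `𝒰` onto the sample PC
subspace tends to `∑ j, c j ⟪e j, x⟫²`. The limit of `λ̃ / (λ̂ⱼ - λ̃)` is `(1 - c j) / c j`, exactly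
the value that makes the ridged vectors `d` asymptotically orthogonal to `𝒰`. Hence removing them
from the signal space loses nothing, and the form of the adaptive subspace is
`∑ j, c j ⟪e j, x⟫² + gain x`, where `gain` is the positive semidefinite contribution of the
components of the references orthogonal to the sample PC subspace (`projectionTendsto_complement`).
Squared cosines of principal angles are the ordered eigenvalues of these forms. If `A = 0`, then
`gain = 0` and the angles have equal limits. If `A ≠ 0`, all eigenvalues increase strictly as soon
as `gain` vanishes at no eigenvector of the first form (`exists_lt_cosSq`), that is, as soon as no
eigenvector of `N Nᵀ` is orthogonal to a given nonzero column of `A`. This is the nonvanishing of a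
Krylov determinant, a polynomial in the leading scores that is not identically zero, so it holds
almost surely by absolute continuity (`ae_krylovDet_ne_zero`). In particular the strict inequality
requires only `A ≠ 0`, whatever the rank of `A`.

*Back to probabilities.* Sample eigenvectors are arbitrary choices and need not be measurable
functions of the sample point, so limits are taken along ultrafilters on pairs `(p, ω)`, where
bounded quantities converge, and `tendsto_measure_zero_of_ultrafilter` turns the outcome into
statements on outer probabilities.
-/

namespace ARG

/-! ### Variational bounds for singular values and principal angles -/

section SingularValues

variable {V W : Type*} [NormedAddCommGroup V] [InnerProductSpace ℝ V] [FiniteDimensional ℝ V]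
  [NormedAddCommGroup W] [InnerProductSpace ℝ W] [FiniteDimensional ℝ W]

lemma norm_sq_map_eq_sum_singularValues (L : V →ₗ[ℝ] W) (x : V) :
    ‖L x‖ ^ 2 = ∑ i : Fin (Module.finrank ℝ V), L.singularValues i ^ 2 *
      inner ℝ (L.isSymmetric_adjoint_comp_self.eigenvectorBasis rfl i) x ^ 2 := by
  set b := L.isSymmetric_adjoint_comp_self.eigenvectorBasis rfl with hb
  have h1 : ‖L x‖ ^ 2 = inner ℝ ((L.adjoint ∘ₗ L) x) x := by
    rw [LinearMap.comp_apply, LinearMap.adjoint_inner_left, real_inner_self_eq_norm_sq]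
  rw [h1, ← b.sum_inner_mul_inner]
  refine Finset.sum_congr rfl fun i _ => ?_
  have h2 : inner ℝ ((L.adjoint ∘ₗ L) x) (b i) = L.singularValues i ^ 2 * inner ℝ (b i) x := by
    rw [L.isSymmetric_adjoint_comp_self, hb,
      L.isSymmetric_adjoint_comp_self.apply_eigenvectorBasis rfl i,
      L.sq_singularValues_fin rfl i, real_inner_smul_right, real_inner_comm]
    rfl
  rw [h2]; ring

/-- A subspace whose dimension exceeds the number of linear constraints contains a nonzero vector
satisfying all of them. -/
lemma exists_mem_ne_zero_inner_eq_zero {κ : Type*} [Fintype κ] (E : Submodule ℝ V) (q : κ → V)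
    (h : Fintype.card κ < Module.finrank ℝ E) :
    ∃ x ∈ E, x ≠ 0 ∧ ∀ i, inner ℝ (q i) x = 0 := by
  let f : E →ₗ[ℝ] (κ → ℝ) := LinearMap.pi fun i => (innerₛₗ ℝ (q i)) ∘ₗ E.subtype
  have hker : LinearMap.ker f ≠ ⊥ := LinearMap.ker_ne_bot_of_finrank_lt (by simpa using h)
  obtain ⟨x, hx, hx0⟩ := Submodule.exists_mem_ne_zero_of_ne_bot hker
  refine ⟨x, x.2, by simpa using hx0, fun i => ?_⟩
  exact congrFun (LinearMap.mem_ker.1 hx) i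

/-- One half of the Courant–Fischer principle: a lower bound on a subspace of dimension `k + 1` is
a lower bound for the `k`-th singular value. -/
lemma le_sq_singularValues (L : V →ₗ[ℝ] W) {k : ℕ} (E : Submodule ℝ V)
    (hE : k + 1 ≤ Module.finrank ℝ E) {c : ℝ} (h : ∀ x ∈ E, c * ‖x‖ ^ 2 ≤ ‖L x‖ ^ 2) :
    c ≤ L.singularValues k ^ 2 := by
  set b := L.isSymmetric_adjoint_comp_self.eigenvectorBasis rfl with hb
  have hk : k ≤ Module.finrank ℝ V := by
    have := Submodule.finrank_le E
    omega
  obtain ⟨x, hxE, hx0, hx⟩ := exists_mem_ne_zero_inner_eq_zero E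
    (fun i : Fin k => b (Fin.castLE hk i)) (by simpa using hE)
  have h1 : ‖L x‖ ^ 2 ≤ L.singularValues k ^ 2 * ‖x‖ ^ 2 := by
    rw [norm_sq_map_eq_sum_singularValues, ← b.sum_sq_inner_right x, Finset.mul_sum]
    refine Finset.sum_le_sum fun i _ => ?_
    by_cases hi : (i : ℕ) < k
    · have := hx ⟨i, hi⟩
      rw [show Fin.castLE hk ⟨i, hi⟩ = i from rfl] at this
      rw [← hb, this]; simp
    · have h2 := L.singularValues_antitone (not_lt.1 hi)
      have h3 := L.singularValues_nonneg i
      gcongr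
  have h4 := h x hxE
  have h5 : 0 < ‖x‖ ^ 2 := by positivity
  exact le_of_mul_le_mul_right (h4.trans h1) h5

/-- The other half of the Courant–Fischer principle: an upper bound on a subspace of codimension `k`
is an upper bound for the `k`-th singular value. -/
lemma sq_singularValues_le (L : V →ₗ[ℝ] W) {k : ℕ} (hk : k < Module.finrank ℝ V)
    (E : Submodule ℝ V) (hE : Module.finrank ℝ V ≤ Module.finrank ℝ E + k) {c : ℝ}
    (h : ∀ x ∈ E, ‖L x‖ ^ 2 ≤ c * ‖x‖ ^ 2) :
    L.singularValues k ^ 2 ≤ c := by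
  set b := L.isSymmetric_adjoint_comp_self.eigenvectorBasis rfl with hb
  obtain ⟨x, hxE, hx0, hx⟩ := exists_mem_ne_zero_inner_eq_zero E
    (fun i : Fin (Module.finrank ℝ V - (k + 1)) =>
      b ⟨k + 1 + i, by omega⟩) (by simp; omega)
  have h1 : L.singularValues k ^ 2 * ‖x‖ ^ 2 ≤ ‖L x‖ ^ 2 := by
    rw [norm_sq_map_eq_sum_singularValues, ← b.sum_sq_inner_right x, Finset.mul_sum]
    refine Finset.sum_le_sum fun i _ => ?_
    by_cases hi : k < (i : ℕ)
    · have := hx ⟨i - (k + 1), by omega⟩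
      have h6 : (⟨k + 1 + (i - (k + 1)), by omega⟩ : Fin (Module.finrank ℝ V)) = i := by
        ext; simp; omega
      simp only [h6] at this
      rw [← hb, this]; simp
    · have h2 := L.singularValues_antitone (not_lt.1 hi)
      have h3 := L.singularValues_nonneg k
      gcongr
  have h4 := h x hxE
  have h5 : 0 < ‖x‖ ^ 2 := by positivity
  exact le_of_mul_le_mul_right (h1.trans h4) h5

end SingularValues

/-- The vector with coordinates `x` with respect to the `m` leading vectors of a list. -/
noncomputable def leadingComb {p : ℕ} (m : ℕ) (u : ℕ → Vec p) :
    EuclideanSpace ℝ (Fin m) →ₗ[ℝ] Vec p where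
  toFun x := ∑ a, x a • u a
  map_add' x y := by simp [add_smul, Finset.sum_add_distrib]
  map_smul' c x := by simp [mul_smul, Finset.smul_sum]

lemma leadingComb_mem {p m : ℕ} (u : ℕ → Vec p) (x : EuclideanSpace ℝ (Fin m)) :
    leadingComb m u x ∈ leadingSpan m u := by
  change ∑ a, x a • u a ∈ leadingSpan m u
  exact Submodule.sum_mem _ fun a _ =>
    Submodule.smul_mem _ _ (Submodule.subset_span (Set.mem_range_self a))

lemma norm_leadingComb {p m : ℕ} {u : ℕ → Vec p} (hu : Orthonormal ℝ (fun i : Fin m => u i))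
    (x : EuclideanSpace ℝ (Fin m)) : ‖leadingComb m u x‖ = ‖x‖ := by
  have h : ‖leadingComb m u x‖ ^ 2 = ‖x‖ ^ 2 := by
    rw [← real_inner_self_eq_norm_sq]
    change inner ℝ (∑ a, x a • u a) (∑ a, x a • u a) = _
    rw [hu.inner_sum, EuclideanSpace.norm_sq_eq]
    simp [sq]
  exact (sq_eq_sq₀ (norm_nonneg _) (norm_nonneg _)).1 h

lemma finrank_leadingSpan {p m : ℕ} {u : ℕ → Vec p}
    (hu : Orthonormal ℝ (fun i : Fin m => u i)) :
    Module.finrank ℝ (leadingSpan m u) = m := by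
  exact (finrank_span_eq_card hu.linearIndependent).trans (Fintype.card_fin m)

lemma exists_leadingComb_eq {p m : ℕ} (u : ℕ → Vec p) {y : Vec p} (hy : y ∈ leadingSpan m u) :
    ∃ x : EuclideanSpace ℝ (Fin m), leadingComb m u x = y := by
  obtain ⟨c, hc⟩ := (Submodule.mem_span_range_iff_exists_fun ℝ).1 hy
  exact ⟨WithLp.toLp 2 c, hc⟩

/-- The coordinates of the vectors of the leading span, for orthonormal leading vectors. -/
noncomputable def leadingIso {p m : ℕ} {u : ℕ → Vec p}
    (hu : Orthonormal ℝ (fun i : Fin m => u i)) :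
    EuclideanSpace ℝ (Fin m) ≃ₗ[ℝ] leadingSpan m u :=
  LinearEquiv.ofBijective ((leadingComb m u).codRestrict _ (leadingComb_mem u)) <| by
    constructor
    · rw [← LinearMap.ker_eq_bot, LinearMap.ker_eq_bot']
      intro x hx
      have h : leadingComb m u x = 0 := congrArg Subtype.val hx
      have := norm_leadingComb hu x
      rw [h, norm_zero] at this
      exact norm_eq_zero.1 this.symm
    · rintro ⟨y, hy⟩
      obtain ⟨x, hx⟩ := exists_leadingComb_eq u hy
      exact ⟨x, Subtype.ext hx⟩

/-- The square of the cosine of the `k`-th principal angle. -/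
noncomputable def cosSq {p : ℕ} (k : ℕ) (T₁ T₂ : Submodule ℝ (Vec p)) : ℝ :=
  (((T₁.orthogonalProjectionOnto : Vec p →ₗ[ℝ] T₁) ∘ₗ T₂.subtype).singularValues k) ^ 2

lemma principalAngle_eq {p : ℕ} (k : ℕ) (T₁ T₂ : Submodule ℝ (Vec p)) :
    principalAngle k T₁ T₂ = Real.arccos (√(cosSq k T₁ T₂)) := by
  rw [principalAngle, cosSq, Real.sqrt_sq (LinearMap.singularValues_nonneg _ _)]

section

variable {p m : ℕ} {u : ℕ → Vec p} (T : Submodule ℝ (Vec p))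

lemma le_cosSq (hu : Orthonormal ℝ (fun i : Fin m => u i)) {k : ℕ}
    (E : Submodule ℝ (EuclideanSpace ℝ (Fin m))) (hE : k + 1 ≤ Module.finrank ℝ E) {c : ℝ}
    (h : ∀ x ∈ E, c * ‖x‖ ^ 2 ≤ ‖T.starProjection (leadingComb m u x)‖ ^ 2) :
    c ≤ cosSq k T (leadingSpan m u) := by
  refine le_sq_singularValues _ (E.map (leadingIso hu).toLinearMap) ?_ ?_
  · rwa [LinearEquiv.finrank_map_eq]
  · rintro _ ⟨x, hx, rfl⟩
    have := h x hx
    rw [← norm_leadingComb hu] at this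
    exact this

lemma cosSq_le (hu : Orthonormal ℝ (fun i : Fin m => u i)) {k : ℕ} (hk : k < m)
    (E : Submodule ℝ (EuclideanSpace ℝ (Fin m))) (hE : m ≤ Module.finrank ℝ E + k) {c : ℝ}
    (h : ∀ x ∈ E, ‖T.starProjection (leadingComb m u x)‖ ^ 2 ≤ c * ‖x‖ ^ 2) :
    cosSq k T (leadingSpan m u) ≤ c := by
  refine sq_singularValues_le _ ?_ (E.map (leadingIso hu).toLinearMap) ?_ ?_
  · rwa [finrank_leadingSpan hu]
  · rwa [LinearEquiv.finrank_map_eq, finrank_leadingSpan hu]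
  · rintro _ ⟨x, hx, rfl⟩
    have := h x hx
    rw [← norm_leadingComb hu] at this
    exact this

end

/-! ### Limits of principal angles -/

section AngleLimits

variable {m : ℕ}

lemma exists_submodule_inner_eq_zero (e : OrthonormalBasis (Fin m) ℝ (EuclideanSpace ℝ (Fin m)))
    (s : Finset (Fin m)) :
    ∃ E : Submodule ℝ (EuclideanSpace ℝ (Fin m)), Module.finrank ℝ E = s.card ∧
      ∀ x ∈ E, ∀ j ∉ s, inner ℝ (e j) x = 0 := by
  refine ⟨Submodule.span ℝ (Set.range fun i : s => e i), ?_, ?_⟩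
  · have h : LinearIndependent ℝ fun i : s => e i :=
      (e.orthonormal.comp _ Subtype.val_injective).linearIndependent
    exact (finrank_span_eq_card h).trans (Fintype.card_coe s)
  · intro x hx j hj
    refine Submodule.span_induction ?_ (by simp) ?_ ?_ hx
    · rintro _ ⟨i, rfl⟩
      have : j ≠ i := fun h => hj (h ▸ i.2)
      exact e.orthonormal.2 this
    · intro x y _ _ hx hy
      rw [inner_add_right, hx, hy, add_zero]
    · intro a x _ hx
      rw [inner_smul_right, hx, mul_zero]

/-- The squared lengths of the projections of `∑ a, x a • u a` onto the subspaces `T i` converge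
to `Q x`, uniformly for `x` in the unit ball. The ambient dimension `p i` may vary, and the
coordinates `x` make the forms comparable. -/
def ProjectionTendsto {ι : Type*} (l : Filter ι) {p : ι → ℕ}
    (T : (i : ι) → Submodule ℝ (Vec (p i))) (u : (i : ι) → ℕ → Vec (p i))
    (Q : EuclideanSpace ℝ (Fin m) → ℝ) : Prop :=
  ∀ ε > 0, ∀ᶠ i in l, ∀ x : EuclideanSpace ℝ (Fin m),
    |‖(T i).starProjection (leadingComb m (u i) x)‖ ^ 2 - Q x| ≤ ε * ‖x‖ ^ 2

variable {ι : Type*} {l : Filter ι} {p : ι → ℕ} {T : (i : ι) → Submodule ℝ (Vec (p i))}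
  {u : (i : ι) → ℕ → Vec (p i)} {Q : EuclideanSpace ℝ (Fin m) → ℝ}

lemma norm_sq_starProjection_leadingComb {p : ℕ} (T : Submodule ℝ (Vec p)) (u : ℕ → Vec p)
    (x : EuclideanSpace ℝ (Fin m)) :
    ‖T.starProjection (leadingComb m u x)‖ ^ 2 =
      ∑ a : Fin m, ∑ b : Fin m, x a * x b * inner ℝ (u a) (T.starProjection (u b)) := by
  have h : ‖T.starProjection (leadingComb m u x)‖ ^ 2 =
      inner ℝ (leadingComb m u x) (T.starProjection (leadingComb m u x)) := by
    rw [← real_inner_self_eq_norm_sq, Submodule.inner_starProjection_left_eq_right,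
      Submodule.starProjection_eq_self_iff.2 (Submodule.starProjection_apply_mem _ _)]
  rw [h]
  change inner ℝ (∑ a, x a • u a) (T.starProjection (∑ b, x b • u b)) = _
  simp only [map_sum, map_smul, sum_inner, inner_sum, real_inner_smul_left,
    real_inner_smul_right]
  rw [Finset.sum_comm]
  refine Finset.sum_congr rfl fun a _ => Finset.sum_congr rfl fun b _ => by ring

lemma projectionTendsto_of_entries (G : Matrix (Fin m) (Fin m) ℝ)
    (h : ∀ a b : Fin m, Tendsto (fun i => inner ℝ (u i a) ((T i).starProjection (u i b))) l
      (𝓝 (G a b))) :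
    ProjectionTendsto l T u (fun x => ∑ a : Fin m, ∑ b : Fin m, x a * x b * G a b) := by
  intro ε hε
  have h0 : Tendsto (fun i => ∑ a : Fin m, ∑ b : Fin m,
      |inner ℝ (u i a) ((T i).starProjection (u i b)) - G a b|) l (𝓝 0) := by
    have : (0 : ℝ) = ∑ a : Fin m, ∑ b : Fin m, |G a b - G a b| := by simp
    rw [this]
    exact tendsto_finsetSum _ fun a _ => tendsto_finsetSum _ fun b _ =>
      ((h a b).sub_const _).abs
  filter_upwards [h0.eventually (gt_mem_nhds hε)] with i hi x
  rw [norm_sq_starProjection_leadingComb, ← Finset.sum_sub_distrib]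
  simp_rw [← Finset.sum_sub_distrib, ← mul_sub]
  have hx : ∀ a : Fin m, |x a| ≤ ‖x‖ := fun a => PiLp.norm_apply_le x a
  calc _ ≤ ∑ a : Fin m, ∑ b : Fin m, ‖x‖ * ‖x‖ *
        |inner ℝ (u i a) ((T i).starProjection (u i b)) - G a b| := by
        refine (Finset.abs_sum_le_sum_abs _ _).trans (Finset.sum_le_sum fun a _ => ?_)
        refine (Finset.abs_sum_le_sum_abs _ _).trans (Finset.sum_le_sum fun b _ => ?_)
        rw [abs_mul, abs_mul]
        gcongr
        exacts [hx a, hx b]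
    _ ≤ ε * ‖x‖ ^ 2 := by
        simp_rw [← Finset.mul_sum]
        nlinarith [sq_nonneg ‖x‖]

variable (e : OrthonormalBasis (Fin m) ℝ (EuclideanSpace ℝ (Fin m))) {c : Fin m → ℝ}

/-- The squared cosines of the principal angles converge to the ordered eigenvalues of the limiting
quadratic form. -/
lemma tendsto_cosSq (hu : ∀ᶠ i in l, Orthonormal ℝ (fun a : Fin m => u i a)) (hc : Antitone c)
    (hQ : ProjectionTendsto l T u (fun x => ∑ j, c j * inner ℝ (e j) x ^ 2)) (k : Fin m) :
    Tendsto (fun i => cosSq k (T i) (leadingSpan m (u i))) l (𝓝 (c k)) := by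
  rw [Metric.tendsto_nhds]
  intro ε hε
  filter_upwards [hu, hQ (ε / 2) (by positivity)] with i hi hQi
  obtain ⟨E₁, hE₁, hE₁'⟩ := exists_submodule_inner_eq_zero e (Finset.Iic k)
  obtain ⟨E₂, hE₂, hE₂'⟩ := exists_submodule_inner_eq_zero e (Finset.Ici k)
  have h1 : c k - ε / 2 ≤ cosSq k (T i) (leadingSpan m (u i)) := by
    refine le_cosSq (T i) hi E₁ (by simp [hE₁]) fun x hx => ?_
    have h2 : c k * ‖x‖ ^ 2 ≤ ∑ j, c j * inner ℝ (e j) x ^ 2 := by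
      rw [← e.sum_sq_inner_right x, Finset.mul_sum]
      refine Finset.sum_le_sum fun j _ => ?_
      by_cases hj : j ≤ k
      · exact mul_le_mul_of_nonneg_right (hc hj) (sq_nonneg _)
      · rw [hE₁' x hx j (by simpa using hj)]; simp
    linarith [(abs_le.1 (hQi x)).1]
  have h2 : cosSq k (T i) (leadingSpan m (u i)) ≤ c k + ε / 2 := by
    refine cosSq_le (T i) hi k.2 E₂ (by simp [hE₂]) fun x hx => ?_
    have h2 : ∑ j, c j * inner ℝ (e j) x ^ 2 ≤ c k * ‖x‖ ^ 2 := by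
      rw [← e.sum_sq_inner_right x, Finset.mul_sum]
      refine Finset.sum_le_sum fun j _ => ?_
      by_cases hj : k ≤ j
      · exact mul_le_mul_of_nonneg_right (hc hj) (sq_nonneg _)
      · rw [hE₂' x hx j (by simpa using hj)]; simp
    linarith [(abs_le.1 (hQi x)).2]
  rw [Real.dist_eq, abs_lt]
  constructor <;> linarith

/-- A positive semidefinite perturbation `K` which does not vanish at any eigenvector of the limit
form strictly increases every eigenvalue: by compactness of the unit sphere, the perturbed form
exceeds `c k` by a uniform amount on the span of the first `k + 1` eigenvectors. -/
lemma exists_lt_cosSq (hu : ∀ᶠ i in l, Orthonormal ℝ (fun a : Fin m => u i a)) (hc : Antitone c)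
    (K : EuclideanSpace ℝ (Fin m) → ℝ) (hKc : Continuous K) (hK0 : ∀ x, 0 ≤ K x)
    (hKs : ∀ (t : ℝ) x, K (t • x) = t ^ 2 * K x)
    (hK : ∀ (γ : ℝ) x, x ≠ 0 → (∀ j, inner ℝ (e j) x ≠ 0 → c j = γ) → 0 < K x)
    (hQ : ProjectionTendsto l T u (fun x => ∑ j, c j * inner ℝ (e j) x ^ 2 + K x))
    (k : Fin m) :
    ∃ δ > 0, ∀ᶠ i in l, c k + δ ≤ cosSq k (T i) (leadingSpan m (u i)) := by
  obtain ⟨E, hE, hE'⟩ := exists_submodule_inner_eq_zero e (Finset.Iic k)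
  set F : EuclideanSpace ℝ (Fin m) → ℝ :=
    fun x => (∑ j, c j * inner ℝ (e j) x ^ 2 + K x) - c k * ‖x‖ ^ 2 with hF
  have hFpos : ∀ x ∈ E, x ≠ 0 → 0 < F x := by
    intro x hx hx0
    have h1 : ∀ j, c k * inner ℝ (e j) x ^ 2 ≤ c j * inner ℝ (e j) x ^ 2 := by
      intro j
      by_cases hj : j ≤ k
      · exact mul_le_mul_of_nonneg_right (hc hj) (sq_nonneg _)
      · rw [hE' x hx j (by simpa using hj)]; simp
    have h2 : F x = ∑ j, (c j * inner ℝ (e j) x ^ 2 - c k * inner ℝ (e j) x ^ 2) + K x := by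
      simp only [hF]
      rw [← e.sum_sq_inner_right x, Finset.mul_sum, Finset.sum_sub_distrib]; ring
    rw [h2]
    by_cases h3 : ∀ j, inner ℝ (e j) x ≠ 0 → c j = c k
    · exact add_pos_of_nonneg_of_pos (Finset.sum_nonneg fun j _ => sub_nonneg.2 (h1 j))
        (hK _ x hx0 h3)
    · push Not at h3
      obtain ⟨j, hj, hjk⟩ := h3
      refine add_pos_of_pos_of_nonneg ?_ (hK0 x)
      refine Finset.sum_pos' (fun j _ => sub_nonneg.2 (h1 j)) ⟨j, Finset.mem_univ _, ?_⟩
      have h4 : 0 < inner ℝ (e j) x ^ 2 := by positivity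
      have h5 := h1 j
      refine sub_pos.2 (lt_of_le_of_ne h5 fun h6 => hjk ?_)
      exact (mul_right_cancel₀ h4.ne' h6).symm
  have hFc : Continuous F := by fun_prop
  have hFs : ∀ (t : ℝ) x, F (t • x) = t ^ 2 * F x := by
    intro t x
    simp only [hF, hKs, real_inner_smul_right, norm_smul, mul_pow, mul_sub, mul_add,
      Finset.mul_sum, Real.norm_eq_abs, sq_abs]
    congr 1
    · congr 1
      exact Finset.sum_congr rfl fun j _ => by ring
    · ring
  have hcomp : IsCompact (Metric.sphere (0 : EuclideanSpace ℝ (Fin m)) 1 ∩ E) :=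
    (isCompact_sphere 0 1).inter_right E.closed_of_finiteDimensional
  have hex : ∃ δ > 0, ∀ x ∈ Metric.sphere (0 : EuclideanSpace ℝ (Fin m)) 1 ∩ E, δ ≤ F x := by
    rcases (Metric.sphere (0 : EuclideanSpace ℝ (Fin m)) 1 ∩ E).eq_empty_or_nonempty with h | h
    · exact ⟨1, one_pos, fun x hx => by simp [h] at hx⟩
    · obtain ⟨x, hx, hmin⟩ := hcomp.exists_isMinOn h hFc.continuousOn
      refine ⟨F x, hFpos x hx.2 ?_, fun y hy => hmin hy⟩
      rintro rfl
      simp at hx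
  obtain ⟨δ, hδ, hmin⟩ := hex
  refine ⟨δ / 2, by positivity, ?_⟩
  filter_upwards [hu, hQ (δ / 2) (by positivity)] with i hi hQi
  refine le_cosSq (T i) hi E (by simp [hE]) fun x hx => ?_
  have h1 : δ * ‖x‖ ^ 2 ≤ F x := by
    rcases eq_or_ne x 0 with rfl | hx0
    · have := hFs 0 0
      simp at this; simp [this]
    · have hn : ‖x‖ ≠ 0 := norm_ne_zero_iff.2 hx0
      have h2 := hmin (‖x‖⁻¹ • x) ⟨by simp [norm_smul, hn], E.smul_mem _ hx⟩
      rw [hFs] at h2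
      have h3 : 0 < ‖x‖ ^ 2 := by positivity
      calc δ * ‖x‖ ^ 2 ≤ (‖x‖⁻¹ ^ 2 * F x) * ‖x‖ ^ 2 := by gcongr
        _ = F x := by field_simp
  have h2 := (abs_le.1 (hQi x)).1
  simp only [hF] at h1
  nlinarith

end AngleLimits

/-! ### Orthogonal projections onto spans -/

section Projections

open scoped Matrix

variable {E : Type*} [NormedAddCommGroup E] [InnerProductSpace ℝ E] [FiniteDimensional ℝ E]

lemma starProjection_sup_of_isOrtho {U W T : Submodule ℝ E} (hT : U ⊔ W = T) (h : U ⟂ W)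
    (x : E) : T.starProjection x = U.starProjection x + W.starProjection x := by
  subst hT
  apply Submodule.eq_starProjection_of_mem_orthogonal
  · exact Submodule.add_mem_sup (Submodule.starProjection_apply_mem _ _)
      (Submodule.starProjection_apply_mem _ _)
  · rw [← Submodule.inf_orthogonal]
    refine ⟨?_, ?_⟩
    · rw [← sub_sub]
      exact Submodule.sub_mem _ (Submodule.sub_starProjection_mem_orthogonal x)
        (h.symm (Submodule.starProjection_apply_mem _ _))
    · rw [add_comm, ← sub_sub]
      exact Submodule.sub_mem _ (Submodule.sub_starProjection_mem_orthogonal x)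
        (h (Submodule.starProjection_apply_mem _ _))

lemma starProjection_inf_orthogonal {S D : Submodule ℝ E} (h : D ≤ S) (x : E) :
    (S ⊓ Dᗮ).starProjection x = S.starProjection x - D.starProjection x := by
  have h1 : D ⊔ S ⊓ Dᗮ = S := by
    rw [inf_comm]; exact Submodule.sup_orthogonal_inf_of_hasOrthogonalProjection h
  have h2 : D ⟂ S ⊓ Dᗮ :=
    (Submodule.isOrtho_orthogonal_right D).mono_right inf_le_right
  rw [starProjection_sup_of_isOrtho h1 h2 x]; abel

lemma inner_starProjection_span {κ : Type*} [Fintype κ] [DecidableEq κ] (w : κ → E)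
    (h : IsUnit (Matrix.gram ℝ w).det) (x y : E) :
    inner ℝ x ((Submodule.span ℝ (Set.range w)).starProjection y) =
      ∑ k, ∑ l, inner ℝ (w k) x * (Matrix.gram ℝ w)⁻¹ k l * inner ℝ (w l) y := by
  set M := Matrix.gram ℝ w with hM
  have h1 : (Submodule.span ℝ (Set.range w)).starProjection y =
      ∑ k, (∑ l, M⁻¹ k l * inner ℝ (w l) y) • w k := by
    apply Submodule.eq_starProjection_of_mem_orthogonal
    · exact Submodule.sum_mem _ fun k _ =>
        Submodule.smul_mem _ _ (Submodule.subset_span (Set.mem_range_self k))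
    · rw [Submodule.mem_orthogonal]
      intro z hz
      refine Submodule.span_induction ?_ (by simp) ?_ ?_ hz
      · rintro _ ⟨i, rfl⟩
        have h2 : M *ᵥ (M⁻¹ *ᵥ fun l => inner ℝ (w l) y) = fun l => inner ℝ (w l) y := by
          rw [Matrix.mulVec_mulVec, Matrix.mul_nonsing_inv _ h, Matrix.one_mulVec]
        have h3 := congrFun h2 i
        rw [inner_sub_right, inner_sum, sub_eq_zero]
        simp only [real_inner_smul_right]
        rw [← h3]
        simp only [Matrix.mulVec, dotProduct, hM, Matrix.gram_apply]
        exact Finset.sum_congr rfl fun k _ => mul_comm _ _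
      · intro a b _ _ ha hb
        rw [inner_add_left, ha, hb, add_zero]
      · intro a b _ hb
        rw [inner_smul_left, hb, mul_zero]
  rw [h1, inner_sum]
  refine Finset.sum_congr rfl fun k _ => ?_
  rw [real_inner_smul_right, Finset.sum_mul]
  refine Finset.sum_congr rfl fun l _ => ?_
  rw [real_inner_comm x (w k)]; ring

lemma starProjection_span_orthonormal {κ : Type*} [Fintype κ] {w : κ → E}
    (h : Orthonormal ℝ w) (y : E) :
    (Submodule.span ℝ (Set.range w)).starProjection y = ∑ k, inner ℝ (w k) y • w k := by
  classical
  apply Submodule.eq_starProjection_of_mem_orthogonal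
  · exact Submodule.sum_mem _ fun k _ =>
      Submodule.smul_mem _ _ (Submodule.subset_span (Set.mem_range_self k))
  · rw [Submodule.mem_orthogonal]
    intro z hz
    refine Submodule.span_induction ?_ (by simp) ?_ ?_ hz
    · rintro _ ⟨i, rfl⟩
      rw [inner_sub_right, h.inner_right_fintype, sub_self]
    · intro a b _ _ ha hb
      rw [inner_add_left, ha, hb, add_zero]
    · intro a b _ hb
      rw [inner_smul_left, hb, mul_zero]

/-- The projection onto the orthogonal complement of the span of `d` within `U ⊔ span v`, when `d`
arises from `v` by adding vectors of `U`: here `w` is the family of components of `v` orthogonal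
to `U`. -/
lemma starProjection_complement {κ : Type*} (U : Submodule ℝ E) (v d : κ → E)
    (hd : ∀ k, d k - v k ∈ U) (x : E) :
    ((U ⊔ Submodule.span ℝ (Set.range v)) ⊓ (Submodule.span ℝ (Set.range d))ᗮ).starProjection x =
      U.starProjection x +
        (Submodule.span ℝ (Set.range fun k => v k - U.starProjection (v k))).starProjection x -
        (Submodule.span ℝ (Set.range d)).starProjection x := by
  set w : κ → E := fun k => v k - U.starProjection (v k) with hw
  have hUv : U ⊔ Submodule.span ℝ (Set.range v) = U ⊔ Submodule.span ℝ (Set.range w) := by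
    apply le_antisymm
    · refine sup_le le_sup_left (Submodule.span_le.2 ?_)
      rintro _ ⟨k, rfl⟩
      have : v k = U.starProjection (v k) + w k := by simp [hw]
      rw [this]
      exact Submodule.add_mem_sup (Submodule.starProjection_apply_mem _ _)
        (Submodule.subset_span (Set.mem_range_self k))
    · refine sup_le le_sup_left (Submodule.span_le.2 ?_)
      rintro _ ⟨k, rfl⟩
      have : w k = -U.starProjection (v k) + v k := by simp [hw]; abel
      rw [this]
      exact Submodule.add_mem_sup (U.neg_mem (Submodule.starProjection_apply_mem _ _))
        (Submodule.subset_span (Set.mem_range_self k))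
  have hort : U ⟂ Submodule.span ℝ (Set.range w) := by
    refine Submodule.IsOrtho.symm (Submodule.span_le.2 ?_)
    rintro _ ⟨k, rfl⟩
    exact Submodule.sub_starProjection_mem_orthogonal _
  have hdS : Submodule.span ℝ (Set.range d) ≤ U ⊔ Submodule.span ℝ (Set.range v) := by
    refine Submodule.span_le.2 ?_
    rintro _ ⟨k, rfl⟩
    have : d k = (d k - v k) + v k := by abel
    rw [this]
    exact Submodule.add_mem_sup (hd k) (Submodule.subset_span (Set.mem_range_self k))
  rw [starProjection_inf_orthogonal hdS, starProjection_sup_of_isOrtho hUv.symm hort]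

end Projections

/-! ### Limits of the principal angles of the two estimators -/

section LimitingAngles

open scoped Matrix

variable {m r : ℕ} {ι : Type*}

/-- The limits of the inner products between true and sample PC directions and references.
The `m` leading sample directions `uHat i j` converge, as far as inner products with the true
directions and the references are concerned, to `√(c j) e j` with `e` an orthonormal basis of the
true PC subspace (written in the coordinates given by `u`) and `c j ∈ (0, 1)`; `rho i j` stands
for `λ̃ / (λ̂ⱼ - λ̃)`. -/
structure AlignedLimits (l : Filter ι) {p : ι → ℕ} (u uHat : (i : ι) → ℕ → Vec (p i))
    (v : (i : ι) → Fin r → Vec (p i)) (rho : ι → ℕ → ℝ) (A : Matrix (Fin m) (Fin r) ℝ)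
    (VG : Matrix (Fin r) (Fin r) ℝ)
    (e : OrthonormalBasis (Fin m) ℝ (EuclideanSpace ℝ (Fin m))) (c : Fin m → ℝ) : Prop where
  orthonormal_u : ∀ᶠ i in l, Orthonormal ℝ (fun a : Fin m => u i a)
  orthonormal_uHat : ∀ᶠ i in l, Orthonormal ℝ (fun a : Fin m => uHat i a)
  u_uHat : ∀ a j : Fin m, Tendsto (fun i => inner ℝ (u i a) (uHat i j)) l (𝓝 (√(c j) * e j a))
  v_uHat : ∀ k (j : Fin m), Tendsto (fun i => inner ℝ (v i k) (uHat i j)) l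
    (𝓝 (√(c j) * ∑ a, A a k * e j a))
  v_u : ∀ k (a : Fin m), Tendsto (fun i => inner ℝ (v i k) (u i a)) l (𝓝 (A a k))
  v_v : ∀ k k', Tendsto (fun i => inner ℝ (v i k) (v i k')) l (𝓝 (VG k k'))
  rho : ∀ j : Fin m, Tendsto (fun i => rho i j) l (𝓝 ((1 - c j) / c j))
  isUnit_VG : IsUnit VG.det
  pos : ∀ j, 0 < c j
  lt_one : ∀ j, c j < 1
  antitone : Antitone c

lemma sum_coord_mul_coord (e : OrthonormalBasis (Fin m) ℝ (EuclideanSpace ℝ (Fin m)))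
    (y : Fin m → ℝ) (a : Fin m) : ∑ j, e j a * ∑ b, y b * e j b = y a := by
  have h := congrArg (fun z : EuclideanSpace ℝ (Fin m) => z a) (e.sum_repr' (WithLp.toLp 2 y))
  simp only [WithLp.ofLp_sum, WithLp.ofLp_smul, Finset.sum_apply, Pi.smul_apply, smul_eq_mul,
    PiLp.inner_apply, RCLike.inner_apply, conj_trivial] at h
  rw [← h]
  exact Finset.sum_congr rfl fun j _ => mul_comm _ _

/-- The reference directions in the coordinates of the basis `e`. -/
noncomputable def refCoord (A : Matrix (Fin m) (Fin r) ℝ)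
    (e : OrthonormalBasis (Fin m) ℝ (EuclideanSpace ℝ (Fin m))) (j : Fin m) (k : Fin r) : ℝ :=
  ∑ a, A a k * e j a

/-- The limiting Gram matrix of the components of the references orthogonal to the sample PC
subspace. -/
noncomputable def residualGram (A : Matrix (Fin m) (Fin r) ℝ) (VG : Matrix (Fin r) (Fin r) ℝ)
    (e : OrthonormalBasis (Fin m) ℝ (EuclideanSpace ℝ (Fin m))) (c : Fin m → ℝ) :
    Matrix (Fin r) (Fin r) ℝ :=
  Matrix.of fun k k' => VG k k' - ∑ j, c j * refCoord A e j k * refCoord A e j k'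

variable {l : Filter ι} {p : ι → ℕ} {u uHat : (i : ι) → ℕ → Vec (p i)}
  {v : (i : ι) → Fin r → Vec (p i)} {rho : ι → ℕ → ℝ} {A : Matrix (Fin m) (Fin r) ℝ}
  {VG : Matrix (Fin r) (Fin r) ℝ} {e : OrthonormalBasis (Fin m) ℝ (EuclideanSpace ℝ (Fin m))}
  {c : Fin m → ℝ}

lemma tendsto_inner_starProjection_leadingSpan (h : AlignedLimits l u uHat v rho A VG e c)
    (a b : Fin m) :
    Tendsto (fun i => inner ℝ (u i a) ((leadingSpan m (uHat i)).starProjection (u i b))) l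
      (𝓝 (∑ j, (√(c j) * e j a) * (√(c j) * e j b))) := by
  have h2 : Tendsto (fun i => ∑ j : Fin m, inner ℝ (u i a) (uHat i j) *
      inner ℝ (u i b) (uHat i j)) l
      (𝓝 (∑ j, (√(c j) * e j a) * (√(c j) * e j b))) :=
    tendsto_finsetSum _ fun j _ => (h.u_uHat a j).mul (h.u_uHat b j)
  refine h2.congr' ?_
  filter_upwards [h.orthonormal_uHat] with i hi
  rw [leadingSpan, starProjection_span_orthonormal hi, inner_sum]
  refine Finset.sum_congr rfl fun j _ => ?_
  rw [real_inner_smul_right, real_inner_comm (u i b)]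
  ring

lemma sum_mul_sq_inner_eq (e : OrthonormalBasis (Fin m) ℝ (EuclideanSpace ℝ (Fin m)))
    (hc : ∀ j, 0 ≤ c j) (x : EuclideanSpace ℝ (Fin m)) :
    ∑ j, c j * inner ℝ (e j) x ^ 2 =
      ∑ a, ∑ b, x a * x b * ∑ j, (√(c j) * e j a) * (√(c j) * e j b) := by
  simp only [PiLp.inner_apply, RCLike.inner_apply, conj_trivial]
  simp_rw [Finset.mul_sum]
  rw [Finset.sum_congr rfl fun a _ => Finset.sum_comm, Finset.sum_comm]
  refine Finset.sum_congr rfl fun j _ => ?_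
  rw [sq, Finset.sum_mul_sum, Finset.mul_sum]
  refine Finset.sum_congr rfl fun a _ => ?_
  rw [Finset.mul_sum]
  refine Finset.sum_congr rfl fun b _ => ?_
  have := Real.mul_self_sqrt (hc j)
  linear_combination (-(x a * x b * e j a * e j b)) * this

lemma projectionTendsto_leadingSpan (h : AlignedLimits l u uHat v rho A VG e c) :
    ProjectionTendsto l (fun i => leadingSpan m (uHat i)) u
      (fun x => ∑ j, c j * inner ℝ (e j) x ^ 2) := by
  convert projectionTendsto_of_entries (m := m) (l := l) (u := u)
    (T := fun i => leadingSpan m (uHat i))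
    (Matrix.of fun a b => ∑ j, (√(c j) * e j a) * (√(c j) * e j b))
    (tendsto_inner_starProjection_leadingSpan h) using 2 with x
  exact sum_mul_sq_inner_eq e (fun j => (h.pos j).le) x

lemma sum_sq_refCoord (A : Matrix (Fin m) (Fin r) ℝ)
    (e : OrthonormalBasis (Fin m) ℝ (EuclideanSpace ℝ (Fin m))) (x : Fin r → ℝ) :
    ∑ j, (∑ k, x k * refCoord A e j k) ^ 2 = ∑ a, (∑ k, x k * A a k) ^ 2 := by
  have h1 := e.sum_sq_inner_right (WithLp.toLp 2 (fun a => ∑ k, x k * A a k))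
  rw [EuclideanSpace.norm_sq_eq] at h1
  simp only [Real.norm_eq_abs, sq_abs] at h1
  rw [← h1]
  refine Finset.sum_congr rfl fun j _ => ?_
  congr 1
  simp only [refCoord, PiLp.inner_apply, RCLike.inner_apply, conj_trivial, Finset.mul_sum,
    Finset.sum_mul]
  rw [Finset.sum_comm]
  exact Finset.sum_congr rfl fun a _ => Finset.sum_congr rfl fun k _ => by ring

/-- The inequality `Aᵀ A ≤ VG` is the limit of Bessel's inequality. -/
lemma sum_sq_le_quadratic (h : AlignedLimits l u uHat v rho A VG e c) [l.NeBot] (x : Fin r → ℝ) :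
    ∑ a, (∑ k, x k * A a k) ^ 2 ≤ ∑ k, ∑ k', x k * x k' * VG k k' := by
  have h1 : Tendsto (fun i => ∑ a : Fin m, (∑ k, x k * inner ℝ (v i k) (u i a)) ^ 2) l
      (𝓝 (∑ a, (∑ k, x k * A a k) ^ 2)) :=
    tendsto_finsetSum _ fun a _ => (tendsto_finsetSum _ fun k _ =>
      (h.v_u k a).const_mul _).pow 2
  have h2 : Tendsto (fun i => ∑ k, ∑ k', x k * x k' * inner ℝ (v i k) (v i k')) l
      (𝓝 (∑ k, ∑ k', x k * x k' * VG k k')) :=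
    tendsto_finsetSum _ fun k _ => tendsto_finsetSum _ fun k' _ => (h.v_v k k').const_mul _
  refine le_of_tendsto_of_tendsto h1 h2 ?_
  filter_upwards [h.orthonormal_u] with i hi
  have h3 := hi.sum_inner_products_le (∑ k, x k • v i k) (s := Finset.univ)
  rw [← real_inner_self_eq_norm_sq] at h3
  simp only [inner_sum, sum_inner, real_inner_smul_right, real_inner_smul_left,
    Real.norm_eq_abs, sq_abs] at h3
  calc _ = ∑ a : Fin m, (∑ k, x k * inner ℝ (u i a) (v i k)) ^ 2 := by
        simp_rw [real_inner_comm]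
    _ ≤ _ := h3
    _ = _ := by
        rw [Finset.sum_comm]
        exact Finset.sum_congr rfl fun k _ => Finset.sum_congr rfl fun k' _ => by ring

lemma VG_symm (h : AlignedLimits l u uHat v rho A VG e c) [l.NeBot] (k k' : Fin r) :
    VG k k' = VG k' k := by
  refine tendsto_nhds_unique (h.v_v k k') ?_
  simpa only [real_inner_comm] using h.v_v k' k

/-- The Gram matrix `residualGram` is `VG - ∑ j, c j qⱼ qⱼᵀ`, with `qⱼ` the `j`-th coordinates of
the references, and `∑ j, qⱼ qⱼᵀ = Aᵀ A ≤ VG`. A vector at which it vanishes is orthogonal to all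
the `qⱼ`, since `c j < 1`, and is then in the kernel of the positive definite `VG`. -/
lemma residualGram_add_posDef (h : AlignedLimits l u uHat v rho A VG e c) [l.NeBot]
    (t : Fin m → ℝ) (ht : ∀ j, 0 ≤ t j) :
    (Matrix.of fun k k' => residualGram A VG e c k k' +
      ∑ j, t j * refCoord A e j k * refCoord A e j k').PosDef := by
  have hquad : ∀ (s : Fin m → ℝ) (x : Fin r → ℝ),
      ∑ k, ∑ k', x k * x k' * ∑ j, s j * refCoord A e j k * refCoord A e j k' =
        ∑ j, s j * (∑ k, x k * refCoord A e j k) ^ 2 := by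
    intro s x
    simp_rw [Finset.mul_sum]
    rw [Finset.sum_congr rfl fun k _ => Finset.sum_comm, Finset.sum_comm]
    refine Finset.sum_congr rfl fun j _ => ?_
    rw [sq, Finset.sum_mul_sum, Finset.mul_sum]
    refine Finset.sum_congr rfl fun k _ => ?_
    rw [Finset.mul_sum]
    exact Finset.sum_congr rfl fun k' _ => by ring
  refine Matrix.PosDef.of_dotProduct_mulVec_pos ?_ ?_
  · ext k k'
    simp only [Matrix.conjTranspose_apply, Matrix.of_apply, star_trivial, residualGram]
    rw [VG_symm h k' k]
    congr 1
    · congr 1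
      exact Finset.sum_congr rfl fun j _ => by ring
    · exact Finset.sum_congr rfl fun j _ => by ring
  · intro x hx
    set q : ℝ := ∑ k, ∑ k', x k * x k' * VG k k' with hq
    have h1 : star x ⬝ᵥ ((Matrix.of fun k k' => residualGram A VG e c k k' +
        ∑ j, t j * refCoord A e j k * refCoord A e j k') *ᵥ x) =
        q - ∑ j, c j * (∑ k, x k * refCoord A e j k) ^ 2 +
          ∑ j, t j * (∑ k, x k * refCoord A e j k) ^ 2 := by
      rw [← hquad c x, ← hquad t x, hq, ← Finset.sum_sub_distrib, ← Finset.sum_add_distrib]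
      simp only [dotProduct, Matrix.mulVec, Pi.star_apply, star_trivial]
      refine Finset.sum_congr rfl fun k _ => ?_
      rw [← Finset.sum_sub_distrib, ← Finset.sum_add_distrib, Finset.mul_sum]
      refine Finset.sum_congr rfl fun k' _ => ?_
      simp only [Matrix.of_apply, residualGram]
      ring
    rw [h1]
    have h2 : 0 ≤ ∑ j, t j * (∑ k, x k * refCoord A e j k) ^ 2 :=
      Finset.sum_nonneg fun j _ => mul_nonneg (ht j) (sq_nonneg _)
    have h3 := sum_sq_le_quadratic h x
    rw [← sum_sq_refCoord A e x] at h3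
    have h4 : ∑ j, c j * (∑ k, x k * refCoord A e j k) ^ 2 ≤
        ∑ j, (∑ k, x k * refCoord A e j k) ^ 2 :=
      Finset.sum_le_sum fun j _ =>
        mul_le_of_le_one_left (sq_nonneg _) (h.lt_one j).le
    by_contra hneg
    have h5 : ∑ j, c j * (∑ k, x k * refCoord A e j k) ^ 2 =
        ∑ j, (∑ k, x k * refCoord A e j k) ^ 2 := by linarith
    have h6 : q = ∑ j, (∑ k, x k * refCoord A e j k) ^ 2 := by linarith
    have h7 : ∀ j, ∑ k, x k * refCoord A e j k = 0 := by
      have := (Finset.sum_eq_sum_iff_of_le (fun j _ =>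
        mul_le_of_le_one_left (sq_nonneg (∑ k, x k * refCoord A e j k)) (h.lt_one j).le)).1 h5
      intro j
      have h8 := this j (Finset.mem_univ j)
      have h9 : (1 - c j) * (∑ k, x k * refCoord A e j k) ^ 2 = 0 := by linarith
      rcases mul_eq_zero.1 h9 with h10 | h10
      · linarith [h.lt_one j]
      · exact pow_eq_zero_iff two_ne_zero |>.1 h10
    have hq0 : q = 0 := by rw [h6]; simp [h7]
    have hpsd : VG.PosSemidef := by
      refine Matrix.PosSemidef.of_dotProduct_mulVec_nonneg ?_ ?_
      · ext k k'
        simp [VG_symm h k' k]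
      · intro y
        have h8 := sum_sq_le_quadratic h y
        have h9 : star y ⬝ᵥ (VG *ᵥ y) = ∑ k, ∑ k', y k * y k' * VG k k' := by
          simp only [dotProduct, Matrix.mulVec, Pi.star_apply, star_trivial]
          refine Finset.sum_congr rfl fun k _ => ?_
          rw [Finset.mul_sum]
          exact Finset.sum_congr rfl fun k' _ => by ring
        rw [h9]
        exact le_trans (Finset.sum_nonneg fun a _ => sq_nonneg _) h8
    have hpd : VG.PosDef :=
      hpsd.posDef_iff_isUnit.2 ((Matrix.isUnit_iff_isUnit_det _).2 h.isUnit_VG)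
    have h8 := hpd.dotProduct_mulVec_pos hx
    have h9 : star x ⬝ᵥ (VG *ᵥ x) = q := by
      simp only [dotProduct, Matrix.mulVec, Pi.star_apply, star_trivial, hq]
      refine Finset.sum_congr rfl fun k _ => ?_
      rw [Finset.mul_sum]
      exact Finset.sum_congr rfl fun k' _ => by ring
    rw [h9, hq0] at h8
    exact lt_irrefl _ h8

end LimitingAngles

section LimitingARG

open scoped Matrix

variable {m r : ℕ} {ι : Type*}
variable {l : Filter ι} {p : ι → ℕ} {u uHat : (i : ι) → ℕ → Vec (p i)}
  {v : (i : ι) → Fin r → Vec (p i)} {rho : ι → ℕ → ℝ} {A : Matrix (Fin m) (Fin r) ℝ}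
  {VG : Matrix (Fin r) (Fin r) ℝ} {e : OrthonormalBasis (Fin m) ℝ (EuclideanSpace ℝ (Fin m))}
  {c : Fin m → ℝ}

lemma tendsto_inner_starProjection_span {w : (i : ι) → Fin r → Vec (p i)}
    {H : Matrix (Fin m) (Fin r) ℝ} {M : Matrix (Fin r) (Fin r) ℝ} (hM : IsUnit M.det)
    (hwu : ∀ k (a : Fin m), Tendsto (fun i => inner ℝ (w i k) (u i a)) l (𝓝 (H a k)))
    (hww : ∀ k k', Tendsto (fun i => inner ℝ (w i k) (w i k')) l (𝓝 (M k k'))) (a b : Fin m) :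
    Tendsto (fun i => inner ℝ (u i a)
      ((Submodule.span ℝ (Set.range (w i))).starProjection (u i b))) l
      (𝓝 (∑ k, ∑ k', H a k * M⁻¹ k k' * H b k')) := by
  have hG : Tendsto (fun i => Matrix.gram ℝ (w i)) l (𝓝 M) :=
    tendsto_pi_nhds.2 fun k => tendsto_pi_nhds.2 fun k' => hww k k'
  have hinv : Tendsto (fun i => (Matrix.gram ℝ (w i))⁻¹) l (𝓝 M⁻¹) := by
    refine Tendsto.comp (continuousAt_matrix_inv M ?_) hG
    rw [Ring.inverse_eq_inv']
    exact continuousAt_inv₀ hM.ne_zero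
  have hdet : ∀ᶠ i in l, IsUnit (Matrix.gram ℝ (w i)).det := by
    have h1 : Tendsto (fun i => (Matrix.gram ℝ (w i)).det) l (𝓝 M.det) :=
      ((continuous_id.matrix_det).tendsto M).comp hG
    filter_upwards [h1.eventually_ne hM.ne_zero] with i hi
    exact isUnit_iff_ne_zero.2 hi
  have h2 : Tendsto (fun i => ∑ k, ∑ k', inner ℝ (w i k) (u i a) *
      (Matrix.gram ℝ (w i))⁻¹ k k' * inner ℝ (w i k') (u i b)) l
      (𝓝 (∑ k, ∑ k', H a k * M⁻¹ k k' * H b k')) :=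
    tendsto_finsetSum _ fun k _ => tendsto_finsetSum _ fun k' _ =>
      ((hwu k a).mul (tendsto_pi_nhds.1 (tendsto_pi_nhds.1 hinv k) k')).mul (hwu k' b)
  refine h2.congr' ?_
  filter_upwards [hdet] with i hi
  rw [inner_starProjection_span _ hi]

/-- The vector `x` with its component along each leading sample direction `uHat j` multiplied by
`-rho j`. For `rho j = λ̃ / (λ̂ⱼ - λ̃)` this is the ridged discriminant vector of `x`
(`ridgedVector_eq`), and for `rho = 0` the component of `x` orthogonal to the sample PC subspace. -/
noncomputable def ridgedSum {p : ℕ} (m : ℕ) (uHat : ℕ → Vec p) (rho : ℕ → ℝ) (x : Vec p) :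
    Vec p :=
  x - ∑ j : Fin m, ((1 + rho j) * inner ℝ (uHat j) x) • uHat j

lemma inner_ridgedSum {p : ℕ} (uHat : ℕ → Vec p) (rho : ℕ → ℝ) (x y : Vec p) :
    inner ℝ (ridgedSum m uHat rho x) y =
      inner ℝ x y - ∑ j : Fin m, (1 + rho j) * inner ℝ x (uHat j) * inner ℝ y (uHat j) := by
  simp only [ridgedSum, inner_sub_left, sum_inner, real_inner_smul_left]
  congr 1
  exact Finset.sum_congr rfl fun j _ => by
    rw [real_inner_comm x (uHat j), real_inner_comm y (uHat j)]

lemma inner_ridgedSum_ridgedSum {p : ℕ} {uHat : ℕ → Vec p}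
    (hu : Orthonormal ℝ (fun a : Fin m => uHat a)) (rho : ℕ → ℝ) (x y : Vec p) :
    inner ℝ (ridgedSum m uHat rho x) (ridgedSum m uHat rho y) =
      inner ℝ x y + ∑ j : Fin m, (rho j ^ 2 - 1) * inner ℝ x (uHat j) * inner ℝ y (uHat j) := by
  have h1 : ∀ j : Fin m, inner ℝ (ridgedSum m uHat rho y) (uHat j) =
      -rho j * inner ℝ y (uHat j) := by
    intro j
    simp only [ridgedSum, inner_sub_left]
    rw [hu.inner_left_fintype]
    rw [real_inner_comm y (uHat j)]
    simp
    ring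
  rw [inner_ridgedSum, real_inner_comm, inner_ridgedSum, real_inner_comm]
  simp_rw [h1]
  rw [sub_sub, ← Finset.sum_add_distrib, sub_eq_add_neg, ← Finset.sum_neg_distrib]
  congr 1
  exact Finset.sum_congr rfl fun j _ => by ring

lemma tendsto_inner_ridgedSum (h : AlignedLimits l u uHat v rho A VG e c) {s : ι → ℕ → ℝ}
    {s' : Fin m → ℝ} (hs : ∀ j : Fin m, Tendsto (fun i => s i j) l (𝓝 (s' j))) (k : Fin r)
    (a : Fin m) :
    Tendsto (fun i => inner ℝ (ridgedSum m (uHat i) (s i) (v i k)) (u i a)) l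
      (𝓝 (∑ j, (1 - (1 + s' j) * c j) * e j a * refCoord A e j k)) := by
  have h1 : Tendsto (fun i => inner ℝ (v i k) (u i a) - ∑ j : Fin m, (1 + s i j) *
      inner ℝ (v i k) (uHat i j) * inner ℝ (u i a) (uHat i j)) l
      (𝓝 (A a k - ∑ j, (1 + s' j) * (√(c j) * ∑ a, A a k * e j a) * (√(c j) * e j a))) :=
    (h.v_u k a).sub (tendsto_finsetSum _ fun j _ =>
      (((hs j).const_add 1).mul (h.v_uHat k j)).mul (h.u_uHat a j))
  simp_rw [inner_ridgedSum]
  convert h1 using 2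
  rw [← sum_coord_mul_coord e (fun a => A a k) a, ← Finset.sum_sub_distrib]
  refine Finset.sum_congr rfl fun j _ => ?_
  have := Real.mul_self_sqrt (h.pos j).le
  rw [refCoord]
  linear_combination ((1 + s' j) * e j a * ∑ a, A a k * e j a) * this

lemma tendsto_inner_ridgedSum_ridgedSum (h : AlignedLimits l u uHat v rho A VG e c)
    {s : ι → ℕ → ℝ} {s' : Fin m → ℝ}
    (hs : ∀ j : Fin m, Tendsto (fun i => s i j) l (𝓝 (s' j))) (k k' : Fin r) :
    Tendsto (fun i => inner ℝ (ridgedSum m (uHat i) (s i) (v i k))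
      (ridgedSum m (uHat i) (s i) (v i k'))) l
      (𝓝 (residualGram A VG e c k k' +
        ∑ j, (s' j ^ 2 * c j) * refCoord A e j k * refCoord A e j k')) := by
  have h1 : Tendsto (fun i => inner ℝ (v i k) (v i k') + ∑ j : Fin m, (s i j ^ 2 - 1) *
      inner ℝ (v i k) (uHat i j) * inner ℝ (v i k') (uHat i j)) l
      (𝓝 (VG k k' + ∑ j, (s' j ^ 2 - 1) * (√(c j) * ∑ a, A a k * e j a) *
        (√(c j) * ∑ a, A a k' * e j a))) :=
    (h.v_v k k').add (tendsto_finsetSum _ fun j _ =>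
      ((((hs j).pow 2).sub_const 1).mul (h.v_uHat k j)).mul (h.v_uHat k' j))
  have h2 : VG k k' + ∑ j, (s' j ^ 2 - 1) * (√(c j) * ∑ a, A a k * e j a) *
        (√(c j) * ∑ a, A a k' * e j a) = residualGram A VG e c k k' +
        ∑ j, (s' j ^ 2 * c j) * refCoord A e j k * refCoord A e j k' := by
    simp only [residualGram, Matrix.of_apply]
    rw [sub_add, ← Finset.sum_sub_distrib, sub_eq_add_neg, ← Finset.sum_neg_distrib]
    congr 1
    refine Finset.sum_congr rfl fun j _ => ?_
    have := Real.mul_self_sqrt (h.pos j).le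
    simp only [refCoord]
    linear_combination ((s' j ^ 2 - 1) * (∑ a, A a k * e j a) * ∑ a, A a k' * e j a) * this
  rw [← h2]
  refine h1.congr' ?_
  filter_upwards [h.orthonormal_uHat] with i hi
  rw [inner_ridgedSum_ridgedSum hi]

lemma dotProduct_mulVec_sum (H : Matrix (Fin m) (Fin r) ℝ) (M : Matrix (Fin r) (Fin r) ℝ)
    (x : Fin m → ℝ) :
    (fun k => ∑ a, x a * H a k) ⬝ᵥ (M *ᵥ fun k => ∑ a, x a * H a k) =
      ∑ a, ∑ b, x a * x b * ∑ k, ∑ k', H a k * M k k' * H b k' := by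
  have h : ∀ k k' : Fin r, (∑ a, x a * H a k) * (M k k' * ∑ b, x b * H b k') =
      ∑ a, ∑ b, x a * x b * (H a k * M k k' * H b k') := by
    intro k k'
    rw [Finset.mul_sum, Finset.sum_mul_sum]
    exact Finset.sum_congr rfl fun a _ => Finset.sum_congr rfl fun b _ => by ring
  simp only [dotProduct, Matrix.mulVec]
  simp_rw [Finset.mul_sum _ _ (∑ a, x a * H a _), h, Finset.mul_sum]
  rw [Finset.sum_congr rfl fun k _ => Finset.sum_comm, Finset.sum_comm]
  refine Finset.sum_congr rfl fun a _ => ?_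
  rw [Finset.sum_congr rfl fun k _ => Finset.sum_comm, Finset.sum_comm]

/-- The limiting inner products of `∑ a, x a • u a` with the components of the references
orthogonal to the sample PC subspace. -/
noncomputable def residualCoord (A : Matrix (Fin m) (Fin r) ℝ)
    (e : OrthonormalBasis (Fin m) ℝ (EuclideanSpace ℝ (Fin m))) (c : Fin m → ℝ)
    (x : EuclideanSpace ℝ (Fin m)) (k : Fin r) : ℝ :=
  ∑ j, (1 - c j) * inner ℝ (e j) x * refCoord A e j k

/-- The increase of the limiting quadratic form due to the references. -/
noncomputable def gain (A : Matrix (Fin m) (Fin r) ℝ) (VG : Matrix (Fin r) (Fin r) ℝ)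
    (e : OrthonormalBasis (Fin m) ℝ (EuclideanSpace ℝ (Fin m))) (c : Fin m → ℝ)
    (x : EuclideanSpace ℝ (Fin m)) : ℝ :=
  residualCoord A e c x ⬝ᵥ ((residualGram A VG e c)⁻¹ *ᵥ residualCoord A e c x)

lemma residualGram_posDef (h : AlignedLimits l u uHat v rho A VG e c) [l.NeBot] :
    (residualGram A VG e c).PosDef := by
  have := residualGram_add_posDef h 0 (fun _ => le_rfl)
  simp only [Pi.zero_apply, zero_mul, Finset.sum_const_zero, add_zero] at this
  exact this

/-- The ridged discriminant vectors are asymptotically orthogonal to the true PC subspace, so that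
removing them from the signal subspace costs nothing, while the components of the references
orthogonal to the sample PC subspace add the form `gain`. -/
lemma projectionTendsto_complement (h : AlignedLimits l u uHat v rho A VG e c) [l.NeBot]
    {T : (i : ι) → Submodule ℝ (Vec (p i))}
    (hT : ∀ᶠ i in l, T i = (leadingSpan m (uHat i) ⊔ Submodule.span ℝ (Set.range (v i))) ⊓
      (Submodule.span ℝ (Set.range fun k => ridgedSum m (uHat i) (rho i) (v i k)))ᗮ) :
    ProjectionTendsto l T u
      (fun x => ∑ j, c j * inner ℝ (e j) x ^ 2 + gain A VG e c x) := by
  set H : Matrix (Fin m) (Fin r) ℝ :=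
    Matrix.of fun a k => ∑ j, (1 - c j) * e j a * refCoord A e j k with hH
  set M := residualGram A VG e c with hM
  have hMpd : M.PosDef := residualGram_posDef h
  -- the components orthogonal to the sample PC subspace are the case `rho = 0`
  have hw := fun a b => tendsto_inner_starProjection_span (l := l) (u := u)
    (w := fun i k => ridgedSum m (uHat i) 0 (v i k)) (H := H) (M := M)
    ((Matrix.isUnit_iff_isUnit_det _).1 hMpd.isUnit)
    (fun k a => by
      have := tendsto_inner_ridgedSum h (s := fun _ => 0) (s' := 0)
        (fun j => tendsto_const_nhds) k a
      simpa [hH] using this)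
    (fun k k' => by
      have := tendsto_inner_ridgedSum_ridgedSum h (s := fun _ => 0) (s' := 0)
        (fun j => tendsto_const_nhds) k k'
      simpa [hH] using this) a b
  -- with `s = (1 - c) / c` the factor `1 - (1 + s) c` vanishes: the ridged vectors become
  -- orthogonal to the true PC directions
  have hd := fun a b => tendsto_inner_starProjection_span (l := l) (u := u)
    (w := fun i k => ridgedSum m (uHat i) (rho i) (v i k)) (H := 0)
    ((Matrix.isUnit_iff_isUnit_det _).1 (residualGram_add_posDef h
      (fun j => ((1 - c j) / c j) ^ 2 * c j)
      (fun j => mul_nonneg (sq_nonneg _) (h.pos j).le)).isUnit)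
    (fun k a => by
      have := tendsto_inner_ridgedSum h h.rho k a
      have h0 : ∑ j, (1 - (1 + (1 - c j) / c j) * c j) * e j a * refCoord A e j k = 0 := by
        refine Finset.sum_eq_zero fun j _ => ?_
        have := (h.pos j).ne'
        have h1 : 1 - (1 + (1 - c j) / c j) * c j = 0 := by field_simp; ring
        rw [h1]; ring
      rwa [h0] at this)
    (fun k k' => tendsto_inner_ridgedSum_ridgedSum h h.rho k k') a b
  have hT' := projectionTendsto_of_entries (m := m) (l := l) (u := u) (T := T)
    (Matrix.of fun a b => ∑ j, (√(c j) * e j a) * (√(c j) * e j b) +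
      ∑ k, ∑ k', H a k * M⁻¹ k k' * H b k') (fun a b => by
      have h1 := ((tendsto_inner_starProjection_leadingSpan h a b).add (hw a b)).sub (hd a b)
      simp only [Matrix.zero_apply, zero_mul, Finset.sum_const_zero, sub_zero] at h1
      refine h1.congr' ?_
      filter_upwards [hT, h.orthonormal_uHat] with i hi hui
      have hw0 : (fun k => ridgedSum m (uHat i) 0 (v i k)) =
          fun k => v i k - (leadingSpan m (uHat i)).starProjection (v i k) := by
        funext k
        rw [leadingSpan, starProjection_span_orthonormal hui]
        simp [ridgedSum]
      simp only [hw0]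
      rw [hi, starProjection_complement, inner_sub_right, inner_add_right]
      · intro k
        rw [ridgedSum, sub_sub_cancel_left]
        exact Submodule.neg_mem _ (Submodule.sum_mem _ fun j _ =>
          Submodule.smul_mem _ _ (Submodule.subset_span (Set.mem_range_self j))))
  have hx : ∀ x, residualCoord A e c x = fun k => ∑ a, x a * H a k := by
    intro x
    funext k
    simp only [residualCoord, hH, Matrix.of_apply, Finset.mul_sum, PiLp.inner_apply,
      RCLike.inner_apply, conj_trivial, Finset.sum_mul]
    rw [Finset.sum_comm]
    exact Finset.sum_congr rfl fun a _ => Finset.sum_congr rfl fun j _ => by ring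
  convert hT' using 2 with x
  simp only [Matrix.of_apply, mul_add, Finset.sum_add_distrib]
  rw [sum_mul_sq_inner_eq e (fun j => (h.pos j).le) x, gain, hx, ← hM, dotProduct_mulVec_sum]

end LimitingARG

section Comparison

open scoped Matrix

variable {m r : ℕ} {ι : Type*}
variable {l : Filter ι} {p : ι → ℕ} {u uHat : (i : ι) → ℕ → Vec (p i)}
  {v : (i : ι) → Fin r → Vec (p i)} {rho : ι → ℕ → ℝ} {A : Matrix (Fin m) (Fin r) ℝ}
  {VG : Matrix (Fin r) (Fin r) ℝ} {e : OrthonormalBasis (Fin m) ℝ (EuclideanSpace ℝ (Fin m))}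
  {c : Fin m → ℝ}

lemma continuous_gain : Continuous (gain A VG e c) := by
  unfold gain
  simp only [dotProduct, Matrix.mulVec, residualCoord]
  fun_prop

lemma gain_smul (t : ℝ) (x : EuclideanSpace ℝ (Fin m)) :
    gain A VG e c (t • x) = t ^ 2 * gain A VG e c x := by
  have h : residualCoord A e c (t • x) = t • residualCoord A e c x := by
    funext k
    simp only [residualCoord, Pi.smul_apply, smul_eq_mul, real_inner_smul_right, Finset.mul_sum]
    exact Finset.sum_congr rfl fun j _ => by ring
  rw [gain, gain, h, Matrix.mulVec_smul, dotProduct_smul, smul_dotProduct, smul_eq_mul,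
    smul_eq_mul]
  ring

/-- The hypothesis `hγ` says that `x` belongs to the `γ`-eigenspace of `∑ j, c j ⟪e j, x⟫²`. There
the factor `1 - c j` is constant, and the residual coordinates are multiples of `Aᵀ x`. -/
lemma residualCoord_ne_zero (hc : ∀ j, c j < 1) {γ : ℝ} {x : EuclideanSpace ℝ (Fin m)}
    (hx : x ≠ 0) (hγ : ∀ j, inner ℝ (e j) x ≠ 0 → c j = γ) {k : Fin r}
    (hk : ∑ a, x a * A a k ≠ 0) : residualCoord A e c x ≠ 0 := by
  have h1 : residualCoord A e c x k = (1 - γ) * ∑ a, x a * A a k := by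
    have h2 : ∀ j, (1 - c j) * inner ℝ (e j) x * refCoord A e j k =
        (1 - γ) * (inner ℝ (e j) x * refCoord A e j k) := by
      intro j
      by_cases hj : inner ℝ (e j) x = 0
      · simp [hj]
      · rw [hγ j hj]; ring
    rw [residualCoord, Finset.sum_congr rfl fun j _ => h2 j, ← Finset.mul_sum]
    congr 1
    have h3 : ∀ j, refCoord A e j k = inner ℝ (e j) (WithLp.toLp 2 fun a => A a k) := by
      intro j
      simp [refCoord, PiLp.inner_apply]
    have h4 : ∀ j, inner ℝ (e j) x = inner ℝ x (e j) := fun j => real_inner_comm _ _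
    simp_rw [h3, h4]
    rw [e.sum_inner_mul_inner]
    simp [PiLp.inner_apply, mul_comm]
  obtain ⟨j, hj⟩ : ∃ j, inner ℝ (e j) x ≠ 0 := by
    by_contra! hne
    refine hx (norm_eq_zero.1 ?_)
    have := e.sum_sq_inner_right x
    simpa [hne] using this.symm
  have hγ1 : γ < 1 := hγ j hj ▸ hc j
  intro h0
  rw [h0] at h1
  exact mul_ne_zero (sub_ne_zero.2 hγ1.ne') hk h1.symm

lemma cosSq_le_one {p k : ℕ} {u : ℕ → Vec p} (T : Submodule ℝ (Vec p))
    (hu : Orthonormal ℝ (fun i : Fin m => u i)) (hk : k < m) :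
    cosSq k T (leadingSpan m u) ≤ 1 := by
  refine cosSq_le T hu hk ⊤ (by simp) fun x _ => ?_
  rw [one_mul, ← norm_leadingComb hu]
  gcongr
  exact Submodule.norm_starProjection_apply_le _ _

/-- If no eigenvector of the limiting form `∑ j, c j ⟪e j, x⟫²` is orthogonal to all the columns of
`A`, the limits of the references projected to the true PC subspace, then the
adaptive subspace eventually has strictly smaller principal angles. -/
theorem eventually_principalAngle_lt (h : AlignedLimits l u uHat v rho A VG e c) [l.NeBot]
    {T : (i : ι) → Submodule ℝ (Vec (p i))}
    (hT : ∀ᶠ i in l, T i = (leadingSpan m (uHat i) ⊔ Submodule.span ℝ (Set.range (v i))) ⊓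
      (Submodule.span ℝ (Set.range fun k => ridgedSum m (uHat i) (rho i) (v i k)))ᗮ)
    (hgen : ∀ (γ : ℝ) (x : EuclideanSpace ℝ (Fin m)), x ≠ 0 →
      (∀ j, inner ℝ (e j) x ≠ 0 → c j = γ) → ∃ k, ∑ a, x a * A a k ≠ 0) {k : ℕ} (hk : k < m) :
    ∀ᶠ i in l, principalAngle k (T i) (leadingSpan m (u i)) <
      principalAngle k (leadingSpan m (uHat i)) (leadingSpan m (u i)) := by
  have hpd := (residualGram_posDef h).inv
  obtain ⟨δ, hδ, h1⟩ := exists_lt_cosSq e h.orthonormal_u h.antitone (gain A VG e c)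
    continuous_gain
    (fun x => by
      have := hpd.posSemidef.dotProduct_mulVec_nonneg (residualCoord A e c x)
      simpa [gain] using this)
    gain_smul
    (fun γ x hx hγ => by
      obtain ⟨k, hk⟩ := hgen γ x hx hγ
      have := hpd.dotProduct_mulVec_pos (residualCoord_ne_zero h.lt_one hx hγ hk)
      simpa [gain] using this)
    (projectionTendsto_complement h hT) ⟨k, hk⟩
  have h2 := tendsto_cosSq e h.orthonormal_u h.antitone (projectionTendsto_leadingSpan h) ⟨k, hk⟩
  filter_upwards [h1, h2.eventually (gt_mem_nhds (lt_add_of_pos_right _ hδ)), h.orthonormal_u]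
    with i hi1 hi2 hu
  rw [principalAngle_eq, principalAngle_eq]
  refine Real.arccos_lt_arccos ?_ ?_ ?_
  · linarith [Real.sqrt_nonneg (cosSq k (leadingSpan m (uHat i)) (leadingSpan m (u i)))]
  · exact Real.sqrt_lt_sqrt (sq_nonneg _) (hi2.trans_le hi1)
  · exact Real.sqrt_le_one.2 (cosSq_le_one _ hu hk)

/-- If the references are asymptotically orthogonal to the true PC subspace, they do not change
the limits of the principal angles. -/
theorem tendsto_principalAngle_sub (h : AlignedLimits l u uHat v rho 0 VG e c) [l.NeBot]
    {T : (i : ι) → Submodule ℝ (Vec (p i))}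
    (hT : ∀ᶠ i in l, T i = (leadingSpan m (uHat i) ⊔ Submodule.span ℝ (Set.range (v i))) ⊓
      (Submodule.span ℝ (Set.range fun k => ridgedSum m (uHat i) (rho i) (v i k)))ᗮ)
    {k : ℕ} (hk : k < m) :
    Tendsto (fun i => principalAngle k (T i) (leadingSpan m (u i)) -
      principalAngle k (leadingSpan m (uHat i)) (leadingSpan m (u i))) l (𝓝 0) := by
  have h0 : ∀ x, gain 0 VG e c x = 0 := by
    intro x
    have : residualCoord (0 : Matrix (Fin m) (Fin r) ℝ) e c x = 0 := by
      funext k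
      simp [residualCoord, refCoord]
    rw [gain, this, zero_dotProduct]
  have h1 := projectionTendsto_complement h hT
  simp only [h0, add_zero] at h1
  have h1' := tendsto_cosSq e h.orthonormal_u h.antitone h1 ⟨k, hk⟩
  have h2 := tendsto_cosSq e h.orthonormal_u h.antitone (projectionTendsto_leadingSpan h) ⟨k, hk⟩
  have hcont : Continuous fun x : ℝ => Real.arccos √x :=
    Real.continuous_arccos.comp Real.continuous_sqrt
  have h3 := ((hcont.tendsto _).comp h1').sub ((hcont.tendsto _).comp h2)
  rw [sub_self] at h3
  simp only [principalAngle_eq]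
  exact h3

end Comparison

/-! ### Eigenstructure of the limiting dual covariance matrix -/

section DualStructure

variable {V W : Type*} [NormedAddCommGroup V] [InnerProductSpace ℝ V] [FiniteDimensional ℝ V]
  [NormedAddCommGroup W] [InnerProductSpace ℝ W] [FiniteDimensional ℝ W]

/-- Pairwise orthogonal vectors whose number exceeds the dimension cannot all be nonzero. -/
lemma exists_eq_zero_of_pairwise_orthogonal {κ : Type*} [Fintype κ] {w : κ → W}
    (h : Module.finrank ℝ W < Fintype.card κ)
    (hw : Pairwise fun j k => inner ℝ (w j) (w k) = 0) : ∃ j, w j = 0 := by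
  by_contra! hne
  exact (linearIndependent_of_ne_zero_of_inner_eq_zero hne hw).fintype_card_le_finrank.not_gt h

/-- The rescaled dual sample covariance operator has the form `N† N + t (1 - o oᵀ)` in the limit,
with `N` carrying the spikes, `t` the noise level and `o` the unit vector along `(1, …, 1)`.
The vectors `b j` (orthogonal, of squared length `ℓ j`) diagonalize it. -/
structure DualEigen (N : V →ₗ[ℝ] W) (t : ℝ) (o : V) {q : ℕ} (b : Fin q → V) (ℓ : Fin q → ℝ) :
    Prop where
  norm_o : ‖o‖ = 1
  map_o : N o = 0
  adjoint_injective : Function.Injective N.adjoint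
  pos : 0 < t
  finrank_eq : Module.finrank ℝ V = q + 1
  antitone : Antitone ℓ
  inner_eq : ∀ j k, inner ℝ (b j) (b k) = if j = k then ℓ j else 0
  sum_eq : ∀ y, ∑ j, inner ℝ (b j) y • b j = N.adjoint (N y) + t • (y - inner ℝ o y • o)

namespace DualEigen

variable {N : V →ₗ[ℝ] W} {t : ℝ} {o : V} {q : ℕ} {b : Fin q → V} {ℓ : Fin q → ℝ}

lemma sum_sq_eq (h : DualEigen N t o b ℓ) (y : V) :
    ∑ j, inner ℝ (b j) y ^ 2 = ‖N y‖ ^ 2 + t * (‖y‖ ^ 2 - inner ℝ o y ^ 2) := by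
  have h1 := congrArg (fun z => inner ℝ z y) (h.sum_eq y)
  simp only [sum_inner, real_inner_smul_left, inner_add_left, inner_sub_left,
    LinearMap.adjoint_inner_left, real_inner_self_eq_norm_sq] at h1
  simp only [sq] at h1 ⊢
  exact h1

lemma inner_o (h : DualEigen N t o b ℓ) (j : Fin q) : inner ℝ o (b j) = 0 := by
  have h1 := h.sum_sq_eq o
  rw [h.map_o, real_inner_self_eq_norm_sq, h.norm_o] at h1
  simp only [norm_zero, one_pow, sub_self, mul_zero, ne_eq, OfNat.ofNat_ne_zero,
    not_false_eq_true, zero_pow, add_zero] at h1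
  rw [Finset.sum_eq_zero_iff_of_nonneg fun _ _ => sq_nonneg _] at h1
  rw [real_inner_comm]
  exact pow_eq_zero_iff two_ne_zero |>.1 (h1 j (Finset.mem_univ j))

lemma adjoint_map (h : DualEigen N t o b ℓ) (j : Fin q) :
    N.adjoint (N (b j)) = (ℓ j - t) • b j := by
  have h1 := h.sum_eq (b j)
  simp only [h.inner_eq, h.inner_o, ite_smul, zero_smul, Finset.sum_ite_eq', Finset.mem_univ,
    if_true, sub_zero] at h1
  rw [sub_smul, h1]; abel

lemma inner_map (h : DualEigen N t o b ℓ) (j k : Fin q) :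
    inner ℝ (N (b j)) (N (b k)) = if j = k then (ℓ j - t) * ℓ j else 0 := by
  rw [← LinearMap.adjoint_inner_left, h.adjoint_map, real_inner_smul_left, h.inner_eq]
  split_ifs <;> simp

/-- A vector orthogonal to `o` and to all the `b j` vanishes. -/
lemma eq_zero (h : DualEigen N t o b ℓ) {y : V} (ho : inner ℝ o y = 0)
    (hy : ∀ j, inner ℝ (b j) y = 0) : y = 0 := by
  have h1 := h.sum_sq_eq y
  simp only [hy, ho, ne_eq, OfNat.ofNat_ne_zero, not_false_eq_true, zero_pow,
    Finset.sum_const_zero, sub_zero] at h1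
  have h2 : t * ‖y‖ ^ 2 = 0 := by
    have := mul_nonneg h.pos.le (sq_nonneg ‖y‖)
    have := sq_nonneg ‖N y‖
    linarith
  rcases mul_eq_zero.1 h2 with h3 | h3
  · exact absurd h3 h.pos.ne'
  · exact norm_eq_zero.1 (pow_eq_zero_iff two_ne_zero |>.1 h3)

lemma eigenvalue_pos (h : DualEigen N t o b ℓ) (j : Fin q) : 0 < ℓ j := by
  have h0 : ℓ j = ‖b j‖ ^ 2 := by
    rw [← real_inner_self_eq_norm_sq, h.inner_eq, if_pos rfl]
  rw [h0]
  have hb : b j ≠ 0 := by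
    intro hb
    obtain ⟨y, -, hy0, hy⟩ := exists_mem_ne_zero_inner_eq_zero (⊤ : Submodule ℝ V)
      (fun k => if k = j then o else b k) (by
        rw [finrank_top, h.finrank_eq, Fintype.card_fin]; omega)
    refine hy0 (h.eq_zero (by simpa using hy j) fun k => ?_)
    by_cases hk : k = j
    · rw [hk, hb, inner_zero_left]
    · simpa [hk] using hy k
  positivity

lemma le_eigenvalue (h : DualEigen N t o b ℓ) (j : Fin q) : t ≤ ℓ j := by
  have h1 := h.inner_map j j
  rw [if_pos rfl, real_inner_self_eq_norm_sq] at h1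
  have h2 : 0 ≤ (ℓ j - t) * ℓ j := h1 ▸ sq_nonneg _
  nlinarith [h.eigenvalue_pos j]

/-- At most `finrank W` of the orthogonal vectors `N (b j)` are nonzero, so the trailing eigenvalues
are those of the noise. -/
lemma eigenvalue_eq (h : DualEigen N t o b ℓ) {j : Fin q} (hj : Module.finrank ℝ W ≤ j) :
    ℓ j = t := by
  refine le_antisymm ?_ (h.le_eigenvalue j)
  by_contra! hlt
  obtain ⟨k, hk⟩ := exists_eq_zero_of_pairwise_orthogonal
    (w := fun k : Fin (j + 1) => N (b (Fin.castLE (by omega) k))) (by simp; omega)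
    (fun k k' hkk' => by
      beta_reduce
      rw [h.inner_map, if_neg]
      simpa [Fin.ext_iff] using hkk')
  have h1 := h.inner_map (Fin.castLE (by omega) k) (Fin.castLE (by omega) k)
  rw [if_pos rfl, hk, inner_zero_left] at h1
  have h2 : ℓ j ≤ ℓ (Fin.castLE (by omega) k) := h.antitone (by
    rw [Fin.le_def]; simp; omega)
  have h3 := h.eigenvalue_pos (Fin.castLE (by omega) k)
  have : 0 < (ℓ (Fin.castLE (by omega) k) - t) * ℓ (Fin.castLE (by omega) k) :=
    mul_pos (by linarith) h3
  linarith

/-- The leading eigenvalues exceed the noise level because `N` has full rank. -/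
lemma lt_eigenvalue (h : DualEigen N t o b ℓ) {j : Fin q} (hj : j < Module.finrank ℝ W) :
    t < ℓ j := by
  refine lt_of_le_of_ne (h.le_eigenvalue j) fun hjt => ?_
  have hker : ∀ k, j ≤ k → N (b k) = 0 := by
    intro k hk
    have h1 := h.inner_map k k
    have h2 : ℓ k = t := le_antisymm ((h.antitone hk).trans hjt.ge) (h.le_eigenvalue k)
    rw [if_pos rfl, h2, sub_self, zero_mul] at h1
    exact inner_self_eq_zero.1 h1
  obtain ⟨x, -, hx0, hx⟩ := exists_mem_ne_zero_inner_eq_zero (⊤ : Submodule ℝ W)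
    (fun k : Fin j => N (b (Fin.castLE j.2.le k))) (by rw [finrank_top, Fintype.card_fin]; omega)
  have h1 : N.adjoint x = 0 := by
    refine h.eq_zero ?_ fun k => ?_
    · rw [LinearMap.adjoint_inner_right, h.map_o, inner_zero_left]
    · rw [LinearMap.adjoint_inner_right]
      by_cases hk : j ≤ k
      · rw [hker k hk, inner_zero_left]
      · exact hx ⟨k, by simpa using hk⟩
  exact hx0 (h.adjoint_injective (h1.trans (map_zero _).symm))

/-- The vectors `ℓ j⁻¹ N (b j)` are the limits of the projections of the sample PC directions onto
the true PC subspace: they point along an eigenbasis of `N N†` and have squared length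
`1 - t / ℓ j`. -/
lemma exists_orthonormalBasis (h : DualEigen N t o b ℓ) {m : ℕ} (hm : Module.finrank ℝ W = m)
    (hmq : m ≤ q) : ∃ e : OrthonormalBasis (Fin m) ℝ W, ∀ j : Fin m,
      (ℓ (Fin.castLE hmq j))⁻¹ • N (b (Fin.castLE hmq j)) =
        √(1 - t / ℓ (Fin.castLE hmq j)) • e j ∧
      N (N.adjoint (e j)) = (ℓ (Fin.castLE hmq j) - t) • e j := by
  set s : Fin m → ℝ := fun j => √((ℓ (Fin.castLE hmq j) - t) * ℓ (Fin.castLE hmq j)) with hs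
  have hlt : ∀ j : Fin m, t < ℓ (Fin.castLE hmq j) := fun j =>
    h.lt_eigenvalue (by rw [hm]; exact j.2)
  have hss : ∀ j, 0 < (ℓ (Fin.castLE hmq j) - t) * ℓ (Fin.castLE hmq j) := fun j =>
    mul_pos (sub_pos.2 (hlt j)) (h.eigenvalue_pos _)
  have hs0 : ∀ j, 0 < s j := fun j => Real.sqrt_pos.2 (hss j)
  have hon : Orthonormal ℝ fun j : Fin m => (s j)⁻¹ • N (b (Fin.castLE hmq j)) := by
    rw [orthonormal_iff_ite]
    intro j k
    rw [real_inner_smul_left, real_inner_smul_right, h.inner_map]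
    by_cases hjk : j = k
    · subst hjk
      have h1 : s j * s j = (ℓ (Fin.castLE hmq j) - t) * ℓ (Fin.castLE hmq j) :=
        Real.mul_self_sqrt (hss j).le
      rw [if_pos rfl, if_pos rfl, ← h1]
      have := (hs0 j).ne'
      field_simp
    · rw [if_neg hjk, if_neg (by simpa using hjk)]; simp
  refine ⟨OrthonormalBasis.mk hon ?_, fun j => ?_⟩
  · rw [hon.linearIndependent.span_eq_top_of_card_eq_finrank' (by simp [hm])]
  · rw [OrthonormalBasis.coe_mk, map_smul, map_smul, h.adjoint_map, map_smul]
    refine ⟨?_, smul_comm _ _ _⟩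
    rw [smul_smul]
    congr 1
    have h1 := h.eigenvalue_pos (Fin.castLE hmq j)
    have h2 : 1 - t / ℓ (Fin.castLE hmq j) =
        (ℓ (Fin.castLE hmq j) - t) * ℓ (Fin.castLE hmq j) / ℓ (Fin.castLE hmq j) ^ 2 := by
      field_simp
    rw [h2, Real.sqrt_div (hss j).le, Real.sqrt_sq h1.le]
    change _ = s j / _ * (s j)⁻¹
    have := (hs0 j).ne'
    field_simp

/-- The forms with eigenvalues `1 - t / ℓ j` and `ℓ j - t` have the same eigenspaces. -/
lemma exists_eigenvalue (h : DualEigen N t o b ℓ) {m : ℕ} (hmq : m ≤ q)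
    {e : OrthonormalBasis (Fin m) ℝ W}
    (he : ∀ j, N (N.adjoint (e j)) = (ℓ (Fin.castLE hmq j) - t) • e j) {γ : ℝ} {x : W}
    (hx : ∀ j, inner ℝ (e j) x ≠ 0 → 1 - t / ℓ (Fin.castLE hmq j) = γ) :
    ∃ μ : ℝ, N (N.adjoint x) = μ • x := by
  refine ⟨t / (1 - γ) - t, ?_⟩
  conv_lhs => rw [← e.sum_repr' x]
  conv_rhs => rw [← e.sum_repr' x]
  simp only [map_sum, map_smul, he, Finset.smul_sum]
  refine Finset.sum_congr rfl fun j _ => ?_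
  by_cases hj : inner ℝ (e j) x = 0
  · simp [hj]
  · rw [smul_comm]
    congr 1
    rw [← hx j hj]
    have h1 := h.eigenvalue_pos (Fin.castLE hmq j)
    have h2 := h.pos
    have h3 : 1 - (1 - t / ℓ (Fin.castLE hmq j)) = t / ℓ (Fin.castLE hmq j) := by ring
    rw [h3]
    field_simp

end DualEigen

end DualStructure

/-! ### Limits of the sample eigenvectors -/

section SampleDual

/-- `L j` (for `j < p`) are the eigenvalues of `∑ a, y a (y a)ᵀ`, in non-increasing order, with
orthonormal eigenvectors `uHat j`, and the vectors `y a` sum to zero. -/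
structure DualSample {n p : ℕ} (y : Fin n → Vec p) (uHat : ℕ → Vec p) (L : ℕ → ℝ) : Prop where
  lt : n < p
  orthonormal : Orthonormal ℝ fun j : Fin p => uHat j
  eigen : ∀ j < p, ∑ a, (inner ℝ (y a) (uHat j) : ℝ) • y a = L j • uHat j
  antitone : ∀ j k, j ≤ k → k < p → L k ≤ L j
  sum_eq_zero : ∑ a, y a = 0

lemma inner_toLp_toLp {κ : Type*} [Fintype κ] (f g : κ → ℝ) :
    inner ℝ (WithLp.toLp 2 f : EuclideanSpace ℝ κ) (WithLp.toLp 2 g) = ∑ a, f a * g a := by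
  simp [PiLp.inner_apply, mul_comm]

namespace DualSample

variable {n p : ℕ} {y : Fin n → Vec p} {uHat : ℕ → Vec p} {L : ℕ → ℝ}

lemma inner_uHat (h : DualSample y uHat L) {j k : ℕ} (hj : j < p) (hk : k < p) :
    inner ℝ (uHat j) (uHat k) = if j = k then (1 : ℝ) else 0 := by
  have := orthonormal_iff_ite.1 h.orthonormal ⟨j, hj⟩ ⟨k, hk⟩
  simpa [Fin.ext_iff] using this

lemma sum_inner_mul_inner (h : DualSample y uHat L) {j k : ℕ} (hj : j < p) (hk : k < p) :
    ∑ a, inner ℝ (y a) (uHat j) * inner ℝ (y a) (uHat k) = if j = k then L j else 0 := by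
  have h1 := congrArg (fun z => inner ℝ z (uHat k)) (h.eigen j hj)
  simp only [sum_inner, real_inner_smul_left] at h1
  rw [h1, h.inner_uHat hj hk]
  simp

lemma eigenvalue_nonneg (h : DualSample y uHat L) {j : ℕ} (hj : j < p) : 0 ≤ L j := by
  have h1 := h.sum_inner_mul_inner hj hj
  rw [if_pos rfl] at h1
  rw [← h1]
  exact Finset.sum_nonneg fun a _ => mul_self_nonneg _

/-- Only `n - 1` eigenvalues are nonzero, since centering makes the rank at most `n - 1`. -/
lemma eigenvalue_eq_zero (h : DualSample y uHat L) (hn : 0 < n) {j : ℕ} (hj : n - 1 ≤ j)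
    (hjp : j < p) : L j = 0 := by
  have hlt := h.lt
  refine le_antisymm ((h.antitone (n - 1) j hj hjp).trans ?_) (h.eigenvalue_nonneg hjp)
  by_contra! hpos
  let w : Option (Fin n) → EuclideanSpace ℝ (Fin n) := fun o =>
    o.elim (WithLp.toLp 2 fun _ => 1) fun j => WithLp.toLp 2 fun a => inner ℝ (y a) (uHat j)
  have hw1 : ∀ j : Fin n, inner ℝ (w none) (w (some j)) = 0 := by
    intro j
    simp only [w, Option.elim]
    rw [inner_toLp_toLp]
    simp only [one_mul]
    rw [← sum_inner, h.sum_eq_zero, inner_zero_left]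
  have hw2 : ∀ j k : Fin n, inner ℝ (w (some j)) (w (some k)) = if j = k then L j else 0 := by
    intro j k
    simp only [w, Option.elim]
    rw [inner_toLp_toLp, h.sum_inner_mul_inner (j.2.trans hlt) (k.2.trans hlt)]
    simp only [Fin.ext_iff]
  obtain ⟨o, ho⟩ := exists_eq_zero_of_pairwise_orthogonal (w := w) (by simp) (by
    rintro (_ | j) (_ | k) hjk
    · exact absurd rfl hjk
    · exact hw1 k
    · rw [real_inner_comm]; exact hw1 j
    · rw [hw2, if_neg]; exact fun h' => hjk (congrArg some h'))
  rcases o with _ | j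
  · have := congrArg (fun z : EuclideanSpace ℝ (Fin n) => z ⟨0, hn⟩) ho
    simp [w] at this
  · have h1 := hw2 j j
    rw [ho, inner_zero_left, if_pos rfl] at h1
    have := h.antitone j (n - 1) (by omega) (by omega)
    linarith

lemma inner_eq_zero (h : DualSample y uHat L) (hn : 0 < n) {j : ℕ} (hj : n - 1 ≤ j)
    (hjp : j < p) (a : Fin n) : inner ℝ (y a) (uHat j) = 0 := by
  have h1 := h.sum_inner_mul_inner hjp hjp
  rw [if_pos rfl, h.eigenvalue_eq_zero hn hj hjp,
    Finset.sum_eq_zero_iff_of_nonneg fun _ _ => mul_self_nonneg _] at h1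
  exact mul_self_eq_zero.1 (h1 a (Finset.mem_univ a))

lemma inner_eq_sum (h : DualSample y uHat L) (hn : 0 < n) (a a' : Fin n) :
    inner ℝ (y a) (y a') =
      ∑ j : Fin (n - 1), inner ℝ (y a) (uHat j) * inner ℝ (y a') (uHat j) := by
  have hlt := h.lt
  let E : OrthonormalBasis (Fin p) ℝ (Vec p) := OrthonormalBasis.mk h.orthonormal (by
    rw [h.orthonormal.linearIndependent.span_eq_top_of_card_eq_finrank' (by simp)])
  have hE : ∀ j, E j = uHat j := fun j => by simp [E]
  rw [← E.sum_inner_mul_inner]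
  simp only [hE]
  have h1 : ∀ j : Fin p, inner ℝ (y a) (uHat j) * inner ℝ (uHat j) (y a') =
      (fun j : ℕ => inner ℝ (y a) (uHat j) * inner ℝ (y a') (uHat j)) j := fun j => by
    rw [real_inner_comm (y a')]
  rw [Finset.sum_congr rfl fun j _ => h1 j,
    Fin.sum_univ_eq_sum_range (fun j : ℕ => inner ℝ (y a) (uHat j) * inner ℝ (y a') (uHat j)) p,
    Fin.sum_univ_eq_sum_range (fun j : ℕ => inner ℝ (y a) (uHat j) * inner ℝ (y a') (uHat j))
      (n - 1)]
  symm
  refine Finset.sum_subset (Finset.range_mono (by omega)) fun j hj hj' => ?_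
  rw [h.inner_eq_zero hn (by simpa using hj') (by simpa using hj), zero_mul]

end DualSample

lemma exists_tendsto_of_eventually_abs_le {ι : Type*} (l : Ultrafilter ι) (f : ι → ℝ) (C : ℝ)
    (h : ∀ᶠ i in (l : Filter ι), |f i| ≤ C) : ∃ x, Tendsto f l (𝓝 x) := by
  obtain ⟨x, -, hx⟩ := (isCompact_Icc (a := -C) (b := C)).ultrafilter_le_nhds (l.map f)
    (by
      rw [Ultrafilter.coe_map, le_principal_iff]
      exact h.mono fun i hi => abs_le.1 hi)
  exact ⟨x, hx⟩

variable {ι : Type*} {l : Ultrafilter ι} {n m r : ℕ} {p : ι → ℕ}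
  {y : (i : ι) → Fin n → Vec (p i)} {u uHat : (i : ι) → ℕ → Vec (p i)}
  {v : (i : ι) → Fin r → Vec (p i)} {L : ι → ℕ → ℝ} {A : Matrix (Fin m) (Fin r) ℝ}
  {VG : Matrix (Fin r) (Fin r) ℝ} {N : Matrix (Fin m) (Fin n) ℝ} {t : ℝ}

/-- The limits of the inner products of the centered and rescaled observations `y a` with each
other, with the true PC directions and with the references. -/
structure DualLimits (l : Filter ι) (y : (i : ι) → Fin n → Vec (p i))
    (u : (i : ι) → ℕ → Vec (p i)) (v : (i : ι) → Fin r → Vec (p i))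
    (A : Matrix (Fin m) (Fin r) ℝ) (N : Matrix (Fin m) (Fin n) ℝ) (t : ℝ) : Prop where
  y_y : ∀ a a', Tendsto (fun i => inner ℝ (y i a) (y i a')) l
    (𝓝 (∑ s, N s a * N s a' + t * ((if a = a' then 1 else 0) - (n : ℝ)⁻¹)))
  u_y : ∀ (s : Fin m) a, Tendsto (fun i => inner ℝ (u i s) (y i a)) l (𝓝 (N s a))
  v_y : ∀ k a, Tendsto (fun i => inner ℝ (v i k) (y i a)) l (𝓝 (∑ s, A s k * N s a))
  t_pos : 0 < t
  sum_N : ∀ s, ∑ a, N s a = 0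
  injective : ∀ x : Fin m → ℝ, (∀ a, ∑ s, x s * N s a = 0) → x = 0

/-- Along an ultrafilter, the inner products of observations and sample PC directions converge, and
their limits diagonalize the limiting dual covariance matrix. -/
lemma exists_dualEigen (hn : 0 < n) (hS : ∀ᶠ i in (l : Filter ι), DualSample (y i) (uHat i) (L i))
    (hl : DualLimits (l : Filter ι) y u v A N t) :
    ∃ (b : Fin (n - 1) → EuclideanSpace ℝ (Fin n)) (ℓ : Fin (n - 1) → ℝ),
      (∀ (j : Fin (n - 1)) a, Tendsto (fun i => inner ℝ (y i a) (uHat i j)) l (𝓝 (b j a))) ∧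
      (∀ j : Fin (n - 1), Tendsto (fun i => L i j) l (𝓝 (ℓ j))) ∧
      DualEigen N.toEuclideanLin t (WithLp.toLp 2 fun _ => (√n)⁻¹) b ℓ := by
  have hex : ∀ (j : Fin (n - 1)) (a : Fin n), ∃ x,
      Tendsto (fun i => inner ℝ (y i a) (uHat i j)) l (𝓝 x) := by
    intro j a
    have h1 := (hl.y_y a a).eventually (gt_mem_nhds (lt_add_one _))
    refine exists_tendsto_of_eventually_abs_le l _
      (√(∑ s, N s a * N s a + t * ((if a = a then 1 else 0) - (n : ℝ)⁻¹) + 1)) ?_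
    filter_upwards [h1, hS] with i hi hSi
    have hlt := hSi.lt
    refine (abs_real_inner_le_norm _ _).trans ?_
    have h2 : ‖uHat i j‖ = 1 := hSi.orthonormal.1 ⟨j, by omega⟩
    rw [h2, mul_one]
    refine Real.le_sqrt_of_sq_le ?_
    rw [← real_inner_self_eq_norm_sq]
    exact hi.le
  choose B hB using hex
  have hL : ∀ j : Fin (n - 1), Tendsto (fun i => L i j) l (𝓝 (∑ a, B j a * B j a)) := by
    intro j
    have h1 : Tendsto (fun i => ∑ a, inner ℝ (y i a) (uHat i j) * inner ℝ (y i a) (uHat i j)) l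
        (𝓝 (∑ a, B j a * B j a)) := tendsto_finsetSum _ fun a _ => (hB j a).mul (hB j a)
    refine h1.congr' ?_
    filter_upwards [hS] with i hSi
    have hlt := hSi.lt
    rw [hSi.sum_inner_mul_inner (by omega) (by omega), if_pos rfl]
  have hn' : (n : ℝ) ≠ 0 := Nat.cast_ne_zero.2 hn.ne'
  have hsn : (√(n : ℝ))⁻¹ * (√(n : ℝ))⁻¹ = (n : ℝ)⁻¹ := by
    rw [← mul_inv, Real.mul_self_sqrt (Nat.cast_nonneg n)]
  refine ⟨fun j => WithLp.toLp 2 (B j), fun j => ∑ a, B j a * B j a, hB, hL, ?_⟩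
  refine ⟨?_, ?_, ?_, hl.t_pos, ?_, ?_, ?_, ?_⟩
  · have h1 : ‖(WithLp.toLp 2 fun _ => (√n)⁻¹ : EuclideanSpace ℝ (Fin n))‖ ^ 2 = 1 := by
      rw [EuclideanSpace.norm_sq_eq]
      simp [hn']
    exact (pow_eq_one_iff_of_nonneg (norm_nonneg _) two_ne_zero).1 h1
  · ext s
    simp only [Matrix.toLpLin_apply, Matrix.mulVec, dotProduct]
    rw [← Finset.sum_mul, hl.sum_N s]
    simp
  · rw [← Matrix.toEuclideanLin_conjTranspose_eq_adjoint, ← LinearMap.ker_eq_bot,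
      LinearMap.ker_eq_bot']
    intro x hx
    have h1 := hl.injective x fun a => by
      have := congrArg (fun z : EuclideanSpace ℝ (Fin n) => z a) hx
      simp only [Matrix.toLpLin_apply, Matrix.mulVec, dotProduct,
        Matrix.conjTranspose_apply, star_trivial] at this
      rw [← PiLp.zero_apply (p := 2) (β := fun _ : Fin n => ℝ) a, ← this]
      exact Finset.sum_congr rfl fun s _ => mul_comm _ _
    ext s
    exact congrFun h1 s
  · simp; omega
  · intro j k hjk
    refine le_of_tendsto_of_tendsto (hL k) (hL j) ?_
    filter_upwards [hS] with i hSi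
    have hlt := hSi.lt
    exact hSi.antitone j k hjk (by omega)
  · intro j k
    have h1 : Tendsto (fun i => ∑ a, inner ℝ (y i a) (uHat i j) * inner ℝ (y i a) (uHat i k)) l
        (𝓝 (∑ a, B j a * B k a)) := tendsto_finsetSum _ fun a _ => (hB j a).mul (hB k a)
    rw [inner_toLp_toLp]
    by_cases hjk : j = k
    · subst hjk; simp
    · rw [if_neg hjk]
      refine tendsto_nhds_unique h1 (tendsto_const_nhds.congr' ?_)
      filter_upwards [hS] with i hSi
      have hlt := hSi.lt
      rw [hSi.sum_inner_mul_inner (by omega) (by omega), if_neg]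
      exact fun h' => hjk (Fin.ext h')
  · intro z
    have hH : ∀ a a', ∑ j, B j a * B j a' =
        ∑ s, N s a * N s a' + t * ((if a = a' then 1 else 0) - (n : ℝ)⁻¹) := by
      intro a a'
      refine tendsto_nhds_unique (tendsto_finsetSum _ fun j _ => (hB j a).mul (hB j a')) ?_
      refine (hl.y_y a a').congr' ?_
      filter_upwards [hS] with i hSi
      exact hSi.inner_eq_sum hn a a'
    rw [← Matrix.toEuclideanLin_conjTranspose_eq_adjoint]
    ext a
    simp only [WithLp.ofLp_sum, WithLp.ofLp_smul, Finset.sum_apply, Pi.smul_apply, smul_eq_mul,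
      PiLp.inner_apply, RCLike.inner_apply, conj_trivial, WithLp.ofLp_add, Pi.add_apply,
      WithLp.ofLp_sub, Pi.sub_apply, Matrix.toLpLin_apply, Matrix.mulVec, dotProduct,
      Matrix.conjTranspose_apply, star_trivial]
    have h1 : ∑ j, (∑ a', z a' * B j a') * B j a = ∑ a', z a' * ∑ j, B j a * B j a' := by
      simp_rw [Finset.sum_mul, Finset.mul_sum]
      rw [Finset.sum_comm]
      exact Finset.sum_congr rfl fun a' _ => Finset.sum_congr rfl fun j _ => by ring
    have h2 : ∑ s, N s a * ∑ a', N s a' * z a' = ∑ a', z a' * ∑ s, N s a * N s a' := by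
      simp_rw [Finset.mul_sum]
      rw [Finset.sum_comm]
      exact Finset.sum_congr rfl fun a' _ => Finset.sum_congr rfl fun j _ => by ring
    rw [h1, h2]
    simp_rw [hH, mul_add, Finset.sum_add_distrib]
    congr 1
    have h3 : ∀ a', z a' * (t * ((if a = a' then 1 else 0) - (n : ℝ)⁻¹)) =
        t * (if a = a' then z a' else 0) - t * (n : ℝ)⁻¹ * z a' := by
      intro a'
      split_ifs <;> ring
    rw [Finset.sum_congr rfl fun a' _ => h3 a', Finset.sum_sub_distrib, ← Finset.mul_sum,
      ← Finset.mul_sum, ← Finset.sum_mul]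
    simp only [Finset.sum_ite_eq, Finset.mem_univ, if_true]
    linear_combination (t * ∑ a', z a') * hsn

end SampleDual

/-! ### The ridged discriminant vectors -/

section Ridged

lemma toEuclideanLin_spikedPart_sub {p m : ℕ} (l : ℕ → ℝ) (u : ℕ → Vec p) (a : ℝ) (x : Vec p) :
    Matrix.toEuclideanLin (spikedPart m l u - a • (1 : Matrix (Fin p) (Fin p) ℝ)) x =
      ∑ j : Fin m, (l j * inner ℝ (u j) x) • u j - a • x := by
  rw [map_sub, map_smul, LinearMap.sub_apply, LinearMap.smul_apply, spikedPart, map_sum,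
    LinearMap.sum_apply]
  congr 1
  · rw [Finset.sum_range (fun j => Matrix.toEuclideanLin (l j • Matrix.vecMulVec ⇑(u j) ⇑(u j)) x)]
    refine Finset.sum_congr rfl fun j _ => ?_
    ext b
    change ∑ c, (l j * (u j b * u j c)) * x c = l j * inner ℝ (u j) x * u j b
    simp only [PiLp.inner_apply, RCLike.inner_apply, conj_trivial, Finset.mul_sum,
      Finset.sum_mul]
    exact Finset.sum_congr rfl fun c _ => by ring
  · ext b
    simp

/-- The conditions on the ridge make `S_m - λ̃ I` invertible: its eigenvalues are `λ̂ⱼ - λ̃` and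
`-λ̃`. -/
lemma ridgedVector_eq {p n m : ℕ} {l : ℕ → ℝ} {u : ℕ → Vec p}
    (hu : Orthonormal ℝ fun j : Fin m => u j) (h0 : ridge n m l ≠ 0)
    (hne : ∀ j : Fin m, l j ≠ ridge n m l) (x : Vec p) :
    ridgedVector n m l u x =
      ridgedSum m u (fun j => ridge n m l / (l j - ridge n m l)) x := by
  set a := ridge n m l with ha
  set M := spikedPart m l u - a • (1 : Matrix (Fin p) (Fin p) ℝ) with hM
  have key : ∀ y, Matrix.toEuclideanLin M (ridgedSum m u (fun j => a / (l j - a)) y) =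
      (-a) • y := by
    intro y
    have h1 : ∀ j : Fin m, inner ℝ (u j) (ridgedSum m u (fun j => a / (l j - a)) y) =
        -(a / (l j - a)) * inner ℝ (u j) y := by
      intro j
      rw [ridgedSum, inner_sub_right, hu.inner_right_fintype]
      ring
    rw [hM, toEuclideanLin_spikedPart_sub]
    have h2 : ∀ j : Fin m, l j * (-(a / (l j - a)) * inner ℝ (u j) y) =
        -(a * ((1 + a / (l j - a)) * inner ℝ (u j) y)) := by
      intro j
      have := sub_ne_zero.2 (hne j)
      field_simp
      ring
    simp_rw [h1, h2]
    rw [ridgedSum, smul_sub, Finset.smul_sum]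
    simp only [smul_smul, neg_smul, Finset.sum_neg_distrib]
    abel
  have hunit : IsUnit M := by
    rw [← Matrix.mulVec_surjective_iff_isUnit]
    intro z
    refine ⟨ridgedSum m u (fun j => a / (l j - a)) ((-a)⁻¹ • WithLp.toLp 2 z), ?_⟩
    have h1 := congrArg WithLp.ofLp (key ((-a)⁻¹ • WithLp.toLp 2 z))
    rw [smul_smul, mul_inv_cancel₀ (neg_ne_zero.2 h0), one_smul] at h1
    simpa [Matrix.toLpLin_apply] using h1
  have h1 : Matrix.toEuclideanLin M⁻¹ (Matrix.toEuclideanLin M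
      (ridgedSum m u (fun j => a / (l j - a)) x)) =
      ridgedSum m u (fun j => a / (l j - a)) x := by
    ext b
    simp [Matrix.toLpLin_apply, Matrix.mulVec_mulVec,
      Matrix.nonsing_inv_mul _ ((Matrix.isUnit_iff_isUnit_det _).1 hunit)]
  rw [ridgedVector, ← ha, ← hM, ← h1, key, map_smul]

end Ridged

/-! ### Existence of the limits along an ultrafilter -/

section Existence

variable {ι : Type*} {l : Ultrafilter ι} {n m r : ℕ} {p : ι → ℕ}
  {y : (i : ι) → Fin n → Vec (p i)} {u uHat : (i : ι) → ℕ → Vec (p i)}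
  {v : (i : ι) → Fin r → Vec (p i)} {L : ι → ℕ → ℝ} {A : Matrix (Fin m) (Fin r) ℝ}
  {VG : Matrix (Fin r) (Fin r) ℝ} {N : Matrix (Fin m) (Fin n) ℝ} {t : ℝ}

/-- The inner products of the sample PC directions with the true ones and with the references
converge as required by `AlignedLimits`, with `c j = 1 - t / ℓ j`. The eigenvectors of the form
`∑ j, c j ⟪e j, x⟫²` are eigenvectors of `N Nᵀ`, and the ridge eventually differs from zero and from
all the leading eigenvalues. -/
theorem exists_alignedLimits (hmn : m + 2 ≤ n)
    (hS : ∀ᶠ i in (l : Filter ι), DualSample (y i) (uHat i) (L i))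
    (hl : DualLimits (l : Filter ι) y u v A N t)
    (hu : ∀ᶠ i in (l : Filter ι), Orthonormal ℝ (fun a : Fin m => u i a))
    (hvu : ∀ k (a : Fin m), Tendsto (fun i => inner ℝ (v i k) (u i a)) l (𝓝 (A a k)))
    (hvv : ∀ k k', Tendsto (fun i => inner ℝ (v i k) (v i k')) l (𝓝 (VG k k')))
    (hVG : IsUnit VG.det) :
    ∃ (e : OrthonormalBasis (Fin m) ℝ (EuclideanSpace ℝ (Fin m))) (c : Fin m → ℝ),
      AlignedLimits (l : Filter ι) u uHat v
        (fun i j => ridge n m (L i) / (L i j - ridge n m (L i))) A VG e c ∧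
      (∀ (γ : ℝ) (x : EuclideanSpace ℝ (Fin m)), (∀ j, inner ℝ (e j) x ≠ 0 → c j = γ) →
        ∃ μ : ℝ, ∀ s, ∑ s', (∑ a, N s a * N s' a) * x s' = μ * x s) ∧
      (∀ᶠ i in (l : Filter ι), ridge n m (L i) ≠ 0 ∧ ∀ j : Fin m, L i j ≠ ridge n m (L i)) := by
  obtain ⟨b, ℓ, hb, hℓ, hD⟩ := exists_dualEigen (by omega) hS hl
  have hmq : m ≤ n - 1 := by omega
  obtain ⟨e, he⟩ := hD.exists_orthonormalBasis (m := m) (by simp) hmq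
  have hpos := fun j => hD.eigenvalue_pos j
  have hlt : ∀ j : Fin m, t < ℓ (Fin.castLE hmq j) := fun j => hD.lt_eigenvalue (by simp)
  have hridge : Tendsto (fun i => ridge n m (L i)) l (𝓝 t) := by
    have h1 : Tendsto (fun i => (∑ j ∈ Finset.Ico m (n - 1), L i j) / ((n : ℝ) - m - 1)) l
        (𝓝 ((∑ j ∈ Finset.Ico m (n - 1), t) / ((n : ℝ) - m - 1))) := by
      refine (tendsto_finsetSum _ fun j hj => ?_).div_const _
      rw [Finset.mem_Ico] at hj
      have := hℓ ⟨j, hj.2⟩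
      rwa [hD.eigenvalue_eq (by simpa using hj.1)] at this
    have h2 : (∑ j ∈ Finset.Ico m (n - 1), t) / ((n : ℝ) - m - 1) = t := by
      have h3 : (m : ℝ) + 2 ≤ n := by exact_mod_cast hmn
      have h4 : (n : ℝ) - m - 1 ≠ 0 := by linarith
      rw [Finset.sum_const, Nat.card_Ico, nsmul_eq_mul, Nat.cast_sub hmq,
        Nat.cast_sub (by omega), Nat.cast_one]
      field_simp
      ring
    rw [h2] at h1
    exact h1
  -- each leading sample eigenvector is a combination of the observations
  have huy : ∀ (z : (i : ι) → Vec (p i)) (q : Fin n → ℝ),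
      (∀ a, Tendsto (fun i => inner ℝ (z i) (y i a)) l (𝓝 (q a))) → ∀ j : Fin m,
      Tendsto (fun i => inner ℝ (z i) (uHat i j)) l
        (𝓝 ((ℓ (Fin.castLE hmq j))⁻¹ * ∑ a, q a * b (Fin.castLE hmq j) a)) := by
    intro z q hz j
    have h1 : Tendsto (fun i => (L i j)⁻¹ * ∑ a, inner ℝ (z i) (y i a) *
        inner ℝ (y i a) (uHat i j)) l
        (𝓝 ((ℓ (Fin.castLE hmq j))⁻¹ * ∑ a, q a * b (Fin.castLE hmq j) a)) :=
      ((hℓ (Fin.castLE hmq j)).inv₀ (hpos _).ne').mul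
        (tendsto_finsetSum _ fun a _ => (hz a).mul (hb (Fin.castLE hmq j) a))
    refine h1.congr' ?_
    filter_upwards [hS, (hℓ (Fin.castLE hmq j)).eventually_ne (hpos _).ne'] with i hSi hi
    have hi' : L i j ≠ 0 := hi
    have hlt := hSi.lt
    have h2 := congrArg (fun x => inner ℝ (z i) x) (hSi.eigen j (by omega))
    simp only [inner_sum, real_inner_smul_right] at h2
    rw [Finset.sum_congr rfl fun a _ => mul_comm _ _, h2]
    field_simp
  have hcoord : ∀ (j s : Fin m), (ℓ (Fin.castLE hmq j))⁻¹ *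
      ∑ a, N s a * b (Fin.castLE hmq j) a = √(1 - t / ℓ (Fin.castLE hmq j)) * e j s := by
    intro j s
    have := congrArg (fun x : EuclideanSpace ℝ (Fin m) => x s) (he j).1
    simpa [Matrix.toLpLin_apply, Matrix.mulVec, dotProduct] using this
  refine ⟨e, fun j => 1 - t / ℓ (Fin.castLE hmq j), ?_, ?_, ?_⟩
  · refine ⟨hu, ?_, ?_, ?_, hvu, hvv, ?_, hVG, ?_, ?_, ?_⟩
    · filter_upwards [hS] with i hSi
      have hlt := hSi.lt
      exact hSi.orthonormal.comp (Fin.castLE (by omega)) (Fin.castLE_injective _)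
    · intro a j
      rw [← hcoord]
      exact huy (fun i => u i a) (N a) (hl.u_y a) j
    · intro k j
      have h1 := huy (fun i => v i k) _ (hl.v_y k) j
      convert h1 using 2
      rw [Finset.mul_sum]
      have h2 : ∀ s, √(1 - t / ℓ (Fin.castLE hmq j)) * (A s k * e j s) =
          (ℓ (Fin.castLE hmq j))⁻¹ * ∑ a, A s k * N s a * b (Fin.castLE hmq j) a := by
        intro s
        simp_rw [mul_assoc (A s k), ← Finset.mul_sum]
        linear_combination (-A s k) * hcoord j s
      rw [Finset.sum_congr rfl fun s _ => h2 s, ← Finset.mul_sum, Finset.sum_comm]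
      simp_rw [Finset.sum_mul]
    · intro j
      have h1 := hridge.div ((hℓ (Fin.castLE hmq j)).sub hridge) (sub_ne_zero.2 (hlt j).ne')
      have h2 := (hpos (Fin.castLE hmq j)).ne'
      have h3 : ℓ (Fin.castLE hmq j) - t ≠ 0 := sub_ne_zero.2 (hlt j).ne'
      have h4 : 1 - t / ℓ (Fin.castLE hmq j) =
        (ℓ (Fin.castLE hmq j) - t) / ℓ (Fin.castLE hmq j) := by field_simp
      have h5 : (1 - (1 - t / ℓ (Fin.castLE hmq j))) / (1 - t / ℓ (Fin.castLE hmq j)) =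
          t / (ℓ (Fin.castLE hmq j) - t) := by
        rw [sub_sub_cancel, h4]
        field_simp
      rw [h5]
      exact h1
    · intro j
      have := (div_lt_one (hpos _)).2 (hlt j)
      linarith
    · intro j
      have := div_pos hl.t_pos (hpos (Fin.castLE hmq j))
      linarith
    · intro j k hjk
      have h1 : ℓ (Fin.castLE hmq k) ≤ ℓ (Fin.castLE hmq j) := hD.antitone hjk
      have := div_le_div_of_nonneg_left hl.t_pos.le (hpos _) h1
      beta_reduce
      linarith
  · intro γ x hx
    obtain ⟨μ, hμ⟩ := hD.exists_eigenvalue hmq (fun j => (he j).2) hx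
    refine ⟨μ, fun s => ?_⟩
    have h1 := congrArg (fun z : EuclideanSpace ℝ (Fin m) => z s) hμ
    rw [← Matrix.toEuclideanLin_conjTranspose_eq_adjoint] at h1
    simp only [Matrix.toLpLin_apply, Matrix.mulVec, dotProduct, Matrix.conjTranspose_apply,
      star_trivial, WithLp.ofLp_smul, Pi.smul_apply, smul_eq_mul] at h1
    rw [← h1]
    simp_rw [Finset.sum_mul, Finset.mul_sum]
    rw [Finset.sum_comm]
    exact Finset.sum_congr rfl fun a _ => Finset.sum_congr rfl fun s' _ => by ring
  · refine (hridge.eventually_ne hl.t_pos.ne').and (eventually_all.2 fun j => ?_)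
    have h1 := ((hℓ (Fin.castLE hmq j)).sub hridge).eventually_ne (sub_ne_zero.2 (hlt j).ne')
    filter_upwards [h1] with i hi
    exact sub_ne_zero.1 hi

end Existence

/-! ### Genericity of absolutely continuous scores -/

section NullSets

/-- The zero set of a function which does not vanish at `x₀`, and is polynomial on every line
through `x₀`, is a null set: it meets each of these lines in finitely many points. Fubini is applied
to the pairs `(t, y)` with `f (x₀ + t • y) = 0`, and the null set found for one `t ≠ 0` is
rescaled. -/
lemma measure_zeros_eq_zero {E : Type*} [NormedAddCommGroup E] [NormedSpace ℝ E]
    [FiniteDimensional ℝ E] [MeasurableSpace E] [BorelSpace E] (μ : Measure E)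
    [μ.IsAddHaarMeasure] {f : E → ℝ} (hf : Continuous f) {x₀ : E} (hx₀ : f x₀ ≠ 0)
    (hpoly : ∀ y, ∃ q : Polynomial ℝ, ∀ t : ℝ, f (x₀ + t • y) = q.eval t) :
    μ {x | f x = 0} = 0 := by
  set S : Set E := {y | f (x₀ + y) = 0} with hS
  have hSm : MeasurableSet S :=
    (measurableSet_singleton (0 : ℝ)).preimage (by fun_prop : Measurable fun y => f (x₀ + y))
  have hprod : MeasurableSet {z : ℝ × E | z.1 • z.2 ∈ S} :=
    hSm.preimage (by fun_prop : Measurable fun z : ℝ × E => z.1 • z.2)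
  have hnull : (volume.prod μ) {z : ℝ × E | z.1 • z.2 ∈ S} = 0 := by
    rw [Measure.prod_apply_symm hprod,
      lintegral_eq_zero_iff (measurable_measure_prodMk_right hprod)]
    refine Eventually.of_forall fun y => ?_
    obtain ⟨q, hq⟩ := hpoly y
    have hq0 : q ≠ 0 := by
      rintro rfl
      apply hx₀
      simpa using hq 0
    refine Set.Finite.measure_zero ((q.rootSet_finite ℝ).subset fun t ht => ?_) volume
    rw [Polynomial.mem_rootSet]
    refine ⟨hq0, ?_⟩
    have h1 : f (x₀ + t • y) = 0 := ht
    rw [Polynomial.coe_aeval_eq_eval, ← hq, h1]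
  have hae := Measure.ae_ae_of_ae_prod (measure_eq_zero_iff_ae_notMem.1 hnull)
  have hne : ∀ᵐ t : ℝ, t ≠ 0 := by
    simp [ae_iff]
  obtain ⟨t, ht, ht0⟩ := (hae.and hne).exists
  have h1 : μ ((fun y : E => t • y) ⁻¹' S) = 0 := measure_eq_zero_iff_ae_notMem.2 ht
  rw [Measure.addHaar_preimage_smul μ ht0] at h1
  have h2 : μ S = 0 := by
    rcases mul_eq_zero.1 h1 with h3 | h3
    · rw [ENNReal.ofReal_eq_zero, abs_nonpos_iff] at h3
      exact absurd h3 (inv_ne_zero (pow_ne_zero _ ht0))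
    · exact h3
  have h3 : S = (fun y => x₀ + y) ⁻¹' {x | f x = 0} := rfl
  rwa [h3, measure_preimage_add] at h2

lemma absolutelyContinuous_pi {α : Type*} [MeasurableSpace α] {n : ℕ} (μ ν : Fin n → Measure α)
    [∀ i, SigmaFinite (μ i)] [∀ i, SigmaFinite (ν i)] (h : ∀ i, μ i ≪ ν i) :
    Measure.pi μ ≪ Measure.pi ν := by
  induction n with
  | zero =>
    rw [Measure.pi_of_empty, Measure.pi_of_empty]
  | succ n ih =>
    rw [← (measurePreserving_piFinSuccAbove μ 0).symm.map_eq,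
      ← (measurePreserving_piFinSuccAbove ν 0).symm.map_eq]
    exact ((h 0).prod (ih _ _ fun i => h _)).map (MeasurableEquiv.measurable _)

end NullSets

section Krylov

open scoped Matrix

variable {m n : ℕ} {R S : Type*} [CommRing R] [CommRing S]

/-- The product of `det (N Nᵀ)` and of the determinant of the Krylov matrix with columns
`(N Nᵀ) ^ k a`, for `N = diag σ * Z * C`. If it does not vanish, then `N` has full row rank and
no eigenvector of `N Nᵀ` is orthogonal to `a`. -/
def krylovDet (σ : Fin m → R) (C : Matrix (Fin n) (Fin n) R) (a : Fin m → R)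
    (Z : Matrix (Fin m) (Fin n) R) : R :=
  ((Matrix.diagonal σ * Z * C) * (Matrix.diagonal σ * Z * C)ᵀ).det *
    (Matrix.of fun i j : Fin m =>
      (((Matrix.diagonal σ * Z * C) * (Matrix.diagonal σ * Z * C)ᵀ) ^ (j : ℕ) *ᵥ a) i).det

lemma map_krylovDet (f : R →+* S) (σ : Fin m → R) (C : Matrix (Fin n) (Fin n) R) (a : Fin m → R)
    (Z : Matrix (Fin m) (Fin n) R) :
    f (krylovDet σ C a Z) = krylovDet (f ∘ σ) (C.map f) (f ∘ a) (Z.map f) := by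
  have h1 : (Matrix.diagonal σ * Z * C).map f =
      Matrix.diagonal (f ∘ σ) * Z.map f * C.map f := by
    rw [Matrix.map_mul, Matrix.map_mul, Matrix.diagonal_map (map_zero f)]
    rfl
  have h2 : ((Matrix.diagonal σ * Z * C) * (Matrix.diagonal σ * Z * C)ᵀ).map f =
      (Matrix.diagonal (f ∘ σ) * Z.map f * C.map f) *
        (Matrix.diagonal (f ∘ σ) * Z.map f * C.map f)ᵀ := by
    rw [Matrix.map_mul, Matrix.transpose_map, h1]
  rw [krylovDet, krylovDet, map_mul, RingHom.map_det, RingHom.map_det, ← h2]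
  congr 2
  ext i j
  simp only [RingHom.mapMatrix_apply, Matrix.map_apply, Matrix.of_apply]
  rw [RingHom.map_mulVec, Matrix.map_pow]

lemma krylovDet_line (σ : Fin m → ℝ) (C : Matrix (Fin n) (Fin n) ℝ) (a : Fin m → ℝ)
    (Z Y : Matrix (Fin m) (Fin n) ℝ) :
    ∃ q : Polynomial ℝ, ∀ t : ℝ, krylovDet σ C a (Z + t • Y) = q.eval t := by
  refine ⟨krylovDet (Polynomial.C ∘ σ) (C.map Polynomial.C) (Polynomial.C ∘ a)
    (Z.map Polynomial.C + (Polynomial.X : Polynomial ℝ) • Y.map Polynomial.C), fun t => ?_⟩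
  rw [← Polynomial.coe_evalRingHom, map_krylovDet]
  congr 1
  · ext; simp
  · ext; simp
  · ext; simp
  · ext; simpa using mul_comm _ _

/-- An eigenvector of a symmetric matrix orthogonal to `a` is orthogonal to the whole Krylov space
of `a`. -/
lemma eigenvector_dotProduct_ne_zero {Φ : Matrix (Fin m) (Fin m) ℝ} (hΦ : Φᵀ = Φ)
    {a : Fin m → ℝ}
    (h : (Matrix.of fun i j : Fin m => (Φ ^ (j : ℕ) *ᵥ a) i).det ≠ 0) {μ : ℝ} {x : Fin m → ℝ}
    (hx : x ≠ 0) (hμ : Φ *ᵥ x = μ • x) : x ⬝ᵥ a ≠ 0 := by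
  intro h0
  have h1 : ∀ k : ℕ, x ⬝ᵥ (Φ ^ k *ᵥ a) = 0 := by
    intro k
    induction k with
    | zero => simpa using h0
    | succ k ih =>
      rw [pow_succ', ← Matrix.mulVec_mulVec, Matrix.dotProduct_mulVec, ← Matrix.mulVec_transpose,
        hΦ, hμ, smul_dotProduct, ih, smul_zero]
  refine hx (Matrix.eq_zero_of_vecMul_eq_zero h ?_)
  funext j
  exact h1 j

lemma exists_orthonormal_sum_eq_zero (h : m < n) :
    ∃ B : Matrix (Fin m) (Fin n) ℝ, B * Bᵀ = 1 ∧ ∀ k, ∑ a, B k a = 0 := by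
  let o : EuclideanSpace ℝ (Fin n) := WithLp.toLp 2 fun _ => 1
  have ho : o ≠ 0 := by
    intro h0
    have := congrArg (fun z : EuclideanSpace ℝ (Fin n) => z ⟨0, by omega⟩) h0
    simp [o] at this
  have hfr : Module.finrank ℝ (ℝ ∙ o)ᗮ = n - 1 := by
    have h1 := Submodule.finrank_add_finrank_orthogonal (ℝ ∙ o)
    rw [finrank_span_singleton ho] at h1
    simp at h1
    omega
  let b := (stdOrthonormalBasis ℝ (ℝ ∙ o)ᗮ).reindex (finCongr hfr)
  refine ⟨Matrix.of fun k a => (b (Fin.castLE (by omega) k) : EuclideanSpace ℝ (Fin n)) a, ?_, ?_⟩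
  · ext j k
    have h1 := orthonormal_iff_ite.1 b.orthonormal (Fin.castLE (by omega) k)
      (Fin.castLE (by omega) j)
    rw [Submodule.coe_inner, PiLp.inner_apply] at h1
    simp only [RCLike.inner_apply, conj_trivial] at h1
    rw [Matrix.mul_apply, Matrix.one_apply]
    simp only [Matrix.of_apply, Matrix.transpose_apply]
    rw [h1]
    simp [Fin.ext_iff, eq_comm]
  · intro k
    have h1 := Submodule.mem_orthogonal_singleton_iff_inner_right.1 (b (Fin.castLE (by omega) k)).2
    rw [PiLp.inner_apply] at h1
    simpa [o] using h1

/-- A reflection moving `a` onto the diagonal provides an orthogonal matrix none of whose columns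
is orthogonal to `a`. -/
lemma exists_orthogonal_matrix_ne_zero (hm : 0 < m) {a : Fin m → ℝ} (ha : a ≠ 0) :
    ∃ Q : Matrix (Fin m) (Fin m) ℝ, Qᵀ * Q = 1 ∧ ∀ k, (Qᵀ *ᵥ a) k ≠ 0 := by
  let a' : EuclideanSpace ℝ (Fin m) := WithLp.toLp 2 a
  have ha' : 0 < ‖a'‖ := by
    rw [norm_pos_iff]
    intro h0
    exact ha (congrArg WithLp.ofLp h0)
  let w : EuclideanSpace ℝ (Fin m) := WithLp.toLp 2 fun _ => ‖a'‖ / √m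
  have hm' : (0 : ℝ) < m := Nat.cast_pos.2 hm
  have hw : ‖a'‖ = ‖w‖ := by
    rw [← sq_eq_sq₀ (norm_nonneg _) (norm_nonneg _), EuclideanSpace.norm_sq_eq w]
    simp only [w, Real.norm_eq_abs, sq_abs, div_pow, Real.sq_sqrt hm'.le, Finset.sum_const,
      Finset.card_univ, Fintype.card_fin, nsmul_eq_mul]
    field_simp
  let ρ := (ℝ ∙ (a' - w))ᗮ.reflection
  have hρ : ρ a' = w := Submodule.reflection_sub hw
  let q := (EuclideanSpace.basisFun (Fin m) ℝ).map ρ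
  refine ⟨Matrix.of fun i k => q k i, ?_, ?_⟩
  · ext j k
    have h1 := orthonormal_iff_ite.1 q.orthonormal k j
    rw [PiLp.inner_apply] at h1
    simp only [RCLike.inner_apply, conj_trivial] at h1
    rw [Matrix.mul_apply, Matrix.one_apply]
    simp only [Matrix.of_apply, Matrix.transpose_apply]
    rw [h1]
    simp [eq_comm]
  · intro k
    have h1 : ((Matrix.of fun i k => q k i)ᵀ *ᵥ a) k = inner ℝ (q k) a' := by
      rw [PiLp.inner_apply]
      simp [Matrix.mulVec, dotProduct, a', mul_comm]
    have h2 : inner ℝ (q k) a' = ‖a'‖ / √m := by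
      have h3 : a' = ρ w := by
        rw [← hρ]; exact ((ℝ ∙ (a' - w))ᗮ.reflection_reflection a').symm
      have h4 : q k = ρ (EuclideanSpace.basisFun (Fin m) ℝ k) := by simp [q]
      rw [h4]
      conv_lhs => rw [h3]
      rw [LinearIsometryEquiv.inner_map_map, EuclideanSpace.basisFun_inner]
    rw [h1, h2]
    exact (div_pos ha' (Real.sqrt_pos.2 hm')).ne'

/-- The witness makes `N Nᵀ` a matrix with the distinct eigenvalues `1, …, m`, none of whose
eigenvectors is orthogonal to `a`; the Krylov matrix is then a product of invertible matrices, one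
of them a Vandermonde matrix. -/
lemma exists_krylovDet_ne_zero (hm : 0 < m) (hmn : m < n) {σ : Fin m → ℝ} (hσ : ∀ s, σ s ≠ 0)
    {a : Fin m → ℝ} (ha : a ≠ 0) {C : Matrix (Fin n) (Fin n) ℝ}
    (hC : ∀ B : Matrix (Fin m) (Fin n) ℝ, (∀ k, ∑ a, B k a = 0) → B * C = B) :
    ∃ Z, krylovDet σ C a Z ≠ 0 := by
  obtain ⟨B, hB, hB0⟩ := exists_orthonormal_sum_eq_zero hmn
  obtain ⟨Q, hQ, hQa⟩ := exists_orthogonal_matrix_ne_zero hm ha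
  have hQ' : Q * Qᵀ = 1 := mul_eq_one_comm.1 hQ
  set d : Fin m → ℝ := fun k => (k : ℝ) + 1 with hd
  set D : Matrix (Fin m) (Fin m) ℝ := Matrix.diagonal fun k => √(d k) with hD
  have hDD : D * Dᵀ = Matrix.diagonal d := by
    rw [hD, Matrix.diagonal_transpose, Matrix.diagonal_mul_diagonal]
    congr 1
    funext k
    exact Real.mul_self_sqrt (by positivity)
  refine ⟨Matrix.diagonal (fun s => (σ s)⁻¹) * (Q * D * B), ?_⟩
  have hN : Matrix.diagonal σ * (Matrix.diagonal (fun s => (σ s)⁻¹) * (Q * D * B)) * C =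
      Q * D * B := by
    rw [← Matrix.mul_assoc, Matrix.diagonal_mul_diagonal]
    have h1 : (fun s => σ s * (σ s)⁻¹) = fun _ => 1 := funext fun s => mul_inv_cancel₀ (hσ s)
    rw [h1, Matrix.diagonal_one, Matrix.one_mul, Matrix.mul_assoc, hC B hB0]
  have hΦ : (Q * D * B) * (Q * D * B)ᵀ = Q * Matrix.diagonal d * Qᵀ := by
    rw [Matrix.transpose_mul, Matrix.transpose_mul, ← hDD]
    calc Q * D * B * (Bᵀ * (Dᵀ * Qᵀ)) = Q * D * (B * Bᵀ) * (Dᵀ * Qᵀ) := by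
          simp only [Matrix.mul_assoc]
      _ = _ := by rw [hB, Matrix.mul_one]; simp only [Matrix.mul_assoc]
  have hpow : ∀ k : ℕ, (Q * Matrix.diagonal d * Qᵀ) ^ k =
      Q * Matrix.diagonal (fun i => d i ^ k) * Qᵀ := by
    intro k
    induction k with
    | zero => simp [hQ']
    | succ k ih =>
      rw [pow_succ, ih]
      calc Q * Matrix.diagonal (fun i => d i ^ k) * Qᵀ * (Q * Matrix.diagonal d * Qᵀ)
          = Q * Matrix.diagonal (fun i => d i ^ k) * (Qᵀ * Q) * Matrix.diagonal d * Qᵀ := by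
            simp only [Matrix.mul_assoc]
        _ = _ := by
            rw [hQ, Matrix.mul_one, Matrix.mul_assoc Q, Matrix.diagonal_mul_diagonal]
            simp only [pow_succ]
  have hK : (Matrix.of fun i j : Fin m => ((Q * Matrix.diagonal d * Qᵀ) ^ (j : ℕ) *ᵥ a) i) =
      Q * Matrix.diagonal (Qᵀ *ᵥ a) * Matrix.vandermonde d := by
    ext i j
    rw [Matrix.of_apply, hpow, ← Matrix.mulVec_mulVec, ← Matrix.mulVec_mulVec, Matrix.mul_assoc,
      Matrix.mul_apply]
    change ∑ k, Q i k * _ = _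
    refine Finset.sum_congr rfl fun k _ => ?_
    rw [Matrix.mulVec_diagonal, Matrix.diagonal_mul, Matrix.vandermonde_apply]
    ring
  have hdetQ : Q.det ≠ 0 := by
    intro h0
    have := congrArg Matrix.det hQ
    simp [h0] at this
  rw [krylovDet, hN, hΦ, hK]
  simp only [Matrix.det_mul, Matrix.det_transpose, Matrix.det_diagonal]
  have hdet : ∏ i, d i ≠ 0 := Finset.prod_ne_zero_iff.2 fun i _ => by positivity
  have hv : (Matrix.vandermonde d).det ≠ 0 := by
    rw [Matrix.det_vandermonde_ne_zero_iff]
    intro i j hij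
    simpa [hd, Fin.ext_iff] using hij
  have hqa : ∏ i, (Qᵀ *ᵥ a) i ≠ 0 := Finset.prod_ne_zero_iff.2 fun i _ => hQa i
  positivity

end Krylov

/-! ### Weighted laws of large numbers -/

section LLN

variable {Ω : Type*} [MeasurableSpace Ω] {P : Measure Ω}

lemma tendstoInMeasure_zero_of_sq [IsFiniteMeasure P] {T : ℕ → Ω → ℝ}
    (hT : ∀ᶠ p in atTop, Integrable (fun ω => T p ω ^ 2) P)
    (h : Tendsto (fun p => ∫ ω, T p ω ^ 2 ∂P) atTop (𝓝 0)) :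
    TendstoInMeasure P T atTop (fun _ => 0) := by
  rw [tendstoInMeasure_iff_measureReal_norm]
  intro ε hε
  have h1 := h.div_const (ε ^ 2)
  rw [zero_div] at h1
  refine tendsto_of_tendsto_of_tendsto_of_le_of_le' tendsto_const_nhds h1
    (Eventually.of_forall fun p => measureReal_nonneg) ?_
  filter_upwards [hT] with p hp
  rw [le_div_iff₀ (by positivity), mul_comm]
  refine le_trans ?_ (mul_meas_ge_le_integral_of_nonneg
    (Eventually.of_forall fun ω => sq_nonneg (T p ω)) hp (ε ^ 2))
  refine mul_le_mul_of_nonneg_left (measureReal_mono fun ω hω => ?_) (by positivity)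
  simp only [sub_zero, Set.mem_ofPred_eq, Real.norm_eq_abs] at hω ⊢
  rw [← sq_abs (T p ω)]
  gcongr

lemma integrable_sq_sum {s : Finset ℕ} {c : ℕ → ℝ} {W : ℕ → Ω → ℝ}
    (hW : ∀ j, MemLp (W j) 2 P) : Integrable (fun ω => (∑ j ∈ s, c j * W j ω) ^ 2) P := by
  have h1 : MemLp (fun ω => ∑ j ∈ s, c j * W j ω) 2 P :=
    memLp_finsetSum s fun j _ => (hW j).const_mul (c j)
  exact h1.integrable_sq

lemma integral_sq_sum {s : Finset ℕ} {c : ℕ → ℝ} {W : ℕ → Ω → ℝ}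
    (hW : ∀ j, MemLp (W j) 2 P) :
    ∫ ω, (∑ j ∈ s, c j * W j ω) ^ 2 ∂P =
      ∑ j ∈ s, ∑ k ∈ s, c j * c k * ∫ ω, W j ω * W k ω ∂P := by
  have h1 : ∀ ω, (∑ j ∈ s, c j * W j ω) ^ 2 =
      ∑ j ∈ s, ∑ k ∈ s, c j * c k * (W j ω * W k ω) := by
    intro ω
    rw [sq, Finset.sum_mul_sum]
    exact Finset.sum_congr rfl fun j _ => Finset.sum_congr rfl fun k _ => by ring
  have h2 : ∀ j k, Integrable (fun ω => W j ω * W k ω) P := fun j k =>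
    (hW j).integrable_mul (hW k)
  simp_rw [h1]
  rw [integral_finsetSum _ fun j _ => integrable_finsetSum _ fun k _ => (h2 j k).const_mul _]
  refine Finset.sum_congr rfl fun j _ => ?_
  rw [integral_finsetSum _ fun k _ => (h2 j k).const_mul _]
  exact Finset.sum_congr rfl fun k _ => integral_const_mul _ _

/-- Weighted sums of orthonormal random variables tend to zero in probability if the sums of the
squared weights do. -/
lemma tendstoInMeasure_of_orthonormal [IsFiniteMeasure P] {W : ℕ → Ω → ℝ}
    (hW : ∀ j, MemLp (W j) 2 P)
    (hWW : ∀ j k, ∫ ω, W j ω * W k ω ∂P = if j = k then 1 else 0) (s : ℕ → Finset ℕ)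
    (c : ℕ → ℕ → ℝ) (hc : Tendsto (fun p => ∑ j ∈ s p, c p j ^ 2) atTop (𝓝 0)) :
    TendstoInMeasure P (fun p ω => ∑ j ∈ s p, c p j * W j ω) atTop (fun _ => 0) := by
  refine tendstoInMeasure_zero_of_sq (Eventually.of_forall fun p => integrable_sq_sum hW) ?_
  refine hc.congr fun p => ?_
  rw [integral_sq_sum hW]
  refine Finset.sum_congr rfl fun j hj => ?_
  simp only [hWW, mul_ite, mul_one, mul_zero, Finset.sum_ite_eq, hj, if_true]
  ring

variable [IsProbabilityMeasure P]

lemma abs_covariance_le {f g : Ω → ℝ} (hf : MemLp f 2 P) (hg : MemLp g 2 P) {C : ℝ}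
    (hfC : Var[f; P] ≤ C) (hgC : Var[g; P] ≤ C) : |cov[f, g; P]| ≤ C := by
  have h1 := variance_nonneg (f + g) P
  have h2 := variance_nonneg (f - g) P
  rw [variance_add hf hg] at h1
  rw [variance_sub hf hg] at h2
  rw [abs_le]
  constructor <;> linarith

lemma covariance_eq_zero_of_variance_eq_zero {f g : Ω → ℝ} (hf : MemLp f 2 P)
    (h : Var[f; P] = 0) : cov[f, g; P] = 0 := by
  rw [covariance]
  refine integral_eq_zero_of_ae ?_
  filter_upwards [ae_eq_integral_of_variance_eq_zero hf h] with ω hω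
  simp [hω]

/-- Under `ρ`-mixing, square-integrable functions of single members of the sequence are nearly
uncorrelated if their indices are far apart. -/
lemma exists_abs_covariance_le {Y : ℕ → Ω → ℝ} (hY : IsRhoMixing P Y) {φ : ℝ → ℝ}
    (hφ : Measurable φ) (hL : ∀ j, MemLp (fun ω => φ (Y j ω)) 2 P) {C : ℝ}
    (hC : ∀ j, Var[fun ω => φ (Y j ω); P] ≤ C) {ε : ℝ} (hε : 0 < ε) :
    ∃ K : ℕ, ∀ j k : ℕ, j + K ≤ k →
      |cov[fun ω => φ (Y j ω), fun ω => φ (Y k ω); P]| ≤ ε * C := by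
  have h1 := hY.eventually (gt_mem_nhds (ENNReal.ofReal_pos.2 hε))
  obtain ⟨K, hK⟩ := eventually_atTop.1 h1
  refine ⟨K, fun j k hjk => ?_⟩
  obtain ⟨d, rfl⟩ := Nat.exists_eq_add_of_le (le_trans (Nat.le_add_right j K) hjk)
  have hd : K ≤ d := by omega
  have hmeas : ∀ (S : Set ℕ) (i : ℕ), i ∈ S →
      Measurable[⨆ j ∈ S, MeasurableSpace.comap (Y j) inferInstance] fun ω => φ (Y i ω) := by
    intro S i hi
    have h2 : MeasurableSpace.comap (Y i) inferInstance ≤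
        ⨆ j ∈ S, MeasurableSpace.comap (Y j) inferInstance := le_iSup₂_of_le i hi le_rfl
    exact (hφ.comp (comap_measurable (Y i))).mono h2 le_rfl
  have h3 : ENNReal.ofReal (|cov[fun ω => φ (Y j ω), fun ω => φ (Y (j + d) ω); P]| /
      (√Var[fun ω => φ (Y j ω); P] * √Var[fun ω => φ (Y (j + d) ω); P])) ≤
      rhoCoefficient P Y d := by
    refine le_iSup_of_le j ?_
    refine le_iSup_of_le (fun ω => φ (Y j ω)) (le_iSup_of_le (fun ω => φ (Y (j + d) ω)) ?_)
    exact le_iSup_of_le (hmeas (Set.Iic j) j (Set.mem_Iic.2 le_rfl))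
      (le_iSup_of_le (hmeas (Set.Ici (j + d)) (j + d) (Set.mem_Ici.2 le_rfl))
        (le_iSup_of_le (hL j) (le_iSup_of_le (hL (j + d)) le_rfl)))
  have h4 := (ENNReal.ofReal_lt_ofReal_iff hε).1 (h3.trans_lt (hK d hd))
  have hC0 : 0 ≤ C := (variance_nonneg _ _).trans (hC 0)
  rcases (Real.sqrt_nonneg (Var[fun ω => φ (Y j ω); P])).eq_or_lt with h5 | h5
  · have h6 : Var[fun ω => φ (Y j ω); P] = 0 :=
      (Real.sqrt_eq_zero (variance_nonneg _ _)).1 h5.symm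
    rw [covariance_eq_zero_of_variance_eq_zero (hL j) h6, abs_zero]
    positivity
  rcases (Real.sqrt_nonneg (Var[fun ω => φ (Y (j + d) ω); P])).eq_or_lt with h6 | h6
  · have h7 : Var[fun ω => φ (Y (j + d) ω); P] = 0 :=
      (Real.sqrt_eq_zero (variance_nonneg _ _)).1 h6.symm
    rw [covariance_comm, covariance_eq_zero_of_variance_eq_zero (hL (j + d)) h7, abs_zero]
    positivity
  rw [div_lt_iff₀ (mul_pos h5 h6)] at h4
  refine h4.le.trans (mul_le_mul_of_nonneg_left ?_ hε.le)
  calc √Var[fun ω => φ (Y j ω); P] * √Var[fun ω => φ (Y (j + d) ω); P] ≤ √C * √C := by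
        gcongr
        · exact hC j
        · exact hC (j + d)
    _ = C := Real.mul_self_sqrt hC0

/-- Few indices are close to a given one after the permutation. -/
lemma card_filter_near_le (s : Finset ℕ) (π : Equiv.Perm ℕ) (K j : ℕ) :
    (s.filter fun k => ¬ (π.symm j + K ≤ π.symm k ∨ π.symm k + K ≤ π.symm j)).card ≤ 2 * K := by
  calc _ ≤ (Finset.Ico (π.symm j - K) (π.symm j + K)).card := by
        refine Finset.card_le_card_of_injOn π.symm ?_ π.symm.injective.injOn
        intro k hk
        simp only [Finset.coe_filter, Set.mem_ofPred_eq, not_or, not_le] at hk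
        simp only [Finset.coe_Ico, Set.mem_Ico]
        omega
    _ ≤ 2 * K := by rw [Nat.card_Ico]; omega

/-- A law of large numbers for functions of a sequence which is `ρ`-mixing after a permutation:
only `O(p)` of the `p²` covariances are not small. -/
lemma tendstoInMeasure_of_rhoMixing {Z : ℕ → Ω → ℝ} {π : Equiv.Perm ℕ}
    (hZ : IsRhoMixing P fun j => Z (π j)) {φ : ℝ → ℝ} (hφ : Measurable φ)
    (hL : ∀ j, MemLp (fun ω => φ (Z j ω)) 2 P) (h0 : ∀ j, ∫ ω, φ (Z j ω) ∂P = 0) {C : ℝ}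
    (hC : ∀ j, Var[fun ω => φ (Z j ω); P] ≤ C) (s : ℕ → Finset ℕ) (hs : ∀ p, (s p).card ≤ p)
    (c : ℕ → ℕ → ℝ) {B : ℝ} (hc : ∀ᶠ p : ℕ in atTop, ∀ j ∈ s p, |c p j| ≤ B / p) :
    TendstoInMeasure P (fun p ω => ∑ j ∈ s p, c p j * φ (Z j ω)) atTop (fun _ => 0) := by
  refine tendstoInMeasure_zero_of_sq
    (Eventually.of_forall fun p => integrable_sq_sum (W := fun j ω => φ (Z j ω)) hL) ?_
  have hC0 : 0 ≤ C := (variance_nonneg _ _).trans (hC 0)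
  rw [Metric.tendsto_nhds]
  intro ε hε
  -- the covariances are split according to the distance of the permuted indices
  obtain ⟨δ, hδ, hδε⟩ : ∃ δ : ℝ, 0 < δ ∧ B ^ 2 * (δ * C) < ε / 2 := by
    refine ⟨ε / (4 * (B ^ 2 * C + 1)), by positivity, ?_⟩
    rw [div_mul_eq_mul_div, ← mul_div_assoc, div_lt_iff₀ (by positivity)]
    have : 0 ≤ B ^ 2 * C := by positivity
    nlinarith
  obtain ⟨K, hK⟩ := exists_abs_covariance_le hZ hφ (fun j => hL (π j)) (fun j => hC (π j)) hδ
  have hlim : Tendsto (fun p : ℕ => B ^ 2 * (2 * K * C) / (p : ℝ)) atTop (𝓝 0) :=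
    tendsto_const_div_atTop_nhds_zero_nat _
  filter_upwards [hc, hlim.eventually (gt_mem_nhds (half_pos hε)), eventually_gt_atTop 0]
    with p hp hpε hp0
  rw [integral_sq_sum (W := fun j ω => φ (Z j ω)) hL, Real.dist_eq, sub_zero]
  have hp0' : (0 : ℝ) < p := Nat.cast_pos.2 hp0
  have hcov : ∀ j k, ∫ ω, φ (Z j ω) * φ (Z k ω) ∂P =
      cov[fun ω => φ (Z j ω), fun ω => φ (Z k ω); P] := by
    intro j k
    rw [covariance_eq_sub (hL j) (hL k), h0 j, zero_mul, sub_zero]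
    rfl
  have hfar : ∀ j k, (π.symm j + K ≤ π.symm k ∨ π.symm k + K ≤ π.symm j) →
      |∫ ω, φ (Z j ω) * φ (Z k ω) ∂P| ≤ δ * C := by
    intro j k hjk
    rw [hcov]
    rcases hjk with hjk | hjk
    · simpa using hK _ _ hjk
    · rw [covariance_comm]
      simpa using hK _ _ hjk
  have hnear : ∀ j k, |∫ ω, φ (Z j ω) * φ (Z k ω) ∂P| ≤ C := by
    intro j k
    rw [hcov]
    exact abs_covariance_le (hL j) (hL k) (hC j) (hC k)
  have hrow : ∀ j, ∑ k ∈ s p, |∫ ω, φ (Z j ω) * φ (Z k ω) ∂P| ≤ 2 * K * C + p * (δ * C) := by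
    intro j
    rw [← Finset.sum_filter_not_add_sum_filter (s p)
      (fun k => π.symm j + K ≤ π.symm k ∨ π.symm k + K ≤ π.symm j)]
    refine add_le_add ?_ ?_
    · refine (Finset.sum_le_card_nsmul _ _ C fun k _ => hnear j k).trans ?_
      rw [nsmul_eq_mul]
      refine mul_le_mul_of_nonneg_right ?_ hC0
      exact_mod_cast card_filter_near_le (s p) π K j
    · refine (Finset.sum_le_card_nsmul _ _ (δ * C) fun k hk =>
        hfar j k (Finset.mem_filter.1 hk).2).trans ?_
      rw [nsmul_eq_mul]
      refine mul_le_mul_of_nonneg_right ?_ (by positivity)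
      exact_mod_cast (Finset.card_filter_le _ _).trans (hs p)
  calc _ ≤ ∑ j ∈ s p, ∑ k ∈ s p, (B / p) * (B / p) * |∫ ω, φ (Z j ω) * φ (Z k ω) ∂P| := by
        refine (Finset.abs_sum_le_sum_abs _ _).trans (Finset.sum_le_sum fun j hj => ?_)
        refine (Finset.abs_sum_le_sum_abs _ _).trans (Finset.sum_le_sum fun k hk => ?_)
        rw [abs_mul, abs_mul]
        have h1 := hp j hj
        have h2 := hp k hk
        have h3 : 0 ≤ B / p := (abs_nonneg _).trans h1
        gcongr
    _ ≤ ∑ j ∈ s p, (B / p) * (B / p) * (2 * K * C + p * (δ * C)) := by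
        refine Finset.sum_le_sum fun j _ => ?_
        rw [← Finset.mul_sum]
        exact mul_le_mul_of_nonneg_left (hrow j) (mul_self_nonneg _)
    _ ≤ p * ((B / p) * (B / p) * (2 * K * C + p * (δ * C))) := by
        rw [Finset.sum_const, nsmul_eq_mul]
        refine mul_le_mul_of_nonneg_right (by exact_mod_cast hs p) ?_
        exact mul_nonneg (mul_self_nonneg _) (by positivity)
    _ = B ^ 2 * (2 * K * C) / p + B ^ 2 * (δ * C) := by
        field_simp
    _ < ε := by linarith

end LLN

/-! ### Moments of the standardized scores -/

section Scores

variable {Ω : Type*} [MeasurableSpace Ω] {P : Measure Ω}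

/-- The second-order structure of the scores: within an observation they are orthonormal, and the
products of the scores of two different observations are orthonormal as well. -/
structure IsScoreArray (P : Measure Ω) {n : ℕ} (Z : ℕ → Fin n → Ω → ℝ) : Prop where
  measurable : ∀ j i, Measurable (Z j i)
  memLp : ∀ j i, MemLp (Z j i) 2 P
  integral_mul : ∀ i j k, ∫ ω, Z j i ω * Z k i ω ∂P = if j = k then 1 else 0
  integral_cross : ∀ i i', i ≠ i' → ∀ j k,
    ∫ ω, (Z j i ω * Z j i' ω) * (Z k i ω * Z k i' ω) ∂P = if j = k then 1 else 0

lemma continuous_pcScore {p : ℕ} (mu : Vec p) (a : ℝ) (w : Vec p) :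
    Continuous (pcScore mu a w) := by
  unfold pcScore
  fun_prop

lemma IsSample.integral_inner_mul_inner [IsProbabilityMeasure P] {n p : ℕ}
    {X : Fin n → Ω → Vec p} {mu : Vec p}
    {Sig : Matrix (Fin p) (Fin p) ℝ} (hX : IsSample P X mu Sig) (i : Fin n) (w w' : Vec p) :
    ∫ ω, inner ℝ w (X i ω - mu) * inner ℝ w' (X i ω - mu) ∂P =
      inner ℝ w (Matrix.toEuclideanLin Sig w') := by
  have hcoord : ∀ a, MemLp (fun ω => X i ω a) 2 P := fun a =>
    (EuclideanSpace.proj (𝕜 := ℝ) a).comp_memLp' (hX.memLp i)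
  have hmean : ∀ a, ∫ ω, X i ω a ∂P = mu a := by
    intro a
    rw [← hX.mean i]
    exact (EuclideanSpace.proj (𝕜 := ℝ) a).integral_comp_comm
      ((hX.memLp i).integrable (by norm_num))
  have hsub : ∀ a, MemLp (fun ω => X i ω a - mu a) 2 P := fun a =>
    (hcoord a).sub (memLp_const _)
  have hcov : ∀ a b, ∫ ω, (X i ω a - mu a) * (X i ω b - mu b) ∂P = Sig a b := by
    intro a b
    rw [← hX.cov i a b, covariance, hmean, hmean]
  have hinner : ∀ (w : Vec p) ω, inner ℝ w (X i ω - mu) = ∑ a, w a * (X i ω a - mu a) := by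
    intro w ω
    simp [PiLp.inner_apply, mul_comm]
  have h1 : ∀ ω, inner ℝ w (X i ω - mu) * inner ℝ w' (X i ω - mu) =
      ∑ a, ∑ b, w a * w' b * ((X i ω a - mu a) * (X i ω b - mu b)) := by
    intro ω
    rw [hinner, hinner, Finset.sum_mul_sum]
    exact Finset.sum_congr rfl fun a _ => Finset.sum_congr rfl fun b _ => by ring
  have h2 : ∀ a b, Integrable (fun ω => (X i ω a - mu a) * (X i ω b - mu b)) P := fun a b =>
    (hsub a).integrable_mul (hsub b)
  simp_rw [h1]
  rw [integral_finsetSum _ fun a _ => integrable_finsetSum _ fun b _ => (h2 a b).const_mul _,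
    PiLp.inner_apply]
  refine Finset.sum_congr rfl fun a _ => ?_
  rw [integral_finsetSum _ fun b _ => (h2 a b).const_mul _]
  simp_rw [integral_const_mul, hcov]
  simp only [RCLike.inner_apply, conj_trivial]
  change _ = (∑ b, Sig a b * w' b) * w a
  rw [Finset.sum_mul]
  exact Finset.sum_congr rfl fun b _ => by ring

lemma IsSample.integral_pcScore_mul [IsProbabilityMeasure P] {n p : ℕ} {X : Fin n → Ω → Vec p}
    {mu : Vec p} {Sig : Matrix (Fin p) (Fin p) ℝ} (hX : IsSample P X mu Sig) {lam : ℕ → ℝ}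
    {u : ℕ → Vec p} (hu : IsEigendecomposition Sig lam u) (hlam : ∀ j < p, 0 < lam j) (i : Fin n)
    {j k : ℕ} (hj : j < p) (hk : k < p) :
    ∫ ω, pcScore mu (lam j) (u j) (X i ω) * pcScore mu (lam k) (u k) (X i ω) ∂P =
      if j = k then 1 else 0 := by
  have h1 : ∀ ω, pcScore mu (lam j) (u j) (X i ω) * pcScore mu (lam k) (u k) (X i ω) =
      ((√(lam j))⁻¹ * (√(lam k))⁻¹) *
        (inner ℝ (u j) (X i ω - mu) * inner ℝ (u k) (X i ω - mu)) := by
    intro ω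
    simp only [pcScore]; ring
  simp_rw [h1]
  rw [integral_const_mul, hX.integral_inner_mul_inner, hu.eigenvector k hk, real_inner_smul_right]
  have h2 := orthonormal_iff_ite.1 hu.orthonormal ⟨j, hj⟩ ⟨k, hk⟩
  simp only [Fin.mk.injEq] at h2
  rw [h2]
  by_cases hjk : j = k
  · subst hjk
    rw [if_pos rfl, ← mul_inv, Real.mul_self_sqrt (hlam j hj).le, mul_one,
      inv_mul_cancel₀ (hlam j hj).ne']
  · rw [if_neg hjk]; simp

lemma IsSample.memLp_pcScore [IsProbabilityMeasure P] {n p : ℕ} {X : Fin n → Ω → Vec p}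
    {mu : Vec p} {Sig : Matrix (Fin p) (Fin p) ℝ} (hX : IsSample P X mu Sig) (a : ℝ) (w : Vec p)
    (i : Fin n) : MemLp (fun ω => pcScore mu a w (X i ω)) 2 P :=
  (((innerSL ℝ w).comp_memLp' ((hX.memLp i).sub (memLp_const mu)))).const_mul _

/-- The scores do not depend on the dimension, so that each identity is read off in a dimension
large enough for the indices involved. -/
lemma isScoreArray [IsProbabilityMeasure P] {n : ℕ} {X : (p : ℕ) → Fin n → Ω → Vec p}
    {mu : (p : ℕ) → Vec p} {Sig : (p : ℕ) → Matrix (Fin p) (Fin p) ℝ}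
    (hX : ∀ p, n < p → IsSample P (X p) (mu p) (Sig p)) {lam : ℕ → ℕ → ℝ}
    {u : (p : ℕ) → ℕ → Vec p} (hu : ∀ p, n < p → IsEigendecomposition (Sig p) (lam p) (u p))
    (hlam : ∀ p, n < p → ∀ j < p, 0 < lam p j) {Z : ℕ → Fin n → Ω → ℝ}
    (hZ : ∀ p, n < p → ∀ j < p, ∀ i ω, pcScore (mu p) (lam p j) (u p j) (X p i ω) = Z j i ω) :
    IsScoreArray P Z := by
  have hex : ∀ j k : ℕ, ∃ p, n < p ∧ j < p ∧ k < p := fun j k =>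
    ⟨max n (max j k) + 1, by omega, by omega, by omega⟩
  have heq : ∀ p, n < p → ∀ j < p, ∀ i,
      Z j i = fun ω => pcScore (mu p) (lam p j) (u p j) (X p i ω) := fun p hp j hj i =>
    funext fun ω => (hZ p hp j hj i ω).symm
  refine ⟨fun j i => ?_, fun j i => ?_, fun i j k => ?_, fun i i' hii' j k => ?_⟩
  · obtain ⟨p, hp, hj, -⟩ := hex j j
    rw [heq p hp j hj i]
    exact (continuous_pcScore _ _ _).measurable.comp ((hX p hp).measurable i)
  · obtain ⟨p, hp, hj, -⟩ := hex j j
    rw [heq p hp j hj i]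
    exact (hX p hp).memLp_pcScore _ _ i
  · obtain ⟨p, hp, hj, hk⟩ := hex j k
    rw [heq p hp j hj i, heq p hp k hk i]
    exact (hX p hp).integral_pcScore_mul (hu p hp) (hlam p hp) i hj hk
  · obtain ⟨p, hp, hj, hk⟩ := hex j k
    let g : Vec p → ℝ := fun x =>
      pcScore (mu p) (lam p j) (u p j) x * pcScore (mu p) (lam p k) (u p k) x
    have hg : Measurable g :=
      ((continuous_pcScore _ _ _).mul (continuous_pcScore _ _ _)).measurable
    have h1 : IndepFun (g ∘ X p i) (g ∘ X p i') P :=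
      ((hX p hp).indep.indepFun hii').comp hg hg
    have h2 := h1.integral_fun_mul_eq_mul_integral
      (hg.comp ((hX p hp).measurable i)).aestronglyMeasurable
      (hg.comp ((hX p hp).measurable i')).aestronglyMeasurable
    have h3 : ∀ i, ∫ ω, (g ∘ X p i) ω ∂P = if j = k then 1 else 0 := fun i =>
      (hX p hp).integral_pcScore_mul (hu p hp) (hlam p hp) i hj hk
    rw [h3, h3] at h2
    rw [heq p hp j hj i, heq p hp k hk i, heq p hp j hj i', heq p hp k hk i']
    calc _ = ∫ ω, (g ∘ X p i) ω * (g ∘ X p i') ω ∂P := by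
          refine integral_congr_ae (Eventually.of_forall fun ω => ?_)
          simp only [g, Function.comp]; ring
      _ = _ := by rw [h2]; split_ifs <;> simp

variable {n : ℕ} {Z : ℕ → Fin n → Ω → ℝ}

lemma IsScoreArray.memLp_mul (h : IsScoreArray P Z)
    (h4 : ∀ j i, Integrable (fun ω => Z j i ω ^ 4) P) (i i' : Fin n) (j : ℕ) :
    MemLp (fun ω => Z j i ω * Z j i' ω) 2 P := by
  have hm : AEStronglyMeasurable (fun ω => Z j i ω * Z j i' ω) P :=
    ((h.measurable j i).mul (h.measurable j i')).aestronglyMeasurable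
  rw [memLp_two_iff_integrable_sq hm]
  refine ((h4 j i).add (h4 j i')).mono' (hm.pow 2) (Eventually.of_forall fun ω => ?_)
  simp only [Pi.add_apply, Real.norm_eq_abs]
  rw [abs_of_nonneg (sq_nonneg _)]
  nlinarith [sq_nonneg (Z j i ω ^ 2 - Z j i' ω ^ 2), sq_nonneg (Z j i ω ^ 2 + Z j i' ω ^ 2)]

/-- The noise part of the Gram matrix of the observations is close to its expectation: by
`ρ`-mixing on the diagonal, by independence off the diagonal. -/
lemma IsScoreArray.tendstoInMeasure_mul [IsProbabilityMeasure P] (h : IsScoreArray P Z) {C : ℝ}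
    (h4 : ∀ j i, Integrable (fun ω => Z j i ω ^ 4) P ∧ ∫ ω, Z j i ω ^ 4 ∂P ≤ C)
    (hmix : ∀ i, ∃ π : Equiv.Perm ℕ, IsRhoMixing P (fun j => Z (π j) i))
    (s : ℕ → Finset ℕ) (hs : ∀ p, (s p).card ≤ p) (c : ℕ → ℕ → ℝ) {B : ℝ}
    (hc : ∀ᶠ p : ℕ in atTop, ∀ j ∈ s p, |c p j| ≤ B / p) (i i' : Fin n) :
    TendstoInMeasure P
      (fun p ω => ∑ j ∈ s p, c p j * (Z j i ω * Z j i' ω - if i = i' then 1 else 0)) atTop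
      (fun _ => 0) := by
  by_cases hii' : i = i'
  · subst hii'
    obtain ⟨π, hπ⟩ := hmix i
    have hL : ∀ j, MemLp (fun ω => Z j i ω * Z j i ω - 1) 2 P := fun j =>
      (h.memLp_mul (fun j i => (h4 j i).1) i i j).sub (memLp_const 1)
    have hvar : ∀ j, Var[fun ω => Z j i ω * Z j i ω - 1; P] ≤ C := by
      intro j
      rw [variance_sub_const (h.memLp_mul (fun j i => (h4 j i).1) i i j).aestronglyMeasurable]
      refine (variance_le_expectation_sq
        (h.memLp_mul (fun j i => (h4 j i).1) i i j).aestronglyMeasurable).trans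
        (le_trans (le_of_eq ?_) (h4 j i).2)
      refine integral_congr_ae (Eventually.of_forall fun ω => ?_)
      simp only [Pi.pow_apply]; ring
    have h0 : ∀ j, ∫ ω, (Z j i ω * Z j i ω - 1) ∂P = 0 := by
      intro j
      have hint : Integrable (fun ω => Z j i ω * Z j i ω) P :=
        (h.memLp j i).integrable_mul (h.memLp j i)
      rw [integral_sub hint (integrable_const 1), h.integral_mul]
      simp
    simp only [if_true]
    exact tendstoInMeasure_of_rhoMixing (Z := fun j => Z j i) (φ := fun x => x * x - 1) hπ
      (by fun_prop) hL h0 hvar s hs c hc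
  · simp only [if_neg hii', sub_zero]
    refine tendstoInMeasure_of_orthonormal (W := fun j ω => Z j i ω * Z j i' ω)
      (h.memLp_mul (fun j i => (h4 j i).1) i i') (h.integral_cross i i' hii') s c ?_
    have hlim : Tendsto (fun p : ℕ => B ^ 2 / (p : ℝ)) atTop (𝓝 0) :=
      tendsto_const_div_atTop_nhds_zero_nat _
    refine tendsto_of_tendsto_of_tendsto_of_le_of_le' tendsto_const_nhds hlim
      (Eventually.of_forall fun p => Finset.sum_nonneg fun j _ => sq_nonneg _) ?_
    filter_upwards [hc, eventually_gt_atTop 0] with p hp hp0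
    have hp0' : (0 : ℝ) < p := Nat.cast_pos.2 hp0
    calc ∑ j ∈ s p, c p j ^ 2 ≤ (s p).card • (B / p) ^ 2 := by
          refine Finset.sum_le_card_nsmul _ _ _ fun j hj => ?_
          rw [← sq_abs]
          have := hp j hj
          gcongr
      _ ≤ p * (B / p) ^ 2 := by
          rw [nsmul_eq_mul]
          exact mul_le_mul_of_nonneg_right (by exact_mod_cast hs p) (sq_nonneg _)
      _ = B ^ 2 / p := by field_simp

end Scores

/-! ### From convergence in probability of the data to events of vanishing probability -/

section Transfer

variable {Ω : Type*} [MeasurableSpace Ω] {P : Measure Ω}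

lemma tendsto_measure_dist_ge {κ : Type*} [Fintype κ] {Y : ℕ → Ω → κ → ℝ} {Yinf : Ω → κ → ℝ}
    (hY : ∀ k, TendstoInMeasure P (fun p ω => Y p ω k) atTop (fun ω => Yinf ω k)) {δ : ℝ}
    (hδ : 0 < δ) : Tendsto (fun p => P {ω | δ ≤ dist (Y p ω) (Yinf ω)}) atTop (𝓝 0) := by
  have h1 : Tendsto (fun p => ∑ k, P {ω | δ ≤ dist (Y p ω k) (Yinf ω k)}) atTop (𝓝 0) := by
    have h2 : (0 : ℝ≥0∞) = ∑ _k : κ, 0 := by simp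
    rw [h2]
    exact tendsto_finsetSum _ fun k _ => tendstoInMeasure_iff_dist.1 (hY k) δ hδ
  refine tendsto_of_tendsto_of_tendsto_of_le_of_le tendsto_const_nhds h1 (fun p => zero_le)
    fun p => ?_
  refine (measure_mono fun ω hω => ?_).trans
    (measure_iUnion_fintype_le P fun k => {ω | δ ≤ dist (Y p ω k) (Yinf ω k)})
  by_contra hne
  simp only [Set.mem_iUnion, Set.mem_ofPred_eq, not_exists, not_le] at hne hω
  exact (not_lt.2 hω) ((dist_pi_lt_iff hδ).2 hne)

/-- If the data `Y p` converge in probability to `Yinf`, and almost every value of the limit has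
the property that configurations in large dimension with data close to it are not bad, then the
(outer) probability of the bad events tends to zero. The bad events need not be measurable; they
are enclosed in events defined by closed sets of data. -/
lemma tendsto_measure_zero_of_ultrafilter [IsFiniteMeasure P] {κ : Type*} [Fintype κ]
    {Y : ℕ → Ω → κ → ℝ} {Yinf : Ω → κ → ℝ} (hm : Measurable Yinf)
    (hY : ∀ k, TendstoInMeasure P (fun p ω => Y p ω k) atTop (fun ω => Yinf ω k))
    (bad : ℕ → Set Ω)
    (h : ∀ᵐ ω₀ ∂P, ∀ l : Ultrafilter (ℕ × Ω), Tendsto Prod.fst (l : Filter (ℕ × Ω)) atTop →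
      Tendsto (fun q => Y q.1 q.2) (l : Filter (ℕ × Ω)) (𝓝 (Yinf ω₀)) →
      ∀ᶠ q in (l : Filter (ℕ × Ω)), q.2 ∉ bad q.1) :
    Tendsto (fun p => P (bad p)) atTop (𝓝 0) := by
  -- the values of the limit near which no configuration in dimension at least `N` is bad
  set H : ℕ → Set (κ → ℝ) := fun N =>
    {y | ∀ p ≥ N, ∀ ω, dist (Y p ω) y < 1 / ((N : ℝ) + 1) → ω ∉ bad p} with hH
  have hHc : ∀ N, IsClosed (H N) := by
    intro N
    have : H N = ⋂ p ≥ N, ⋂ ω ∈ bad p, {y | 1 / ((N : ℝ) + 1) ≤ dist (Y p ω) y} := by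
      ext y
      simp only [hH, Set.mem_iInter, Set.mem_ofPred_eq]
      exact forall₂_congr fun p _ => forall_congr' fun ω =>
        ⟨fun h1 h2 => not_lt.1 fun h3 => h1 h3 h2, fun h1 h2 h3 => (h1 h3).not_gt h2⟩
    rw [this]
    exact isClosed_iInter fun p => isClosed_iInter fun _ => isClosed_iInter fun ω =>
      isClosed_iInter fun _ => isClosed_le continuous_const (by fun_prop)
  have hHmono : Monotone H := by
    intro N N' hNN' y hy p hp ω hω
    refine hy p (le_trans hNN' hp) ω (hω.trans_le ?_)
    have : (N : ℝ) ≤ N' := Nat.cast_le.2 hNN'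
    exact one_div_le_one_div_of_le (by positivity) (by linarith)
  have hex : ∀ᵐ ω₀ ∂P, ∃ N, Yinf ω₀ ∈ H N := by
    filter_upwards [h] with ω₀ hω₀
    by_contra! hne
    have h1 : ∀ N, ∃ q : ℕ × Ω, N ≤ q.1 ∧ dist (Y q.1 q.2) (Yinf ω₀) < 1 / ((N : ℝ) + 1) ∧
        q.2 ∈ bad q.1 := by
      intro N
      have h2 := hne N
      simp only [hH, Set.mem_ofPred_eq] at h2
      push Not at h2
      obtain ⟨p, hp, ω, hω, hb⟩ := h2
      exact ⟨(p, ω), hp, hω, hb⟩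
    choose q hq1 hq2 hq3 using h1
    have h2 := hω₀ ((hyperfilter ℕ).map q) ?_ ?_
    · rw [Ultrafilter.coe_map, eventually_map] at h2
      obtain ⟨N, hN⟩ := h2.exists
      exact hN (hq3 N)
    · rw [Ultrafilter.coe_map, tendsto_map'_iff]
      exact (tendsto_atTop_mono hq1 tendsto_id).mono_left Nat.hyperfilter_le_atTop
    · rw [Ultrafilter.coe_map, tendsto_map'_iff]
      refine Tendsto.mono_left ?_ Nat.hyperfilter_le_atTop
      rw [tendsto_iff_dist_tendsto_zero]
      exact squeeze_zero (fun _ => dist_nonneg) (fun N => (hq2 N).le)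
        tendsto_one_div_add_atTop_nhds_zero_nat
  have hlim : Tendsto (fun N => P (Yinf ⁻¹' (H N))ᶜ) atTop (𝓝 0) := by
    have h1 : P (⋂ N, (Yinf ⁻¹' (H N))ᶜ) = 0 := by
      rw [measure_eq_zero_iff_ae_notMem]
      filter_upwards [hex] with ω hω
      simpa using hω
    rw [← h1]
    refine tendsto_measure_iInter_atTop
      (fun N => ((hHc N).measurableSet.preimage hm).compl.nullMeasurableSet) ?_
      ⟨0, measure_ne_top _ _⟩
    exact fun N N' hNN' => Set.compl_subset_compl.2 (Set.preimage_mono (hHmono hNN'))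
  rw [ENNReal.tendsto_nhds_zero]
  intro ε hε
  have hε2 : (0 : ℝ≥0∞) < ε / 2 := ENNReal.half_pos hε.ne'
  obtain ⟨N, hN⟩ := ((ENNReal.tendsto_nhds_zero.1 hlim) (ε / 2) hε2).exists
  have hδ : (0 : ℝ) < 1 / ((N : ℝ) + 1) := by positivity
  filter_upwards [(ENNReal.tendsto_nhds_zero.1 (tendsto_measure_dist_ge hY hδ)) (ε / 2) hε2,
    eventually_ge_atTop N] with p hp hpN
  calc P (bad p) ≤ P ((Yinf ⁻¹' (H N))ᶜ ∪ {ω | 1 / ((N : ℝ) + 1) ≤ dist (Y p ω) (Yinf ω)}) := by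
        refine measure_mono fun ω hω => ?_
        by_cases h1 : Yinf ω ∈ H N
        · refine Or.inr ?_
          by_contra h2
          exact h1 p hpN ω (not_le.1 h2) hω
        · exact Or.inl h1
    _ ≤ ε / 2 + ε / 2 := (measure_union_le _ _).trans (add_le_add hN hp)
    _ = ε := ENNReal.add_halves ε

end Transfer

/-! ### Rescaled observations -/

section Rescaled

variable {n p : ℕ}

/-- The centering matrix `1 - n⁻¹ 1 1ᵀ`. -/
noncomputable def centering (n : ℕ) : Matrix (Fin n) (Fin n) ℝ :=
  Matrix.of fun a b => (if a = b then 1 else 0) - (n : ℝ)⁻¹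

lemma centering_symm (a b : Fin n) : centering n a b = centering n b a := by
  simp [centering, eq_comm]

lemma sum_centering (hn : 0 < n) (a : Fin n) : ∑ b, centering n a b = 0 := by
  have : (n : ℝ) ≠ 0 := Nat.cast_ne_zero.2 hn.ne'
  simp [centering, this]

lemma sum_centering_mul_centering (hn : 0 < n) (a a' : Fin n) :
    ∑ b, centering n a b * centering n a' b = (if a = a' then 1 else 0) - (n : ℝ)⁻¹ := by
  have h1 : ∀ b, centering n a b * centering n a' b =
      (if a' = b then centering n a b else 0) - (n : ℝ)⁻¹ * centering n a b := by
    intro b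
    simp only [centering, Matrix.of_apply]
    by_cases h : a' = b <;> simp [h] <;> ring
  rw [Finset.sum_congr rfl fun b _ => h1 b, Finset.sum_sub_distrib, ← Finset.mul_sum,
    sum_centering hn]
  simp [centering]

lemma mul_centering {m : ℕ} (B : Matrix (Fin m) (Fin n) ℝ) (hB : ∀ k, ∑ a, B k a = 0) :
    B * centering n = B := by
  ext k a
  rw [Matrix.mul_apply]
  simp only [centering, Matrix.of_apply, mul_sub, Finset.sum_sub_distrib, ← Finset.sum_mul, hB]
  simp

/-- An observation, recentered at the mean and divided by `√p`. -/
noncomputable def rescaled (mu x : Vec p) : Vec p := (√(p : ℝ))⁻¹ • (x - mu)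

/-- The rescaled observations, centered at their average. -/
noncomputable def centered (mu : Vec p) (x : Fin n → Vec p) (a : Fin n) : Vec p :=
  ∑ b, centering n a b • rescaled mu (x b)

lemma centered_eq (hn : 0 < n) (mu : Vec p) (x : Fin n → Vec p) (a : Fin n) :
    centered mu x a = (√(p : ℝ))⁻¹ • (x a - (n : ℝ)⁻¹ • ∑ b, x b) := by
  have h1 : centered mu x a = (√(p : ℝ))⁻¹ • ∑ b, centering n a b • x b := by
    simp only [centered, rescaled, smul_comm _ (√(p : ℝ))⁻¹, smul_sub, Finset.sum_sub_distrib,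
      ← Finset.smul_sum, ← Finset.sum_smul]
    rw [sum_centering hn, zero_smul, smul_zero, sub_zero]
  rw [h1]
  congr 1
  simp only [centering, Matrix.of_apply, sub_smul, ite_smul, one_smul, zero_smul,
    Finset.sum_sub_distrib, ← Finset.smul_sum]
  simp

lemma sum_centered (hn : 0 < n) (mu : Vec p) (x : Fin n → Vec p) : ∑ a, centered mu x a = 0 := by
  simp only [centered]
  rw [Finset.sum_comm]
  simp_rw [← Finset.sum_smul, centering_symm, sum_centering hn]
  simp

lemma toEuclideanLin_vecMulVec (w w' x : Vec p) :
    Matrix.toEuclideanLin (Matrix.vecMulVec ⇑w ⇑w') x = inner ℝ w' x • w := by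
  ext b
  change ∑ c, (w b * w' c) * x c = inner ℝ w' x * w b
  simp only [PiLp.inner_apply, RCLike.inner_apply, conj_trivial, Finset.sum_mul]
  exact Finset.sum_congr rfl fun c _ => by ring

/-- The eigenvalues are multiplied by `n / p`, since the sample covariance matrix is divided by `n`
and the observations by `√p`. -/
lemma dualSample_centered (hn : 0 < n) (hp : n < p) (mu : Vec p) {x : Fin n → Vec p} {l : ℕ → ℝ}
    {w : ℕ → Vec p} (h : IsEigendecomposition (sampleCov x) l w) :
    DualSample (centered mu x) w (fun j => (n / p : ℝ) * l j) := by
  have hp0 : (0 : ℝ) < p := Nat.cast_pos.2 (by omega)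
  have hn0 : (n : ℝ) ≠ 0 := Nat.cast_ne_zero.2 hn.ne'
  refine ⟨hp, h.orthonormal, fun j hj => ?_, fun j k hjk hk => ?_, sum_centered hn mu x⟩
  · have h1 := h.eigenvector j hj
    rw [sampleCov, map_smul, map_sum] at h1
    simp only [LinearMap.smul_apply, LinearMap.sum_apply, toEuclideanLin_vecMulVec] at h1
    simp only [centered_eq hn, real_inner_smul_left, smul_smul]
    have h2 : ∀ a, ((√(p : ℝ))⁻¹ * inner ℝ (x a - (n : ℝ)⁻¹ • ∑ b, x b) (w j) *
        (√(p : ℝ))⁻¹) = (p : ℝ)⁻¹ * inner ℝ (x a - (n : ℝ)⁻¹ • ∑ b, x b) (w j) := by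
      intro a
      have : (√(p : ℝ))⁻¹ * (√(p : ℝ))⁻¹ = (p : ℝ)⁻¹ := by
        rw [← mul_inv, Real.mul_self_sqrt hp0.le]
      linear_combination inner ℝ (x a - (n : ℝ)⁻¹ • ∑ b, x b) (w j) * this
    simp_rw [h2, mul_smul, ← Finset.smul_sum]
    have h3 : ∑ a, (inner ℝ (x a - (n : ℝ)⁻¹ • ∑ b, x b) (w j) : ℝ) •
        (x a - (n : ℝ)⁻¹ • ∑ b, x b) = (n : ℝ) • l j • w j := by
      rw [← h1, smul_smul, mul_inv_cancel₀ hn0, one_smul]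
    rw [h3, smul_smul, div_eq_inv_mul, mul_smul]
  · exact mul_le_mul_of_nonneg_left (h.ordered j k hjk hk) (by positivity)

variable {Sig : Matrix (Fin p) (Fin p) ℝ} {lam : ℕ → ℝ} {u : ℕ → Vec p}

lemma inner_rescaled (hlam : ∀ j < p, 0 < lam j) {j : ℕ} (hj : j < p) (mu x : Vec p) :
    inner ℝ (u j) (rescaled mu x) = √(lam j / p) * pcScore mu (lam j) (u j) x := by
  have h1 : √(lam j) ≠ 0 := (Real.sqrt_pos.2 (hlam j hj)).ne'
  rw [rescaled, pcScore, real_inner_smul_right, Real.sqrt_div (hlam j hj).le]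
  field_simp

lemma inner_eq_sum_range (hu : Orthonormal ℝ fun i : Fin p => u i) (w w' : Vec p) :
    inner ℝ w w' = ∑ j ∈ Finset.range p, inner ℝ w (u j) * inner ℝ (u j) w' := by
  let E : OrthonormalBasis (Fin p) ℝ (Vec p) := OrthonormalBasis.mk hu (by
    rw [hu.linearIndependent.span_eq_top_of_card_eq_finrank' (by simp)])
  have hE : ∀ j, E j = u j := fun j => by simp [E]
  rw [← E.sum_inner_mul_inner]
  simp only [hE]
  exact Fin.sum_univ_eq_sum_range (fun j : ℕ => inner ℝ w (u j) * inner ℝ (u j) w') p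

lemma inner_rescaled_eq_sum (hu : Orthonormal ℝ fun i : Fin p => u i)
    (hlam : ∀ j < p, 0 < lam j) (w mu x : Vec p) :
    inner ℝ w (rescaled mu x) = ∑ j ∈ Finset.range p,
      √(lam j / p) * inner ℝ w (u j) * pcScore mu (lam j) (u j) x := by
  rw [inner_eq_sum_range hu]
  refine Finset.sum_congr rfl fun j hj => ?_
  rw [inner_rescaled hlam (Finset.mem_range.1 hj)]
  ring

lemma inner_rescaled_rescaled (hu : Orthonormal ℝ fun i : Fin p => u i)
    (hlam : ∀ j < p, 0 < lam j) (mu x x' : Vec p) :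
    inner ℝ (rescaled mu x) (rescaled mu x') = ∑ j ∈ Finset.range p,
      lam j / p * (pcScore mu (lam j) (u j) x * pcScore mu (lam j) (u j) x') := by
  rw [inner_eq_sum_range hu]
  refine Finset.sum_congr rfl fun j hj => ?_
  have hj' := Finset.mem_range.1 hj
  rw [real_inner_comm, inner_rescaled hlam hj', inner_rescaled hlam hj']
  have h1 : √(lam j / p) * √(lam j / p) = lam j / p :=
    Real.mul_self_sqrt (div_nonneg (hlam j hj').le (Nat.cast_nonneg p))
  linear_combination (pcScore mu (lam j) (u j) x * pcScore mu (lam j) (u j) x') * h1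

end Rescaled

/-! ### The leading scores are almost surely generic -/

section Generic

variable {Ω : Type*} [MeasurableSpace Ω] {P : Measure Ω} [IsProbabilityMeasure P]
  {n p : ℕ} {X : Fin n → Ω → Vec p} {mu : Vec p} {Sig : Matrix (Fin p) (Fin p) ℝ}
  {lam : ℕ → ℝ} {u : ℕ → Vec p}

/-- The leading scores of one observation. -/
noncomputable def leadingScores {p : ℕ} (m : ℕ) (mu : Vec p) (lam : ℕ → ℝ) (u : ℕ → Vec p)
    (x : Vec p) : Fin m → ℝ :=
  fun s => pcScore mu (lam s) (u s) x

lemma measurable_leadingScores (m : ℕ) : Measurable (leadingScores m mu lam u) :=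
  measurable_pi_lambda _ fun _ => (continuous_pcScore _ _ _).measurable

lemma map_leadingScores_absolutelyContinuous {m : ℕ} (hm : m ≤ p)
    (hu : Orthonormal ℝ fun i : Fin p => u i) (hlam : ∀ j < p, 0 < lam j) :
    (volume : Measure (Vec p)).map (leadingScores m mu lam u) ≪ volume := by
  let T : Vec p →ₗ[ℝ] (Fin m → ℝ) :=
    LinearMap.pi fun s => (√(lam s))⁻¹ • (innerₛₗ ℝ (u s))
  have hT : ∀ x s, T x s = (√(lam s))⁻¹ * inner ℝ (u s) x := fun x s => rfl
  have hsurj : Function.Surjective T := by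
    intro z
    refine ⟨∑ s : Fin m, (√(lam s) * z s) • u s, ?_⟩
    funext s
    have hu' : Orthonormal ℝ fun s : Fin m => u s :=
      hu.comp (Fin.castLE hm) (Fin.castLE_injective hm)
    have h1 : √(lam s) ≠ 0 := (Real.sqrt_pos.2 (hlam s (by omega))).ne'
    rw [hT, hu'.inner_right_fintype]
    field_simp
  have hcomp : leadingScores m mu lam u = T ∘ fun x => x - mu := by
    funext x s
    rw [Function.comp, hT]
    rfl
  have hTm : Measurable T := T.continuous_of_finiteDimensional.measurable
  have hmap : (volume : Measure (Vec p)).map (fun x => x - mu) = volume :=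
    (measurePreserving_sub_right volume mu).map_eq
  obtain ⟨c, -, hc⟩ := T.exists_map_addHaar_eq_smul_addHaar volume volume hsurj
  rw [hcomp, ← Measure.map_map hTm (by fun_prop), hmap, hc]
  exact Measure.smul_absolutelyContinuous

/-- The matrix of leading scores has an absolutely continuous law, which does not charge the zero
set of the Krylov determinant. -/
lemma ae_krylovDet_ne_zero (hX : IsSample P X mu Sig)
    (hu : Orthonormal ℝ fun i : Fin p => u i) (hlam : ∀ j < p, 0 < lam j) {m : ℕ} (hm : 0 < m)
    (hmn : m < n) (hnp : n < p) {σ : Fin m → ℝ} (hσ : ∀ s, σ s ≠ 0) {a : Fin m → ℝ}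
    (ha : a ≠ 0) :
    ∀ᵐ ω ∂P, krylovDet σ (centering n) a
      (Matrix.of fun s b => pcScore mu (lam s) (u s) (X b ω)) ≠ 0 := by
  have hlaw : P.map (fun ω b => leadingScores m mu lam u (X b ω)) ≪
      (volume : Measure (Fin n → Fin m → ℝ)) := by
    have hmeas : ∀ b, Measurable fun ω => leadingScores m mu lam u (X b ω) := fun b =>
      (measurable_leadingScores m).comp (hX.measurable b)
    have hind : iIndepFun (fun b ω => leadingScores m mu lam u (X b ω)) P :=
      hX.indep.comp (fun _ => leadingScores m mu lam u) fun _ => measurable_leadingScores m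
    rw [hind.map_fun_eq_pi_map fun b => (hmeas b).aemeasurable]
    have hprob : ∀ b, IsProbabilityMeasure (P.map fun ω => leadingScores m mu lam u (X b ω)) :=
      fun b => Measure.isProbabilityMeasure_map (hmeas b).aemeasurable
    refine absolutelyContinuous_pi _ _ fun b => ?_
    have h1 : P.map (fun ω => leadingScores m mu lam u (X b ω)) =
        (P.map (X b)).map (leadingScores m mu lam u) :=
      (Measure.map_map (measurable_leadingScores m) (hX.measurable b)).symm
    rw [h1]
    exact ((hX.absolutelyContinuous b).map (measurable_leadingScores m)).trans
      (map_leadingScores_absolutelyContinuous (by omega) hu hlam)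
  let f : (Fin n → Fin m → ℝ) → ℝ := fun z =>
    krylovDet σ (centering n) a (Matrix.of fun s b => z b s)
  have hf : Continuous f := by
    have h1 : Continuous fun z : Fin n → Fin m → ℝ => (Matrix.of fun s b => z b s) :=
      continuous_matrix fun s b => by simp only [Matrix.of_apply]; fun_prop
    have h2 : Continuous fun z : Fin n → Fin m → ℝ =>
        Matrix.diagonal σ * (Matrix.of fun s b => z b s) * centering n :=
      (continuous_const.matrix_mul h1).matrix_mul continuous_const
    have h3 := h2.matrix_mul h2.matrix_transpose
    refine h3.matrix_det.mul (Continuous.matrix_det (continuous_matrix fun i j => ?_))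
    exact (continuous_apply i).comp ((h3.pow j).matrix_mulVec continuous_const)
  obtain ⟨Z, hZ⟩ := exists_krylovDet_ne_zero hm hmn hσ ha (C := centering n) mul_centering
  have hnull : volume {z | f z = 0} = 0 := by
    refine measure_zeros_eq_zero volume hf (x₀ := fun b s => Z s b) hZ fun y => ?_
    obtain ⟨q, hq⟩ := krylovDet_line σ (centering n) a Z (Matrix.of fun s b => y b s)
    exact ⟨q, fun t => hq t⟩
  have h2 := measure_eq_zero_iff_ae_notMem.1 (hlaw hnull)
  have hmeas : Measurable fun ω b => leadingScores m mu lam u (X b ω) :=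
    measurable_pi_lambda _ fun b => (measurable_leadingScores m).comp (hX.measurable b)
  exact ae_of_ae_map hmeas.aemeasurable h2

end Generic

/-! ### Limits of the population eigenvalues -/

lemma SpikedCovariance.exists_limits {n m : ℕ} (hmn : m < n) {lam : ℕ → ℕ → ℝ}
    (h : SpikedCovariance n m lam) :
    ∃ (sigSq : Fin m → ℝ) (t C : ℝ), (∀ s, 0 < sigSq s) ∧ 0 < t ∧
      (∀ p, n < p → ∀ j < p, 0 < lam p j) ∧
      (∀ s : Fin m, Tendsto (fun p : ℕ => lam p s / p) atTop (𝓝 (sigSq s))) ∧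
      (∀ p, n < p → ∀ j ∈ Finset.Ico m p, lam p j ≤ C) ∧
      Tendsto (fun p : ℕ => ∑ j ∈ Finset.Ico m p, lam p j / p) atTop (𝓝 t) := by
  obtain ⟨sigSq, tauSq, t, hsig, htau, hlead, hrest, ⟨C, hC⟩, ht, hlim⟩ := h
  have hzero : ∀ s < m, Tendsto (fun p : ℕ => tauSq p s / p) atTop (𝓝 0) := by
    intro s hs
    refine squeeze_zero' (g := fun p : ℕ => C / p) ?_ ?_
      (tendsto_const_nhds.div_atTop tendsto_natCast_atTop_atTop)
    · filter_upwards [eventually_gt_atTop n] with p hp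
      exact div_nonneg (htau p hp s (by omega)).le (Nat.cast_nonneg p)
    · filter_upwards [eventually_gt_atTop n] with p hp
      exact div_le_div_of_nonneg_right (hC p hp s (by omega)) (Nat.cast_nonneg p)
  refine ⟨sigSq, t, C, hsig, ht, fun p hp j hj => ?_, fun s => ?_, fun p hp j hj => ?_, ?_⟩
  · by_cases hjm : j < m
    · have h1 := hlead p hp ⟨j, hjm⟩
      simp only at h1
      rw [h1]
      have := htau p hp j hj
      have := mul_nonneg (hsig ⟨j, hjm⟩).le (Nat.cast_nonneg (α := ℝ) p)
      linarith
    · rw [hrest p hp j hj (by omega)]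
      exact htau p hp j hj
  · have h1 := (hzero s s.2).const_add (sigSq s)
    rw [add_zero] at h1
    refine h1.congr' ?_
    filter_upwards [eventually_gt_atTop n] with p hp
    have hp0 : (p : ℝ) ≠ 0 := Nat.cast_ne_zero.2 (by omega)
    rw [hlead p hp s]
    field_simp
  · rw [Finset.mem_Ico] at hj
    rw [hrest p hp j hj.2 hj.1]
    exact hC p hp j hj.2
  · have h1 := hlim.sub (tendsto_finsetSum (Finset.range m) fun s hs =>
      hzero s (Finset.mem_range.1 hs))
    rw [Finset.sum_const_zero, sub_zero] at h1
    refine h1.congr' ?_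
    filter_upwards [eventually_gt_atTop n] with p hp
    rw [Finset.sum_div, ← Finset.sum_range_add_sum_Ico _ (by omega : m ≤ p), add_sub_cancel_left]
    refine Finset.sum_congr rfl fun j hj => ?_
    rw [Finset.mem_Ico] at hj
    rw [hrest p hp j hj.2 hj.1]

/-! ### Limits along an ultrafilter -/

section Limits

open scoped Matrix

variable {ι : Type*} {n m r : ℕ} {p : ι → ℕ} {mu : (i : ι) → Vec (p i)}
  {x : (i : ι) → Fin n → Vec (p i)} {u uHat : (i : ι) → ℕ → Vec (p i)}
  {v : (i : ι) → Fin r → Vec (p i)} {lamHat : ι → ℕ → ℝ} {A : Matrix (Fin m) (Fin r) ℝ}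
  {VG : Matrix (Fin r) (Fin r) ℝ} {M : Matrix (Fin m) (Fin n) ℝ} {t : ℝ}

/-- Centering turns the limits of the inner products of the observations into those of `DualLimits`,
with `N` the centered version of `M`. -/
lemma dualLimits_centered {l : Filter ι} (hn : 0 < n) (ht : 0 < t)
    (hxx : ∀ b b', Tendsto (fun i => inner ℝ (rescaled (mu i) (x i b)) (rescaled (mu i) (x i b')))
      l (𝓝 (∑ s, M s b * M s b' + t * if b = b' then 1 else 0)))
    (hux : ∀ (s : Fin m) b, Tendsto (fun i => inner ℝ (u i s) (rescaled (mu i) (x i b))) l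
      (𝓝 (M s b)))
    (hvx : ∀ k b, Tendsto (fun i => inner ℝ (v i k) (rescaled (mu i) (x i b))) l
      (𝓝 (∑ s, A s k * M s b)))
    (hdet : ((M * centering n) * (M * centering n)ᵀ).det ≠ 0) :
    DualLimits l (fun i => centered (mu i) (x i)) u v A (M * centering n) t := by
  refine ⟨fun a a' => ?_, fun s a => ?_, fun k a => ?_, ht, fun s => ?_, fun y hy => ?_⟩
  · have h1 : Tendsto (fun i => ∑ b, centering n a b * ∑ b', centering n a' b' *
        inner ℝ (rescaled (mu i) (x i b)) (rescaled (mu i) (x i b'))) l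
        (𝓝 (∑ b, centering n a b * ∑ b', centering n a' b' *
          (∑ s, M s b * M s b' + t * if b = b' then 1 else 0))) :=
      tendsto_finsetSum _ fun b _ => (tendsto_finsetSum _ fun b' _ =>
        (hxx b b').const_mul _).const_mul _
    convert h1 using 2
    · simp only [centered, sum_inner, inner_sum, real_inner_smul_left, real_inner_smul_right,
        Finset.mul_sum]
      rw [Finset.sum_comm]
      exact Finset.sum_congr rfl fun b _ => Finset.sum_congr rfl fun b' _ => by ring
    · rw [← sum_centering_mul_centering hn a a']
      simp only [Matrix.mul_apply, mul_add, Finset.sum_add_distrib, Finset.mul_sum, Finset.sum_mul]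
      congr 1
      · rw [Finset.sum_comm, Finset.sum_congr rfl fun b' _ => Finset.sum_comm, Finset.sum_comm]
        refine Finset.sum_congr rfl fun b _ => Finset.sum_congr rfl fun b' _ =>
          Finset.sum_congr rfl fun s _ => ?_
        rw [centering_symm b a, centering_symm b' a']
        ring
      · simp only [mul_ite, mul_one, mul_zero, Finset.sum_ite_eq, Finset.mem_univ, if_true]
        exact Finset.sum_congr rfl fun b _ => by ring
  · have h1 : Tendsto (fun i => ∑ b, centering n a b *
        inner ℝ (u i s) (rescaled (mu i) (x i b))) l (𝓝 (∑ b, centering n a b * M s b)) :=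
      tendsto_finsetSum _ fun b _ => (hux s b).const_mul _
    convert h1 using 2
    · simp only [centered, inner_sum, real_inner_smul_right]
    · rw [Matrix.mul_apply]
      exact Finset.sum_congr rfl fun b _ => by rw [centering_symm b a, mul_comm]
  · have h1 : Tendsto (fun i => ∑ b, centering n a b *
        inner ℝ (v i k) (rescaled (mu i) (x i b))) l
        (𝓝 (∑ b, centering n a b * ∑ s, A s k * M s b)) :=
      tendsto_finsetSum _ fun b _ => (hvx k b).const_mul _
    convert h1 using 2
    · simp only [centered, inner_sum, real_inner_smul_right]
    · simp only [Matrix.mul_apply, Finset.mul_sum]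
      rw [Finset.sum_comm]
      refine Finset.sum_congr rfl fun b _ => Finset.sum_congr rfl fun s _ => ?_
      rw [centering_symm b a]
      ring
  · simp only [Matrix.mul_apply]
    rw [Finset.sum_comm]
    simp_rw [← Finset.mul_sum, sum_centering hn, mul_zero, Finset.sum_const_zero]
  · have h1 : y ᵥ* (M * centering n) = 0 := by
      ext a
      exact hy a
    have h2 : y ᵥ* ((M * centering n) * (M * centering n)ᵀ) = 0 := by
      rw [← Matrix.vecMul_vecMul, h1, Matrix.zero_vecMul]
    exact Matrix.eq_zero_of_vecMul_eq_zero hdet h2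

lemma ridge_const_mul (n m : ℕ) (a : ℝ) (l : ℕ → ℝ) :
    ridge n m (fun j => a * l j) = a * ridge n m l := by
  rw [ridge, ridge, ← Finset.mul_sum, mul_div_assoc]

/-- The version of `exists_alignedLimits` for the sample covariance matrix of observations `x` whose
inner products converge, with the adaptive subspace written through `ridgedSum`. -/
theorem exists_alignedLimits_argSubspace {l : Ultrafilter ι} (hmn : m + 2 ≤ n) (ht : 0 < t)
    (hp : ∀ᶠ i in (l : Filter ι), n < p i)
    (hHat : ∀ᶠ i in (l : Filter ι), IsEigendecomposition (sampleCov (x i)) (lamHat i) (uHat i))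
    (hu : ∀ᶠ i in (l : Filter ι), Orthonormal ℝ (fun j : Fin m => u i j))
    (hxx : ∀ b b', Tendsto (fun i => inner ℝ (rescaled (mu i) (x i b)) (rescaled (mu i) (x i b')))
      l (𝓝 (∑ s, M s b * M s b' + t * if b = b' then 1 else 0)))
    (hux : ∀ (s : Fin m) b, Tendsto (fun i => inner ℝ (u i s) (rescaled (mu i) (x i b))) l
      (𝓝 (M s b)))
    (hvx : ∀ k b, Tendsto (fun i => inner ℝ (v i k) (rescaled (mu i) (x i b))) l
      (𝓝 (∑ s, A s k * M s b)))
    (hvu : ∀ k (a : Fin m), Tendsto (fun i => inner ℝ (v i k) (u i a)) l (𝓝 (A a k)))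
    (hvv : ∀ k k', Tendsto (fun i => inner ℝ (v i k) (v i k')) l (𝓝 (VG k k')))
    (hVG : IsUnit VG.det)
    (hdet : ((M * centering n) * (M * centering n)ᵀ).det ≠ 0) :
    ∃ (rho : ι → ℕ → ℝ) (e : OrthonormalBasis (Fin m) ℝ (EuclideanSpace ℝ (Fin m)))
      (c : Fin m → ℝ), AlignedLimits (l : Filter ι) u uHat v rho A VG e c ∧
      (∀ (γ : ℝ) (y : EuclideanSpace ℝ (Fin m)), (∀ j, inner ℝ (e j) y ≠ 0 → c j = γ) →
        ∃ μ : ℝ, ((M * centering n) * (M * centering n)ᵀ) *ᵥ ⇑y = μ • ⇑y) ∧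
      (∀ᶠ i in (l : Filter ι), argSubspace n m (lamHat i) (uHat i) (v i) =
        (leadingSpan m (uHat i) ⊔ Submodule.span ℝ (Set.range (v i))) ⊓
          (Submodule.span ℝ (Set.range fun k => ridgedSum m (uHat i) (rho i) (v i k)))ᗮ) := by
  have hn : 0 < n := by omega
  have hS : ∀ᶠ i in (l : Filter ι), DualSample (centered (mu i) (x i)) (uHat i)
      (fun j => (n / p i : ℝ) * lamHat i j) := by
    filter_upwards [hp, hHat] with i hpi hi
    exact dualSample_centered hn hpi (mu i) hi
  obtain ⟨e, c, h1, h2, h3⟩ := exists_alignedLimits hmn hS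
    (dualLimits_centered hn ht hxx hux hvx hdet) hu hvu hvv hVG
  refine ⟨_, e, c, h1, fun γ y hy => ?_, ?_⟩
  · obtain ⟨μ, hμ⟩ := h2 γ y hy
    refine ⟨μ, funext fun s => ?_⟩
    exact hμ s
  · filter_upwards [h3, hp, h1.orthonormal_uHat] with i hi hpi hui
    -- the ridge and the eigenvalues scale alike, so the rescaling by `n / p` is harmless
    have ha : (n / p i : ℝ) ≠ 0 :=
      div_ne_zero (Nat.cast_ne_zero.2 hn.ne') (Nat.cast_ne_zero.2 (by omega))
    have h0 : ridge n m (lamHat i) ≠ 0 := fun h => hi.1 (by rw [ridge_const_mul, h, mul_zero])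
    have hne : ∀ j : Fin m, lamHat i j ≠ ridge n m (lamHat i) := fun j h =>
      hi.2 j (by rw [ridge_const_mul, h])
    have hrho : (fun j => ridge n m (fun j => (n / p i : ℝ) * lamHat i j) /
        ((n / p i : ℝ) * lamHat i j - ridge n m (fun j => (n / p i : ℝ) * lamHat i j))) =
        fun j => ridge n m (lamHat i) / (lamHat i j - ridge n m (lamHat i)) := by
      funext j
      rw [ridge_const_mul, ← mul_sub, mul_div_mul_left _ _ ha]
    rw [argSubspace, signalSubspace]
    simp only [ridgedVector_eq hui h0 hne, hrho]

end Limits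

/-! ### Transfer to probabilities -/

section Transfer

open scoped Matrix

/-- The noise part of the inner product of an observation with a unit vector has vanishing variance,
by Parseval's identity. -/
lemma tendsto_sum_sq_inner {m : ℕ} {lam : ℕ → ℕ → ℝ} {u : (p : ℕ) → ℕ → Vec p}
    {w : (p : ℕ) → Vec p} {C : ℝ}
    (hu : ∀ᶠ p in atTop, Orthonormal ℝ fun i : Fin p => u p i)
    (hlam : ∀ᶠ p in atTop, ∀ j ∈ Finset.Ico m p, 0 < lam p j)
    (hC : ∀ᶠ p in atTop, ∀ j ∈ Finset.Ico m p, lam p j ≤ C)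
    (hw : ∀ᶠ p in atTop, ‖w p‖ = 1) :
    Tendsto (fun p : ℕ => ∑ j ∈ Finset.Ico m p, (√(lam p j / p) * inner ℝ (w p) (u p j)) ^ 2)
      atTop (𝓝 0) := by
  refine squeeze_zero' (g := fun p : ℕ => |C| / p)
    (Eventually.of_forall fun p => Finset.sum_nonneg fun j _ => sq_nonneg _) ?_
    (tendsto_const_nhds.div_atTop tendsto_natCast_atTop_atTop)
  filter_upwards [hu, hlam, hC, hw] with p hup hl hCp hwp
  have h1 : ∑ j ∈ Finset.range p, inner ℝ (w p) (u p j) ^ 2 = 1 := by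
    have := inner_eq_sum_range hup (w p) (w p)
    rw [real_inner_self_eq_norm_sq, hwp, one_pow] at this
    rw [this]
    exact Finset.sum_congr rfl fun j _ => by rw [real_inner_comm (w p) (u p j), sq]
  calc ∑ j ∈ Finset.Ico m p, (√(lam p j / p) * inner ℝ (w p) (u p j)) ^ 2
      ≤ ∑ j ∈ Finset.Ico m p, |C| / p * inner ℝ (w p) (u p j) ^ 2 := by
        refine Finset.sum_le_sum fun j hj => ?_
        rw [mul_pow, Real.sq_sqrt (div_nonneg (hl j hj).le (Nat.cast_nonneg p))]
        gcongr
        exact (hCp j hj).trans (le_abs_self C)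
    _ ≤ ∑ j ∈ Finset.range p, |C| / p * inner ℝ (w p) (u p j) ^ 2 :=
        Finset.sum_le_sum_of_subset_of_nonneg
          (fun j hj => Finset.mem_range.2 (Finset.mem_Ico.1 hj).2)
          fun j _ _ => by positivity
    _ = |C| / p := by rw [← Finset.mul_sum, h1, mul_one]

variable {Ω : Type*} [MeasurableSpace Ω] {P : Measure Ω} [IsProbabilityMeasure P] {n m r : ℕ}
  {X : (p : ℕ) → Fin n → Ω → Vec p} {mu : (p : ℕ) → Vec p}
  {Sig : (p : ℕ) → Matrix (Fin p) (Fin p) ℝ} {lam : ℕ → ℕ → ℝ} {u : (p : ℕ) → ℕ → Vec p}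
  {lamHat : ℕ → Ω → ℕ → ℝ} {uHat : (p : ℕ) → Ω → ℕ → Vec p} {v : (p : ℕ) → Fin r → Vec p}
  {A : Matrix (Fin m) (Fin r) ℝ}

/-- The (outer) probability of events `bad p` tends to zero if, whenever the inner products converge
as in `AlignedLimits` along an ultrafilter on pairs `(p, ω)` and no eigenvector of the limiting form
is orthogonal to `a`, the pairs are eventually not bad. -/
theorem tendsto_measure_zero_of_alignedLimits (hm : 1 ≤ m) (hmn : m + 2 ≤ n)
    (hX : ∀ p, n < p → IsSample P (X p) (mu p) (Sig p))
    (hu : ∀ p, n < p → IsEigendecomposition (Sig p) (lam p) (u p))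
    (huHat : ∀ p, n < p → ∀ ω,
      IsEigendecomposition (sampleCov fun i => X p i ω) (lamHat p ω) (uHat p ω))
    (h₁ : SpikedCovariance n m lam) (h₂ : RhoMixingScores P X mu lam u)
    (h₃ : ReferencesNonsingular n m v) (h₄ : ReferencesAligned u v A)
    {a : Fin m → ℝ} (ha : a ≠ 0) (bad : ℕ → Set Ω)
    (hbad : ∀ (l : Ultrafilter (ℕ × Ω)) (rho : ℕ × Ω → ℕ → ℝ) (VG : Matrix (Fin r) (Fin r) ℝ)
      (e : OrthonormalBasis (Fin m) ℝ (EuclideanSpace ℝ (Fin m))) (c : Fin m → ℝ),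
      AlignedLimits (l : Filter (ℕ × Ω)) (p := Prod.fst) (fun q => u q.1)
        (fun q => uHat q.1 q.2) (fun q => v q.1) rho A VG e c →
      (∀ (γ : ℝ) (y : EuclideanSpace ℝ (Fin m)), y ≠ 0 →
        (∀ j, inner ℝ (e j) y ≠ 0 → c j = γ) → ⇑y ⬝ᵥ a ≠ 0) →
      (∀ᶠ q in (l : Filter (ℕ × Ω)),
        argSubspace n m (lamHat q.1 q.2) (uHat q.1 q.2) (v q.1) =
          (leadingSpan m (uHat q.1 q.2) ⊔ Submodule.span ℝ (Set.range (v q.1))) ⊓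
            (Submodule.span ℝ
              (Set.range fun k => ridgedSum m (uHat q.1 q.2) (rho q) (v q.1 k)))ᗮ) →
      ∀ᶠ q in (l : Filter (ℕ × Ω)), q.2 ∉ bad q.1) :
    Tendsto (fun p => P (bad p)) atTop (𝓝 0) := by
  obtain ⟨sigSq, t, C, hsig, ht, hlam, hspike, hC, hrest⟩ :=
    h₁.exists_limits (by omega : m < n)
  obtain ⟨Z, hZ, ⟨C4, h4⟩, hmix⟩ := h₂
  obtain ⟨hv, VG, hVG, hvv⟩ := h₃
  have hZs : IsScoreArray P Z := isScoreArray hX hu hlam hZ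
  have hv1 : ∀ k, ∀ᶠ p in atTop, ‖v p k‖ = 1 := fun k => by
    filter_upwards [eventually_gt_atTop n, eventually_ge_atTop (m + r)] with p hp hp'
    exact (hv p hp hp').1 k
  -- the random data in dimension `p`: noise part of the Gram matrix, noise part of the inner
  -- products with the references, and the leading scores, which do not vary with `p`
  let Y : ℕ → Ω → (Fin n × Fin n) ⊕ (Fin r × Fin n) ⊕ (Fin m × Fin n) → ℝ := fun p ω =>
    Sum.elim
      (fun q => ∑ j ∈ Finset.Ico m p,
        lam p j / p * (Z j q.1 ω * Z j q.2 ω - if q.1 = q.2 then 1 else 0))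
      (Sum.elim
        (fun q => ∑ j ∈ Finset.Ico m p, √(lam p j / p) * inner ℝ (v p q.1) (u p j) * Z j q.2 ω)
        (fun q => Z q.1 q.2 ω))
  let Yinf : Ω → (Fin n × Fin n) ⊕ (Fin r × Fin n) ⊕ (Fin m × Fin n) → ℝ := fun ω =>
    Sum.elim (fun _ => 0) (Sum.elim (fun _ => 0) (fun q => Z q.1 q.2 ω))
  have hYinf : Measurable Yinf := by
    refine measurable_pi_iff.2 ?_
    rintro (q | q | q)
    · exact measurable_const
    · exact measurable_const
    · exact hZs.measurable _ _
  have hY : ∀ k, TendstoInMeasure P (fun p ω => Y p ω k) atTop (fun ω => Yinf ω k) := by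
    rintro (q | q | q)
    · refine hZs.tendstoInMeasure_mul h4 hmix (fun p => Finset.Ico m p) (fun p => by simp)
        (fun p j => lam p j / p) (B := C) ?_ q.1 q.2
      filter_upwards [eventually_gt_atTop n] with p hp j hj
      rw [abs_of_nonneg
        (div_nonneg (hlam p hp j (Finset.mem_Ico.1 hj).2).le (Nat.cast_nonneg p))]
      exact div_le_div_of_nonneg_right (hC p hp j hj) (Nat.cast_nonneg p)
    · refine tendstoInMeasure_of_orthonormal (W := fun j => Z j q.2) (fun j => hZs.memLp j q.2)
        (hZs.integral_mul q.2) (fun p => Finset.Ico m p)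
        (fun p j => √(lam p j / p) * inner ℝ (v p q.1) (u p j)) ?_
      refine tendsto_sum_sq_inner (C := C) ?_ ?_ ?_ (hv1 q.1)
      · filter_upwards [eventually_gt_atTop n] with p hp using (hu p hp).orthonormal
      · filter_upwards [eventually_gt_atTop n] with p hp j hj
        exact hlam p hp j (Finset.mem_Ico.1 hj).2
      · filter_upwards [eventually_gt_atTop n] with p hp using hC p hp
    · intro ε hε
      simp only [Y, Yinf, Sum.elim_inr, edist_self]
      simp [hε.ne']
  have hσ : ∀ s, √(sigSq s) ≠ 0 := fun s => (Real.sqrt_pos.2 (hsig s)).ne'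
  have hae : ∀ᵐ ω ∂P, krylovDet (fun s => √(sigSq s)) (centering n) a
      (Matrix.of fun (s : Fin m) b => Z s b ω) ≠ 0 := by
    -- the leading scores are the same in every dimension, so `n + 1` may be used
    have hn1 : n < n + 1 := Nat.lt_succ_self n
    filter_upwards [ae_krylovDet_ne_zero (hX (n + 1) hn1) (hu (n + 1) hn1).orthonormal
      (hlam (n + 1) hn1) (by omega : 0 < m) (by omega : m < n) hn1 hσ ha] with ω hω
    convert hω using 5 with s b
    exact (hZ (n + 1) hn1 s (by omega) b ω).symm
  refine tendsto_measure_zero_of_ultrafilter hYinf hY bad ?_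
  filter_upwards [hae] with ω₀ hω₀ l hl hlY
  rw [tendsto_pi_nhds] at hlY
  have hp : ∀ᶠ q in (l : Filter (ℕ × Ω)), n < q.1 := hl.eventually (eventually_gt_atTop n)
  have hlead : ∀ (s : Fin m) b, Tendsto (fun q : ℕ × Ω => Z s b q.2) l (𝓝 (Z s b ω₀)) :=
    fun s b => hlY (.inr (.inr (s, b)))
  have hpos : ∀ s : Fin m, Tendsto (fun q : ℕ × Ω => lam q.1 s / q.1) l (𝓝 (sigSq s)) :=
    fun s => (hspike s).comp hl
  have hvu : ∀ k (s : Fin m), Tendsto (fun q : ℕ × Ω => inner ℝ (v q.1 k) (u q.1 s)) l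
      (𝓝 (A s k)) := fun k s => (h₄.2 k s).2.comp hl
  set M : Matrix (Fin m) (Fin n) ℝ := Matrix.of fun s b => √(sigSq s) * Z s b ω₀ with hM
  have hMeq : M = Matrix.diagonal (fun s => √(sigSq s)) *
      Matrix.of fun (s : Fin m) b => Z s b ω₀ := by
    ext s b
    rw [Matrix.diagonal_mul]
    rfl
  rw [krylovDet, ← hMeq] at hω₀
  have hux : ∀ (s : Fin m) b, Tendsto (fun q : ℕ × Ω =>
      inner ℝ (u q.1 s) (rescaled (mu q.1) (X q.1 b q.2))) l (𝓝 (M s b)) := by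
    intro s b
    refine ((hpos s).sqrt.mul (hlead s b)).congr' ?_
    filter_upwards [hp] with q hq
    rw [inner_rescaled (hlam q.1 hq) (by omega), hZ q.1 hq s (by omega)]
  have hxx : ∀ b b', Tendsto (fun q : ℕ × Ω => inner ℝ (rescaled (mu q.1) (X q.1 b q.2))
      (rescaled (mu q.1) (X q.1 b' q.2))) l
      (𝓝 (∑ s, M s b * M s b' + t * if b = b' then 1 else 0)) := by
    intro b b'
    have h0 : Tendsto (fun q : ℕ × Ω => ∑ s : Fin m, lam q.1 s / q.1 *
        (Z s b q.2 * Z s b' q.2)) l (𝓝 (∑ s : Fin m, sigSq s * (Z s b ω₀ * Z s b' ω₀))) :=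
      tendsto_finsetSum _ fun s _ => (hpos s).mul ((hlead s b).mul (hlead s b'))
    have h1 := (h0.add
        ((hrest.comp hl).mul_const (if b = b' then (1 : ℝ) else 0))).add (hlY (.inl (b, b')))
    simp only [Yinf, Sum.elim_inl, add_zero] at h1
    have h2 : ∑ s, sigSq s * (Z s b ω₀ * Z s b' ω₀) = ∑ s, M s b * M s b' :=
      Finset.sum_congr rfl fun s _ => by
        have := Real.mul_self_sqrt (hsig s).le
        simp only [hM, Matrix.of_apply]
        linear_combination (-(Z s b ω₀ * Z s b' ω₀)) * this
    rw [h2] at h1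
    refine h1.congr' ?_
    filter_upwards [hp] with q hq
    rw [inner_rescaled_rescaled (hu q.1 hq).orthonormal (hlam q.1 hq),
      ← Finset.sum_range_add_sum_Ico _ (by omega : m ≤ q.1), Finset.sum_range, add_assoc]
    congr 1
    · refine Finset.sum_congr rfl fun s _ => ?_
      rw [hZ q.1 hq s (by omega), hZ q.1 hq s (by omega)]
    · simp only [Y, Sum.elim_inl, Function.comp_apply]
      rw [Finset.sum_mul, ← Finset.sum_add_distrib]
      refine Finset.sum_congr rfl fun j hj => ?_
      rw [hZ q.1 hq j (Finset.mem_Ico.1 hj).2, hZ q.1 hq j (Finset.mem_Ico.1 hj).2]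
      ring
  have hvx : ∀ k b, Tendsto (fun q : ℕ × Ω =>
      inner ℝ (v q.1 k) (rescaled (mu q.1) (X q.1 b q.2))) l (𝓝 (∑ s, A s k * M s b)) := by
    intro k b
    have h0 : Tendsto (fun q : ℕ × Ω => ∑ s : Fin m, inner ℝ (v q.1 k) (u q.1 s) *
        (√(lam q.1 s / q.1) * Z s b q.2)) l (𝓝 (∑ s, A s k * M s b)) :=
      tendsto_finsetSum _ fun s _ => (hvu k s).mul ((hpos s).sqrt.mul (hlead s b))
    have h1 := h0.add (hlY (.inr (.inl (k, b))))
    simp only [Yinf, Sum.elim_inl, Sum.elim_inr, add_zero] at h1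
    refine h1.congr' ?_
    filter_upwards [hp] with q hq
    rw [inner_rescaled_eq_sum (hu q.1 hq).orthonormal (hlam q.1 hq),
      ← Finset.sum_range_add_sum_Ico _ (by omega : m ≤ q.1), Finset.sum_range]
    congr 1
    · refine Finset.sum_congr rfl fun s _ => ?_
      rw [hZ q.1 hq s (by omega)]
      ring
    · simp only [Y, Sum.elim_inl, Sum.elim_inr]
      refine Finset.sum_congr rfl fun j hj => ?_
      rw [hZ q.1 hq j (Finset.mem_Ico.1 hj).2]
  obtain ⟨rho, e, c, hal, heig, hT⟩ := exists_alignedLimits_argSubspace (l := l) (p := Prod.fst)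
    (mu := fun q => mu q.1) (x := fun q b => X q.1 b q.2) (u := fun q => u q.1)
    (uHat := fun q => uHat q.1 q.2) (v := fun q => v q.1) (lamHat := fun q => lamHat q.1 q.2)
    hmn ht hp (hp.mono fun q hq => huHat q.1 hq q.2)
    (hp.mono fun q hq => (hu q.1 hq).orthonormal.comp (Fin.castLE (by omega))
      (Fin.castLE_injective _)) hxx hux hvx hvu
    (fun k k' => (hvv k k').comp hl) hVG (left_ne_zero_of_mul hω₀)
  refine hbad l rho VG e c hal (fun γ y hy hγ => ?_) hT
  obtain ⟨μ, hμ⟩ := heig γ y hγ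
  refine eigenvector_dotProduct_ne_zero ?_ (right_ne_zero_of_mul hω₀) ?_ hμ
  · rw [Matrix.transpose_mul, Matrix.transpose_transpose]
  · exact fun h => hy (by ext s; exact congrFun h s)

lemma tendsto_measure_one_of_compl {s : ℕ → Set Ω}
    (h : Tendsto (fun p => P (s p)ᶜ) atTop (𝓝 0)) : Tendsto (fun p => P (s p)) atTop (𝓝 1) := by
  have h1 : Tendsto (fun p => 1 - P (s p)ᶜ) atTop (𝓝 (1 - 0)) :=
    ENNReal.Tendsto.sub tendsto_const_nhds h (Or.inl ENNReal.one_ne_top)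
  rw [tsub_zero] at h1
  refine tendsto_of_tendsto_of_tendsto_of_le_of_le h1 tendsto_const_nhds (fun p => ?_)
    fun p => prob_le_one
  rw [tsub_le_iff_right, ← measure_univ (μ := P), ← Set.union_compl_self (s p)]
  exact measure_union_le _ _

end Transfer

end ARG

theorem theorem7 {Ω : Type*} [MeasurableSpace Ω] (P : Measure Ω) [IsProbabilityMeasure P]
    (n m r : ℕ) (hm : 1 ≤ m) (hmn : m + 2 ≤ n) (hr : 1 ≤ r)
    -- the sample in each dimension, with its mean and covariance matrix
    (X : (p : ℕ) → Fin n → Ω → Vec p) (mu : (p : ℕ) → Vec p)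
    (Sig : (p : ℕ) → Matrix (Fin p) (Fin p) ℝ)
    (hX : ∀ p, n < p → IsSample P (X p) (mu p) (Sig p))
    -- true PC variances and directions
    (lam : ℕ → ℕ → ℝ) (u : (p : ℕ) → ℕ → Vec p)
    (hu : ∀ p, n < p → IsEigendecomposition (Sig p) (lam p) (u p))
    -- sample PC variances and directions
    (lamHat : ℕ → Ω → ℕ → ℝ) (uHat : (p : ℕ) → Ω → ℕ → Vec p)
    (huHat : ∀ p, n < p → ∀ ω,
      IsEigendecomposition (sampleCov fun i => X p i ω) (lamHat p ω) (uHat p ω))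
    -- reference directions and the limits of their inner products with the true PC directions
    (v : (p : ℕ) → Fin r → Vec p) (A : Matrix (Fin m) (Fin r) ℝ)
    (h₁ : SpikedCovariance n m lam)
    (h₂ : RhoMixingScores P X mu lam u)
    (h₃ : ReferencesNonsingular n m v)
    (h₄ : ReferencesAligned u v A) :
    let thetaARG : ℕ → ℕ → Ω → ℝ := fun k p ω =>
      principalAngle k (argSubspace n m (lamHat p ω) (uHat p ω) (v p)) (leadingSpan m (u p))
    let theta : ℕ → ℕ → Ω → ℝ := fun k p ω =>
      principalAngle k (leadingSpan m (uHat p ω)) (leadingSpan m (u p))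
    (A.rank = min m r → ∀ k < m,
      Tendsto (fun p => P {ω | thetaARG k p ω < theta k p ω}) atTop (𝓝 1)) ∧
    (A.rank ≠ min m r ∧ A ≠ 0 → ∀ ε : ℝ, 0 < ε → ∀ k < m,
      Tendsto (fun p => P {ω | thetaARG k p ω < theta k p ω + ε}) atTop (𝓝 1)) ∧
    (A = 0 → ∀ k < m,
      TendstoInMeasure P (fun p ω => thetaARG k p ω - theta k p ω) atTop (fun _ => 0)) := by
  intro thetaARG theta
  -- a single nonzero column of `A` makes every angle decrease
  have hlt : A ≠ 0 → ∀ k < m,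
      Tendsto (fun p => P {ω | thetaARG k p ω < theta k p ω}) atTop (𝓝 1) := by
    intro hA k hk
    obtain ⟨k₀, hk₀⟩ : ∃ k₀, (fun s => A s k₀) ≠ 0 := by
      by_contra! h
      exact hA (by ext s k'; exact congrFun (h k') s)
    refine tendsto_measure_one_of_compl (tendsto_measure_zero_of_alignedLimits hm hmn hX hu huHat
      h₁ h₂ h₃ h₄ hk₀ _ fun l rho VG e c hal hgen hT => ?_)
    filter_upwards [eventually_principalAngle_lt hal hT
      (fun γ x hx hγ => ⟨k₀, hgen γ x hx hγ⟩) hk] with q hq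
    exact fun h => h hq
  refine ⟨fun hrank => hlt ?_, fun hA ε hε k hk => ?_, fun hA k hk => ?_⟩
  · rintro rfl
    rw [Matrix.rank_zero] at hrank
    omega
  · refine tendsto_of_tendsto_of_tendsto_of_le_of_le (hlt hA.2 k hk) tendsto_const_nhds
      (fun p => measure_mono fun ω hω => ?_) fun p => prob_le_one
    exact lt_add_of_lt_of_pos hω hε
  · subst hA
    rw [tendstoInMeasure_iff_dist]
    intro ε hε
    -- here only the full rank of `N` matters, and any nonzero vector will do
    have ha : (fun _ => 1 : Fin m → ℝ) ≠ 0 := fun h => one_ne_zero (congrFun h ⟨0, hm⟩)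
    refine tendsto_measure_zero_of_alignedLimits hm hmn hX hu huHat h₁ h₂ h₃ h₄ ha _
      fun l rho VG e c hal _ hT => ?_
    filter_upwards [(tendsto_principalAngle_sub hal hT hk).eventually
      (Metric.ball_mem_nhds 0 hε)] with q hq
    exact fun h => not_le.2 hq h
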